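/- Let $G$ be a finite simple graph with vertex set $V(G)=\{0,\dots,n-1\}$ and edge set $E(G)$, and let $c\colon V(G)\to\mathbb N$ be a capacity function (the value $0$ is allowed). A set $X\subseteq V(G)$ is a *capacitated vertex cover* of $(G,c)$ if there is a function $\alpha\colon E(G)\to X$ such that $\alpha(e)$ is an end vertex of $e$ for every edge $e$ and $|\alpha^{-1}(v)|\le c(v)$ for every $v\in X$. It is a *capacitated dominating set* of $(G,c)$ if there is a function $\beta\colon V(G)\setminus X\to X$ such that $\beta(w)$ is a neighbor of $w$ for every $w\in V(G)\setminus X$ and $|\beta^{-1}(v)|\le c(v)$ for every $v\in X$. Minimality is with respect to inclusion. Let $q=\max_{v\in V(G)}c(v)$ and let $\Delta$ be the maximum degree of $G$ (both are $0$ if $n=0$). An algorithm is a program of a random access machine in which every instruction, including every comparison of two registers, takes one time unit and whose only arithmetic operations are successor and predecessor. It is given $n$, the capacities and the adjacency matrix of $G$, and writes sets of vertices element by element. It enumerates a family $\mathcal S$ with delay $d$ on $(G,c)$ if it halts, outputs every member of $\mathcal S$ exactly once and nothing else, and the time before the first output, the time between any two consecutive outputs, and the time from the last output until it halts are each at most $d$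 (if $\mathcal S$ is empty, the total time is at most $d$). **Theorem.** There are an algorithm and a constant $k$ such that, on every instance $(G,c)$ as above, the algorithm enumerates the minimal capacitated vertex covers of $(G,c)$ with delay $$\max\{n,2\}^{\min\{q,\Delta\}+k}.$$ Likewise, there are an algorithm and a constant $k$ such that, on every instance $(G,c)$, the algorithm enumerates the minimal capacitated dominating sets of $(G,c)$ with the same delay bound $\max\{n,2\}^{\min\{q,\Delta\}+k}$. -/

import Mathlib

/-! ### Capacitated vertex covers and capacitated dominating sets -/

/-- `X` is a capacitated vertex cover of `(G, c)`: there is a function `α : E(G) → X` sending each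
edge to one of its end vertices such that at most `c v` edges are sent to each `v ∈ X`. -/
def IsCapacitatedVertexCover {V : Type*} [Finite V] (G : SimpleGraph V) (c : V → ℕ) (X : Finset V) : Prop :=
  ∃ α : G.edgeSet → X, (∀ e : G.edgeSet, (α e : V) ∈ (e : Sym2 V)) ∧
    ∀ v : X, Nat.card {e : G.edgeSet // α e = v} ≤ c v

/-- `X` is a capacitated dominating set of `(G, c)`: there is a function `β : V(G) \ X → X` sending
each vertex outside `X` to one of its neighbors such that at most `c v` vertices are sent to each
`v ∈ X`. -/
def IsCapacitatedDominatingSet {V : Type*} [Finite V] (G : SimpleGraph V) (c : V → ℕ) (X : Finset V) : Prop :=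
  ∃ β : {w : V // w ∉ X} → X, (∀ w : {w : V // w ∉ X}, G.Adj (w : V) (β w : V)) ∧
    ∀ v : X, Nat.card {w : {w : V // w ∉ X} // β w = v} ≤ c v

/-! ### Random access machines with output

The machine is a unit-cost random access machine with structured programs. The only arithmetic is
successor and predecessor, so the numbers in a run never exceed the largest number in the
program and the input plus the number of steps made so far; charging one time unit per instruction
is therefore a realistic measure. -/

namespace RAM

/-- A machine state: registers, addressed only by constants in the program; a memory, addressed
only through register contents; a write-only output buffer with the elements of the set that is
being written; a clock counting the instructions and tests executed so far; and the list, in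
chronological order, of the sets output so far, each with the time of its output. -/
structure State where
  reg : ℕ → ℕ
  mem : ℕ → ℕ
  buf : Finset ℕ
  clock : ℕ
  log : List (Finset ℕ × ℕ)

/-- The basic instructions. -/
inductive Instr where
  /-- `reg i := k` -/
  | const (i k : ℕ)
  /-- `reg i := reg j` -/
  | copy (i j : ℕ)
  /-- `reg i := reg i + 1` -/
  | incr (i : ℕ)
  /-- `reg i := reg i - 1` (truncated at `0`) -/
  | decr (i : ℕ)
  /-- `reg i := mem (reg j)` -/
  | load (i j : ℕ)
  /-- `mem (reg i) := reg j` -/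
  | store (i j : ℕ)
  /-- write the element `reg i` of the current output set -/
  | put (i : ℕ)
  /-- complete the current output set, and start a new, empty one -/
  | emit

/-- One time unit passes. -/
def State.tick (s : State) : State := { s with clock := s.clock + 1 }

/-- The effect of an instruction; each takes one time unit. -/
def Instr.run (a : Instr) (s : State) : State :=
  match a with
  | .const i k => { s.tick with reg := Function.update s.reg i k }
  | .copy i j => { s.tick with reg := Function.update s.reg i (s.reg j) }
  | .incr i => { s.tick with reg := Function.update s.reg i (s.reg i + 1) }
  | .decr i => { s.tick with reg := Function.update s.reg i (s.reg i - 1) }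
  | .load i j => { s.tick with reg := Function.update s.reg i (s.mem (s.reg j)) }
  | .store i j => { s.tick with mem := Function.update s.mem (s.reg i) (s.reg j) }
  | .put i => { s.tick with buf := insert (s.reg i) s.buf }
  | .emit => { s.tick with buf := ∅, log := s.log ++ [(s.buf, s.clock + 1)] }

/-- Programs. -/
inductive Prog where
  | instr (a : Instr)
  | seq (p q : Prog)
  /-- if `reg i < reg j` then `p` else `q` -/
  | ifLt (i j : ℕ) (p q : Prog)
  /-- while `reg i < reg j` do `p` -/
  | whileLt (i j : ℕ) (p : Prog)

/-- `Exec p s t`: the program `p`, started in state `s`, halts in state `t`. Every evaluation of the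
test of a conditional or of a loop takes one time unit. -/
inductive Exec : Prog → State → State → Prop where
  | instr (a : Instr) (s : State) : Exec (.instr a) s (a.run s)
  | seq {p q : Prog} {s t u : State} : Exec p s t → Exec q t u → Exec (.seq p q) s u
  | ifTrue {i j : ℕ} {p q : Prog} {s t : State} :
      s.reg i < s.reg j → Exec p s.tick t → Exec (.ifLt i j p q) s t
  | ifFalse {i j : ℕ} {p q : Prog} {s t : State} :
      ¬ s.reg i < s.reg j → Exec q s.tick t → Exec (.ifLt i j p q) s t
  | whileTrue {i j : ℕ} {p : Prog} {s t u : State} :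
      s.reg i < s.reg j → Exec p s.tick t → Exec (.whileLt i j p) t u → Exec (.whileLt i j p) s u
  | whileFalse {i j : ℕ} {p : Prog} {s : State} :
      ¬ s.reg i < s.reg j → Exec (.whileLt i j p) s s.tick

/-- The memory holding the instance `(G, c)`, where `G` has the vertices `0, …, n - 1`, as an array
with `n + 1` rows of length `n`: row `0` lists the capacities, and row `u + 1` is the row of `u` in
the adjacency matrix of `G`. All other cells are `0`. -/
def inputMem {n : ℕ} (G : SimpleGraph (Fin n)) [DecidableRel G.Adj] (c : Fin n → ℕ) : ℕ → ℕ :=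
  fun a =>
    if h : a % n < n then
      if a / n = 0 then c ⟨a % n, h⟩
      else if h' : a / n - 1 < n then (if G.Adj ⟨a / n - 1, h'⟩ ⟨a % n, h⟩ then 1 else 0)
      else 0
    else 0

/-- The initial state on the instance `(G, c)`: the number of vertices is in register `0`. -/
def initial {n : ℕ} (G : SimpleGraph (Fin n)) [DecidableRel G.Adj] (c : Fin n → ℕ) : State where
  reg := fun i => if i = 0 then n else 0
  mem := inputMem G c
  buf := ∅
  clock := 0
  log := []

/-- On the instance `(G, c)` the program `p` halts, having output each set of the family `𝓢`
exactly once and nothing else, such that the time before the first output, the time between any two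
consecutive outputs, and the time from the last output to the end of the computation are at most `d`
(if there is no output, the total time is at most `d`). -/
def EnumeratesWithDelay (p : Prog) {n : ℕ} (G : SimpleGraph (Fin n)) [DecidableRel G.Adj]
    (c : Fin n → ℕ) (𝓢 : Set (Finset (Fin n))) (d : ℕ) : Prop :=
  ∃ t : State, Exec p (initial G c) t ∧
    (t.log.map Prod.fst).Nodup ∧
    (∀ A : Finset ℕ, A ∈ t.log.map Prod.fst ↔ ∃ X ∈ 𝓢, X.map Fin.valEmbedding = A) ∧
    List.IsChain (fun a b : ℕ => b ≤ a + d) (0 :: (t.log.map Prod.snd ++ [t.clock]))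

end RAM

/-! Both problems are assignment problems. Each demand (an edge, respectively a vertex) needs its
own slot among the slots of the chosen vertices. A vertex has as many slots as its capacity; for
domination it has a further slot 0, reserved for serving itself. Whether the slots of a set suffice
is monotone in the set.

The combinatorial core is `Assignment.Sol.exchange`. Let `f` and `g` be assignments into the slots
of `X` and `Y`, where `v ∉ Y`. Start from the demands that `f` serves at `v`, move each of them to
its slot under `g`, then move the demand that `f` had put there, and so on. These alternating paths
are disjoint, so they end in at most as many fresh slots as `v` served demands. That number is at
most `min q Δ + 1`, by the number of slots and by the size of the closed neighbourhood. Now let `X`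
and `T` be minimal solutions and `v ∈ X \ T`. The exchange inside `(X ∪ T) \ {v}` gives a small `S`
such that `(X ∪ S) \ {v}` is a solution, and each minimal solution below it has a strictly smaller
union with `T`. Hence the moves from `X` to a minimal subset of `(X ∪ S) \ {v}` lead from any
minimal solution to every other one (`Assignment.MinSol.mem_of_closed`).

The algorithm is a breadth-first search along these moves, with at most `n * n ^ (min q Δ + 1)`
moves from each solution. A candidate is tested by an auction for bipartite matching
(`auction_den`), is made minimal greedily, and is looked up in a binary search tree on bit vectors
(`insertRecord_den`). A lookup takes about `n` steps, however many sets are stored. Every round of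
the main loop outputs one stored solution and then performs its moves, so the delay is essentially
the time of one round.

For the time bounds, the algorithm is written in a language of bounded loops, in which the cost of a
statement depends only on `n` and on the number `R` of rounds of the long loops. `St.comp_run`
transfers meaning and cost to the machine, and `St.polyR_cost` reads off from the syntax that the
cost is a polynomial in `n` times `R + 1`. With `R = n ^ (min q Δ + 1)` this is the asserted delay.
-/

namespace RAM

/-! ### Total correctness with time bounds -/

/-- Started in `s`, the program `p` halts within `b` time units in a state satisfying `Q`. -/
def Run (p : Prog) (s : State) (b : ℕ) (Q : State → Prop) : Prop :=
  ∃ t, Exec p s t ∧ t.clock ≤ s.clock + b ∧ Q t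

@[simp] theorem tick_reg (s : State) : s.tick.reg = s.reg := rfl
@[simp] theorem tick_mem (s : State) : s.tick.mem = s.mem := rfl
@[simp] theorem tick_buf (s : State) : s.tick.buf = s.buf := rfl
@[simp] theorem tick_log (s : State) : s.tick.log = s.log := rfl
@[simp] theorem tick_clock (s : State) : s.tick.clock = s.clock + 1 := rfl

theorem Run.instr {a : Instr} {s : State} {Q : State → Prop} (h : Q (a.run s)) :
    Run (.instr a) s 1 Q :=
  ⟨_, .instr a s, by cases a <;> simp [Instr.run], h⟩

theorem Run.mono {p : Prog} {s : State} {b b' : ℕ} {Q Q' : State → Prop} (h : Run p s b Q)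
    (hb : b ≤ b') (hQ : ∀ t, Q t → Q' t) : Run p s b' Q' := by
  obtain ⟨t, h1, h2, h3⟩ := h
  exact ⟨t, h1, by omega, hQ t h3⟩

theorem Run.seq {p q : Prog} {s : State} {b b' : ℕ} {Q : State → Prop}
    (h : Run p s b fun t => Run q t b' Q) : Run (.seq p q) s (b + b') Q := by
  obtain ⟨t, h1, h2, u, h3, h4, h5⟩ := h
  exact ⟨u, .seq h1 h3, by omega, h5⟩

theorem Run.ifLt {i j : ℕ} {p q : Prog} {s : State} {b : ℕ} {Q : State → Prop}
    (h1 : s.reg i < s.reg j → Run p s.tick b Q)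
    (h2 : ¬ s.reg i < s.reg j → Run q s.tick b Q) : Run (.ifLt i j p q) s (b + 1) Q := by
  by_cases h : s.reg i < s.reg j
  · obtain ⟨t, h3, h4, h5⟩ := h1 h
    exact ⟨t, .ifTrue h h3, by simp at h4; omega, h5⟩
  · obtain ⟨t, h3, h4, h5⟩ := h2 h
    exact ⟨t, .ifFalse h h3, by simp at h4; omega, h5⟩

/-- A loop that makes `N` rounds. -/
theorem Run.whileLt {i j : ℕ} {p : Prog} {s : State} {b : ℕ} {Q : State → Prop}
    (I : ℕ → State → Prop) (N : ℕ) (h0 : I 0 s)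
    (hi : ∀ k t, I k t → k ≤ N → (t.reg i < t.reg j ↔ k < N))
    (hs : ∀ k < N, ∀ t, I k t → Run p t.tick b (I (k + 1)))
    (hQ : ∀ t, I N t → Q t.tick) : Run (.whileLt i j p) s (N * (b + 1) + 1) Q := by
  have key : ∀ m k s, m + k = N → I k s → Run (.whileLt i j p) s (m * (b + 1) + 1) Q := by
    intro m
    induction m with
    | zero =>
      intro k s hk hI
      have hk : k = N := by omega
      subst hk
      exact ⟨_, .whileFalse (fun h => by simpa using (hi k s hI le_rfl).1 h), by simp, hQ s hI⟩
    | succ m ih =>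
      intro k s hk hI
      obtain ⟨t, h1, h2, h3⟩ := hs k (by omega) s hI
      obtain ⟨u, h4, h5, h6⟩ := ih (k + 1) t (by omega) h3
      refine ⟨u, .whileTrue ((hi k s hI (by omega)).2 (by omega)) h1 h4, ?_, h6⟩
      simp only [tick_clock] at h2
      rw [Nat.succ_mul]
      omega
  exact key N 0 s rfl h0

/-- Scratch registers. -/
def sc (r : ℕ) : ℕ := 2 * r + 6

/-- The states `s` and `t` differ at most in the clock and in the registers in `A`. -/
def Same (A : ℕ → Prop) (s t : State) : Prop :=
  t.mem = s.mem ∧ t.buf = s.buf ∧ t.log = s.log ∧ ∀ x, ¬ A x → t.reg x = s.reg x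

theorem Same.trans {A B C : ℕ → Prop} {s t u : State} (h : Same A s t) (h' : Same B t u)
    (hA : ∀ x, A x → C x) (hB : ∀ x, B x → C x) : Same C s u :=
  ⟨h'.1.trans h.1, h'.2.1.trans h.2.1, h'.2.2.1.trans h.2.2.1, fun x hx =>
    (h'.2.2.2 x fun h => hx (hB x h)).trans (h.2.2.2 x fun h => hx (hA x h))⟩

theorem Same.mono {A B : ℕ → Prop} {s t : State} (h : Same A s t) (hA : ∀ x, A x → B x) :
    Same B s t :=
  ⟨h.1, h.2.1, h.2.2.1, fun x hx => h.2.2.2 x fun h => hx (hA x h)⟩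

/-- `reg a := reg a + reg y` -/
def addReg (a y r : ℕ) : Prog :=
  .seq (.instr (.const (sc r) 0))
    (.whileLt (sc r) y (.seq (.instr (.incr a)) (.instr (.incr (sc r)))))

/-- With only a successor available, an addition takes time linear in the summand. Summands must
therefore be bounded in terms of `n` wherever this is used. -/
theorem addReg_run {a y r : ℕ} (s : State) (ha : a ≠ sc r) (hy : y ≠ sc r) (hay : a ≠ y) :
    Run (addReg a y r) s (3 * s.reg y + 2) fun t =>
      t.reg a = s.reg a + s.reg y ∧ Same (fun x => x = a ∨ x = sc r) s t := by
  refine Run.mono (Run.seq (b' := s.reg y * 3 + 1) (Run.instr ?_)) (by omega) (fun _ h => h)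
  refine Run.whileLt (fun k t => t.reg (sc r) = k ∧ t.reg a = s.reg a + k ∧
    Same (fun x => x = a ∨ x = sc r) s t) (s.reg y) ?_ ?_ ?_ ?_
  · refine ⟨by simp [Instr.run], by simp [Instr.run, ha], rfl, rfl, rfl, ?_⟩
    intro x hx
    push Not at hx
    simp [Instr.run, hx.2]
  · rintro k t ⟨h1, h2, h3⟩ hk
    rw [h1, h3.2.2.2 y (by simp [hay.symm, hy])]
  · rintro k hk t ⟨h1, h2, h3⟩
    refine Run.seq (Run.instr (Run.instr ⟨?_, ?_, ?_⟩))
    · simp [Instr.run, ha.symm, h1]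
    · simp [Instr.run, ha, h2]; omega
    · refine ⟨by simp [Instr.run, h3.1], by simp [Instr.run, h3.2.1],
        by simp [Instr.run, h3.2.2.1], fun x hx => ?_⟩
      rw [← h3.2.2.2 x hx]
      push Not at hx
      simp [Instr.run, hx.1, hx.2]
  · rintro t ⟨h1, h2, h3⟩
    exact ⟨h2, h3⟩

/-- `reg a := reg a + min (reg x) (reg 1) * reg y` -/
def addMul (a x y r : ℕ) : Prog :=
  .seq (.instr (.const (sc r) 0))
    (.whileLt (sc r) 1 (.seq
      (.ifLt (sc r) x (addReg a y (r + 1)) (.instr (.const (sc (r + 1)) 0)))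
      (.instr (.incr (sc r)))))

/-- The loop always makes `reg 1` rounds and stops adding once it has passed `reg x`. So the time
does not depend on `reg x`, which may hold an arbitrarily large capacity. -/
theorem addMul_run {a x y r : ℕ} (s : State) (ha : a ≠ sc r) (hx : x ≠ sc r) (hy : y ≠ sc r)
    (ha' : a ≠ sc (r + 1)) (hx' : x ≠ sc (r + 1)) (hy' : y ≠ sc (r + 1))
    (hax : a ≠ x) (hay : a ≠ y) (ha1 : a ≠ 1) :
    Run (addMul a x y r) s (s.reg 1 * (3 * s.reg y + 5) + 2) fun t =>
      t.reg a = s.reg a + min (s.reg x) (s.reg 1) * s.reg y ∧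
      Same (fun z => z = a ∨ z = sc r ∨ z = sc (r + 1)) s t := by
  refine Run.mono (Run.seq (b' := s.reg 1 * ((3 * s.reg y + 2 + 1) + 1 + 1) + 1) (Run.instr ?_))
    (by simp only [Nat.mul_add]; omega) (fun _ h => h)
  have hsc : sc r ≠ sc (r + 1) := by simp [sc]
  have h1sc : (1 : ℕ) ≠ sc r ∧ (1 : ℕ) ≠ sc (r + 1) := by constructor <;> simp only [sc] <;> omega
  refine Run.whileLt (fun k t => t.reg (sc r) = k ∧
    t.reg a = s.reg a + min (s.reg x) k * s.reg y ∧
    Same (fun z => z = a ∨ z = sc r ∨ z = sc (r + 1)) s t) (s.reg 1) ?_ ?_ ?_ ?_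
  · refine ⟨by simp [Instr.run], by simp [Instr.run, ha], rfl, rfl, rfl, ?_⟩
    intro z hz
    push Not at hz
    simp [Instr.run, hz.2]
  · rintro k t ⟨h1, h2, h3⟩ hk
    rw [h1, h3.2.2.2 1 (by simp [ha1.symm, h1sc])]
  · rintro k hk t ⟨h1, h2, h3⟩
    have ex : t.reg x = s.reg x := h3.2.2.2 x (by simp [hax.symm, hx, hx'])
    have ey : t.reg y = s.reg y := h3.2.2.2 y (by simp [hay.symm, hy, hy'])
    refine Run.seq (b := 3 * s.reg y + 2 + 1) (b' := 1) (Run.ifLt (fun hlt => ?_) (fun hlt => ?_))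
    · simp only [tick_reg] at hlt ⊢
      refine Run.mono (addReg_run t.tick.tick ha' hy' hay) (by simp [ey]) ?_
      rintro u ⟨h4, h5⟩
      refine Run.instr ⟨?_, ?_, ?_⟩
      · simp only [Instr.run, Function.update_self]
        rw [h5.2.2.2 (sc r) (by simp [ha.symm, hsc])]
        simp [h1]
      · have e1 : min (s.reg x) k = k := min_eq_right (by omega)
        have e2 : min (s.reg x) (k + 1) = k + 1 := min_eq_right (by omega)
        simp only [Instr.run, Function.update_of_ne ha]
        simp only [h4, tick_reg, h2, ey, e1, e2]
        ring
      · have h6 : Same (fun z => z = a ∨ z = sc r ∨ z = sc (r + 1)) t u :=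
          Same.trans (A := fun _ => False) ⟨rfl, rfl, rfl, fun _ _ => rfl⟩ h5 (by simp) (by tauto)
        have h7 := Same.trans (C := fun z => z = a ∨ z = sc r ∨ z = sc (r + 1)) h3 h6
          (fun _ h => h) (fun _ h => h)
        refine ⟨by simp [Instr.run, h7.1], by simp [Instr.run, h7.2.1],
          by simp [Instr.run, h7.2.2.1], fun z hz => ?_⟩
        rw [← h7.2.2.2 z hz]
        push Not at hz
        simp [Instr.run, hz.2.1]
    · simp only [tick_reg] at hlt ⊢
      refine Run.mono (b := 1) (Run.instr (Run.instr ⟨?_, ?_, ?_⟩)) (by omega) (fun _ h => h)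
      · simp [Instr.run, hsc, h1]
      · have e1 : min (s.reg x) k = s.reg x := min_eq_left (by omega)
        have e2 : min (s.reg x) (k + 1) = s.reg x := min_eq_left (by omega)
        simp [Instr.run, ha, ha', h2, e1, e2]
      · refine ⟨by simp [Instr.run, h3.1], by simp [Instr.run, h3.2.1],
          by simp [Instr.run, h3.2.2.1], fun z hz => ?_⟩
        rw [← h3.2.2.2 z hz]
        push Not at hz
        simp [Instr.run, hz.2.1, hz.2.2]
  · rintro t ⟨h1, h2, h3⟩
    exact ⟨h2, h3⟩

/-- `reg a := reg a + b * reg 3` -/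
def addBase (a r : ℕ) : ℕ → Prog
  | 0 => .instr (.const (sc r) 0)
  | b + 1 => .seq (addReg a 3 r) (addBase a r b)

theorem addBase_run {a r : ℕ} (ha : a ≠ sc r) (ha3 : a ≠ 3) (b : ℕ) (s : State) :
    Run (addBase a r b) s (b * (3 * s.reg 3 + 2) + 1) fun t =>
      t.reg a = s.reg a + b * s.reg 3 ∧ Same (fun x => x = a ∨ x = sc r) s t := by
  have h3 : 3 ≠ sc r := by simp only [sc]; omega
  induction b generalizing s with
  | zero =>
    refine Run.mono (Run.instr ?_) (by omega) (fun _ h => h)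
    refine ⟨by simp [Instr.run, ha], rfl, rfl, rfl, fun x hx => ?_⟩
    push Not at hx
    simp [Instr.run, hx.2]
  | succ b ih =>
    refine Run.mono (Run.seq (b' := b * (3 * s.reg 3 + 2) + 1)
      ((addReg_run s ha h3 ha3).mono le_rfl ?_)) (le_of_eq (by ring)) (fun _ h => h)
    rintro t ⟨h4, h5⟩
    have e3 : t.reg 3 = s.reg 3 := h5.2.2.2 3 (by simp [ha3.symm, h3])
    refine (ih t).mono (by rw [e3]) ?_
    rintro u ⟨h6, h7⟩
    refine ⟨?_, h5.trans h7 (fun _ h => h) (fun _ h => h)⟩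
    rw [h6, h4, e3]
    ring

end RAM

namespace RAM

/-! ### A language of bounded loops -/

/-- The parameters of a run: the number of vertices, the number of rounds of the long loops, and
the input. -/
structure Env where
  n : ℕ
  R : ℕ
  inp : ℕ → ℕ

/-- Variables. -/
inductive Var
  | maxCap | maxDeg | deg | width
  | demU | demW | curU | curW | unmet | slotV | slotI | seen | bestV | bestI | round
  | trial | pos | found | ptr | cell | free
  | head | gone | turn | carry
  deriving DecidableEq

/-- Arrays. -/
inductive Arr
  | cand | mark | holdU | holdW | price | dig
  deriving DecidableEq

/-- The number of an array. -/
def Arr.idx (k : Arr) : ℕ := k.ctorIdx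

theorem Arr.idx_lt (k : Arr) : k.idx < 6 := by cases k <;> decide

theorem Arr.idx_inj {k k' : Arr} (h : k.idx = k'.idx) : k = k' := by
  revert h; cases k <;> cases k' <;> decide

/-- Registers holding variables. -/
def vr (v : Var) : ℕ := 2 * v.ctorIdx + 7

theorem vr_inj {v w : Var} (h : vr v = vr w) : v = w := by
  have : v.ctorIdx = w.ctorIdx := by simp only [vr] at h; omega
  revert this; cases v <;> cases w <;> decide

/-- Bounds of loops. -/
inductive Lim
  | n | N | R

/-- The value of a bound. -/
def Lim.val (ρ : Env) : Lim → ℕ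
  | .n => ρ.n
  | .N => ρ.n + 2
  | .R => ρ.R

/-- The register holding a bound. -/
def Lim.reg : Lim → ℕ
  | .n => 0
  | .N => 1
  | .R => 2

/-- The state of a program: variables, six arrays, a heap, and the output buffer. -/
structure HState where
  var : Var → ℕ
  arr : Arr → ℕ → ℕ → ℕ
  heap : ℕ → ℕ
  buf : Finset ℕ

/-- Expressions. -/
inductive Ex
  | var (v : Var)
  | const (k : ℕ)
  | lim (l : Lim)
  | succ (e : Ex)
  | add (e₁ e₂ : Ex)
  | arr (k : Arr) (e₁ e₂ : Ex)
  | heap (e : Ex)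
  | inp (e₁ e₂ : Ex)
  /-- if `e₁ < e₂` then `a` else `b` -/
  | ite (e₁ e₂ a b : Ex)

/-- The value of an expression. Summands and indices are cut off at `n + 2`. -/
def Ex.eval (ρ : Env) (σ : HState) : Ex → ℕ
  | .var v => σ.var v
  | .const k => k
  | .lim l => l.val ρ
  | .succ e => e.eval ρ σ + 1
  | .add e₁ e₂ => e₁.eval ρ σ + min (e₂.eval ρ σ) (ρ.n + 2)
  | .arr k e₁ e₂ => σ.arr k (min (e₁.eval ρ σ) (ρ.n + 2)) (min (e₂.eval ρ σ) (ρ.n + 2))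
  | .heap e => σ.heap (e.eval ρ σ)
  | .inp e₁ e₂ => ρ.inp (min (e₁.eval ρ σ) (ρ.n + 2) * ρ.n + min (e₂.eval ρ σ) (ρ.n + 2))
  | .ite e₁ e₂ a b => if e₁.eval ρ σ < e₂.eval ρ σ then a.eval ρ σ else b.eval ρ σ

/-- Statements. -/
inductive St
  | skip
  | set (v : Var) (e : Ex)
  | aset (k : Arr) (e₁ e₂ e : Ex)
  | hset (e₁ e : Ex)
  | out (e : Ex)
  | seq (p q : St)
  /-- if `e₁ < e₂` then `p` else `q` -/
  | ite (e₁ e₂ : Ex) (p q : St)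
  /-- for `v` from `0` to `l - 1` do `p` -/
  | loop (l : Lim) (v : Var) (p : St)

/-- Assignment to a variable. -/
def HState.setv (σ : HState) (v : Var) (x : ℕ) : HState := { σ with var := Function.update σ.var v x }

/-- Assignment to an array cell. -/
def HState.seta (σ : HState) (k : Arr) (i j x : ℕ) : HState :=
  { σ with arr := fun k' i' j' => if k' = k ∧ i' = i ∧ j' = j then x else σ.arr k' i' j' }

/-- Assignment to a heap cell. -/
def HState.seth (σ : HState) (a x : ℕ) : HState := { σ with heap := Function.update σ.heap a x }

/-- The effect of `m` rounds of a loop. -/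
def iter (f : ℕ → HState → HState) : ℕ → HState → HState
  | 0, σ => σ
  | m + 1, σ => f m (iter f m σ)

/-- The effect of a statement. -/
def St.den (ρ : Env) : St → HState → HState
  | .skip, σ => σ
  | .set v e, σ => σ.setv v (e.eval ρ σ)
  | .aset k e₁ e₂ e, σ =>
    σ.seta k (min (e₁.eval ρ σ) (ρ.n + 2)) (min (e₂.eval ρ σ) (ρ.n + 2)) (e.eval ρ σ)
  | .hset e₁ e, σ => σ.seth (e₁.eval ρ σ) (e.eval ρ σ)
  | .out e, σ => { σ with buf := insert (e.eval ρ σ) σ.buf }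
  | .seq p q, σ => q.den ρ (p.den ρ σ)
  | .ite e₁ e₂ p q, σ => if e₁.eval ρ σ < e₂.eval ρ σ then p.den ρ σ else q.den ρ σ
  | .loop l v p, σ => iter (fun k τ => p.den ρ (τ.setv v k)) (l.val ρ) σ

/-! ### Compilation -/

/-- Computes the address `b * reg 3 + min e₁ (n + 2) * reg y + min e₂ (n + 2)`, where the values of
`e₁` and `e₂` are in the scratch registers `r + 1` and `r + 2`. -/
def addr (b y r : ℕ) : Prog :=
  .seq (.instr (.const (sc r) 0)) (.seq (addBase (sc r) (r + 3) b)
    (.seq (addMul (sc r) (sc (r + 1)) y (r + 3)) (addMul (sc r) (sc (r + 2)) 5 (r + 3))))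

/-- A program computing the value of an expression in the scratch register `r`. -/
def Ex.comp : Ex → ℕ → Prog
  | .var v, r => .instr (.copy (sc r) (vr v))
  | .const k, r => .instr (.const (sc r) k)
  | .lim l, r => .instr (.copy (sc r) l.reg)
  | .succ e, r => .seq (e.comp r) (.instr (.incr (sc r)))
  | .add e₁ e₂, r =>
    .seq (e₁.comp r) (.seq (e₂.comp (r + 1)) (addMul (sc r) (sc (r + 1)) 5 (r + 2)))
  | .arr k e₁ e₂, r => .seq (e₁.comp (r + 1)) (.seq (e₂.comp (r + 2))
      (.seq (addr (k.idx + 1) 4 r) (.instr (.load (sc r) (sc r)))))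
  | .heap e, r => .seq (e.comp r) (.seq (addBase (sc r) (r + 1) 7) (.instr (.load (sc r) (sc r))))
  | .inp e₁ e₂, r => .seq (e₁.comp (r + 1)) (.seq (e₂.comp (r + 2))
      (.seq (addr 0 0 r) (.instr (.load (sc r) (sc r)))))
  | .ite e₁ e₂ a b, r =>
    .seq (e₁.comp r) (.seq (e₂.comp (r + 1)) (.ifLt (sc r) (sc (r + 1)) (a.comp r) (b.comp r)))

/-- A program carrying out a statement with the scratch registers from `r` on. -/
def St.comp : St → ℕ → Prog
  | .skip, r => .instr (.const (sc r) 0)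
  | .set v e, r => .seq (e.comp r) (.instr (.copy (vr v) (sc r)))
  | .aset k e₁ e₂ e, r => .seq (e₁.comp (r + 1)) (.seq (e₂.comp (r + 2))
      (.seq (addr (k.idx + 1) 4 r) (.seq (e.comp (r + 1)) (.instr (.store (sc r) (sc (r + 1)))))))
  | .hset e₁ e, r => .seq (e₁.comp r) (.seq (addBase (sc r) (r + 1) 7)
      (.seq (e.comp (r + 1)) (.instr (.store (sc r) (sc (r + 1))))))
  | .out e, r => .seq (e.comp r) (.instr (.put (sc r)))
  | .seq p q, r => .seq (p.comp r) (q.comp r)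
  | .ite e₁ e₂ p q, r =>
    .seq (e₁.comp r) (.seq (e₂.comp (r + 1)) (.ifLt (sc r) (sc (r + 1)) (p.comp r) (q.comp r)))
  | .loop l v p, r => .seq (.instr (.const (sc r) 0)) (.whileLt (sc r) l.reg
      (.seq (.instr (.copy (vr v) (sc r))) (.seq (p.comp (r + 1)) (.instr (.incr (sc r))))))

/-- Time bound for `addMul` with a factor `y`. -/
def mulCost (n y : ℕ) : ℕ := (n + 2) * (3 * y + 5) + 2

/-- Time bound for `addBase`. -/
def baseCost (n b : ℕ) : ℕ := b * (3 * (n + 3) ^ 2 + 2) + 1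

/-- Time bound for `addr`. -/
def addrCost (n b y : ℕ) : ℕ := 1 + (baseCost n b + (mulCost n y + mulCost n 1))

/-- Time bound for the evaluation of an expression. -/
def Ex.cost (n : ℕ) : Ex → ℕ
  | .var _ => 1
  | .const _ => 1
  | .lim _ => 1
  | .succ e => e.cost n + 1
  | .add e₁ e₂ => e₁.cost n + (e₂.cost n + mulCost n 1)
  | .arr k e₁ e₂ => e₁.cost n + (e₂.cost n + (addrCost n (k.idx + 1) (n + 3) + 1))
  | .heap e => e.cost n + (baseCost n 7 + 1)
  | .inp e₁ e₂ => e₁.cost n + (e₂.cost n + (addrCost n 0 n + 1))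
  | .ite e₁ e₂ a b => e₁.cost n + (e₂.cost n + (max (a.cost n) (b.cost n) + 1))

/-- Time bound for a statement. -/
def St.cost (ρ : Env) : St → ℕ
  | .skip => 1
  | .set _ e => e.cost ρ.n + 1
  | .aset k e₁ e₂ e =>
    e₁.cost ρ.n + (e₂.cost ρ.n + (addrCost ρ.n (k.idx + 1) (ρ.n + 3) + (e.cost ρ.n + 1)))
  | .hset e₁ e => e₁.cost ρ.n + (baseCost ρ.n 7 + (e.cost ρ.n + 1))
  | .out e => e.cost ρ.n + 1
  | .seq p q => p.cost ρ + q.cost ρ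
  | .ite e₁ e₂ p q => e₁.cost ρ.n + (e₂.cost ρ.n + (max (p.cost ρ) (q.cost ρ) + 1))
  | .loop l _ p => 1 + (l.val ρ * (1 + (p.cost ρ + 1) + 1) + 1)

/-! ### Simulation of the loop language on the machine, with time bounds -/

/-- The machine state `s` represents the state `σ`. -/
structure Rep (ρ : Env) (s : State) (σ : HState) : Prop where
  reg_n : s.reg 0 = ρ.n
  reg_N : s.reg 1 = ρ.n + 2
  reg_R : s.reg 2 = ρ.R
  reg_Q : s.reg 3 = (ρ.n + 3) ^ 2
  reg_S : s.reg 4 = ρ.n + 3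
  reg_one : s.reg 5 = 1
  var : ∀ v, s.reg (vr v) = σ.var v
  inp : ∀ a < (ρ.n + 3) ^ 2, s.mem a = ρ.inp a
  arr : ∀ (k : Arr) (i j : ℕ), i ≤ ρ.n + 2 → j ≤ ρ.n + 2 →
    s.mem ((k.idx + 1) * (ρ.n + 3) ^ 2 + i * (ρ.n + 3) + j) = σ.arr k i j
  heap : ∀ x, s.mem (7 * (ρ.n + 3) ^ 2 + x) = σ.heap x
  buf : s.buf = σ.buf

theorem Rep.congr {ρ : Env} {s t : State} {σ : HState} {A : ℕ → Prop} (h : Rep ρ s σ)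
    (hs : Same A s t) (h5 : ∀ x ≤ 5, ¬ A x) (hv : ∀ v, ¬ A (vr v)) : Rep ρ t σ where
  reg_n := by rw [hs.2.2.2 _ (h5 _ (by omega)), h.reg_n]
  reg_N := by rw [hs.2.2.2 _ (h5 _ (by omega)), h.reg_N]
  reg_R := by rw [hs.2.2.2 _ (h5 _ (by omega)), h.reg_R]
  reg_Q := by rw [hs.2.2.2 _ (h5 _ (by omega)), h.reg_Q]
  reg_S := by rw [hs.2.2.2 _ (h5 _ (by omega)), h.reg_S]
  reg_one := by rw [hs.2.2.2 _ (h5 _ (by omega)), h.reg_one]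
  var v := by rw [hs.2.2.2 _ (hv v), h.var]
  inp := by rw [hs.1]; exact h.inp
  arr := by rw [hs.1]; exact h.arr
  heap := by rw [hs.1]; exact h.heap
  buf := by rw [hs.2.1, h.buf]

/-- The scratch registers from `r` on. -/
def IsScratch (r x : ℕ) : Prop := ∃ r', r ≤ r' ∧ x = sc r'

theorem not_isScratch_of_le {r x : ℕ} (hx : x ≤ 5) : ¬ IsScratch r x := by
  rintro ⟨r', -, rfl⟩
  simp only [sc] at hx
  omega

/-- Scratch registers have even numbers, variables have odd numbers. -/
theorem not_isScratch_vr {r : ℕ} {v : Var} : ¬ IsScratch r (vr v) := by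
  rintro ⟨r', -, h⟩
  simp only [sc, vr] at h
  omega

theorem not_isScratch_sc {r r' : ℕ} (h : r' < r) : ¬ IsScratch r (sc r') := by
  rintro ⟨r'', h1, h2⟩
  simp only [sc] at h2
  omega

theorem IsScratch.mono {r r' x : ℕ} (h : IsScratch r x) (hr : r' ≤ r) : IsScratch r' x := by
  obtain ⟨r'', h1, h2⟩ := h
  exact ⟨r'', by omega, h2⟩

theorem isScratch_sc {r r' : ℕ} (h : r ≤ r') : IsScratch r (sc r') := ⟨r', h, rfl⟩

theorem Rep.congr_scratch {ρ : Env} {s t : State} {σ : HState} {r : ℕ} (h : Rep ρ s σ)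
    (hs : Same (IsScratch r) s t) : Rep ρ t σ :=
  h.congr hs (fun _ => not_isScratch_of_le) (fun _ => not_isScratch_vr)

theorem addr_run {ρ : Env} {s : State} {σ : HState} (h : Rep ρ s σ) (b y r : ℕ) (hy : y ≤ 5) :
    Run (addr b y r) s (addrCost ρ.n b (s.reg y)) fun t =>
      t.reg (sc r) = b * (ρ.n + 3) ^ 2 + min (s.reg (sc (r + 1))) (ρ.n + 2) * s.reg y +
        min (s.reg (sc (r + 2))) (ρ.n + 2) ∧
      Same (fun x => x = sc r ∨ IsScratch (r + 3) x) s t := by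
  let A : ℕ → Prop := fun x => x = sc r ∨ IsScratch (r + 3) x
  have hsame : Same A s ((Instr.const (sc r) 0).run s) :=
    ⟨rfl, rfl, rfl, fun x hx => by
      have : x ≠ sc r := fun h => hx (Or.inl h)
      simp [Instr.run, this]⟩
  have low : ∀ x ≤ 5, ¬ A x := by
    rintro x hx (h | h)
    · simp only [sc] at h; omega
    · exact not_isScratch_of_le hx h
  have hA1 : ¬ A (sc (r + 1)) := by
    rintro (h | h)
    · simp only [sc] at h; omega
    · exact not_isScratch_sc (by omega) h
  have hA2 : ¬ A (sc (r + 2)) := by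
    rintro (h | h)
    · simp only [sc] at h; omega
    · exact not_isScratch_sc (by omega) h
  have sub : ∀ x, (x = sc r ∨ x = sc (r + 3) ∨ x = sc (r + 3 + 1)) → A x := by
    rintro x (h | h | h)
    · exact Or.inl h
    · exact Or.inr ⟨_, le_rfl, h⟩
    · exact Or.inr ⟨_, by omega, h⟩
  refine Run.seq (Run.instr (Run.seq ?_))
  have e3 := hsame.2.2.2 3 (low 3 (by omega))
  refine (addBase_run (by simp only [sc, ne_eq]; omega) (by simp only [sc, ne_eq]; omega) b
    ((Instr.const (sc r) 0).run s)).mono (by rw [e3, h.reg_Q]; rfl) ?_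
  rintro t ⟨h1, h2⟩
  have s2 : Same A s t := hsame.trans h2 (fun _ h => h) (fun x hx => sub x (by tauto))
  refine Run.seq ((addMul_run t (a := sc r) (x := sc (r + 1)) (y := y) (r := r + 3)
    ?_ ?_ ?_ ?_ ?_ ?_ ?_ ?_ ?_).mono ?_ ?_)
  any_goals (simp only [sc, ne_eq]; omega)
  · rw [s2.2.2.2 1 (low 1 (by omega)), s2.2.2.2 y (low y hy), h.reg_N]; rfl
  rintro u ⟨h3, h4⟩
  have s3 : Same A s u := s2.trans h4 (fun _ h => h) sub
  refine (addMul_run u (a := sc r) (x := sc (r + 2)) (y := 5) (r := r + 3)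
    ?_ ?_ ?_ ?_ ?_ ?_ ?_ ?_ ?_).mono ?_ ?_
  any_goals (simp only [sc, ne_eq]; omega)
  · rw [s3.2.2.2 1 (low 1 (by omega)), s3.2.2.2 5 (low 5 (by omega)), h.reg_N, h.reg_one]; rfl
  rintro w ⟨h5, h6⟩
  refine ⟨?_, s3.trans h6 (fun _ h => h) sub⟩
  rw [h5, h3, h1, s3.2.2.2 1 (low 1 (by omega)), s3.2.2.2 5 (low 5 (by omega)),
    s3.2.2.2 _ hA2, s2.2.2.2 1 (low 1 (by omega)), s2.2.2.2 y (low y hy), s2.2.2.2 _ hA1, e3,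
    h.reg_N, h.reg_one, h.reg_Q]
  simp [Instr.run]

/-- Intermediate values are kept in the scratch registers below the one in use. The induction
carries along that evaluation at level `r` touches only scratch registers from `r` on, so values
already computed at lower levels survive. -/
theorem Ex.comp_run {ρ : Env} {σ : HState} (e : Ex) (r : ℕ) (s : State) (h : Rep ρ s σ) :
    Run (e.comp r) s (e.cost ρ.n) fun t =>
      t.reg (sc r) = e.eval ρ σ ∧ Same (IsScratch r) s t := by
  have single : ∀ (s : State) (r x : ℕ), Same (IsScratch r) s
      { s.tick with reg := Function.update s.reg (sc r) x } := fun s r x =>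
    ⟨rfl, rfl, rfl, fun y hy => by
      have : y ≠ sc r := fun h => hy ⟨r, le_rfl, h⟩
      simp [this]⟩
  have up : ∀ (r k x : ℕ), IsScratch (r + k) x → IsScratch r x := fun r k x h => h.mono (by omega)
  have addrsub : ∀ r x, (x = sc r ∨ IsScratch (r + 3) x) → IsScratch r x := by
    rintro r x (h | h)
    · exact ⟨r, le_rfl, h⟩
    · exact up _ _ _ h
  induction e generalizing r s with
  | var v => exact Run.instr ⟨by simp [Instr.run, eval, h.var], single _ _ _⟩
  | const k => exact Run.instr ⟨by simp [Instr.run, eval], single _ _ _⟩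
  | lim l =>
    refine Run.instr ⟨?_, single _ _ _⟩
    cases l <;> simp [Instr.run, eval, Lim.reg, Lim.val, h.reg_n, h.reg_N, h.reg_R]
  | succ e ih =>
    refine Run.seq ((ih r s h).mono le_rfl ?_)
    rintro t ⟨h1, h2⟩
    exact Run.instr ⟨by simp [Instr.run, eval, h1],
      h2.trans (single _ _ _) (fun _ h => h) (fun _ h => h)⟩
  | add e₁ e₂ ih₁ ih₂ =>
    refine Run.seq ((ih₁ r s h).mono le_rfl ?_)
    rintro t ⟨h1, h2⟩
    have ht := h.congr_scratch h2
    refine Run.seq ((ih₂ (r + 1) t ht).mono le_rfl ?_)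
    rintro u ⟨h3, h4⟩
    have hu := ht.congr_scratch h4
    refine (addMul_run u (a := sc r) (x := sc (r + 1)) (y := 5) (r := r + 2)
      ?_ ?_ ?_ ?_ ?_ ?_ ?_ ?_ ?_).mono ?_ ?_
    any_goals (simp only [sc, ne_eq]; omega)
    · rw [hu.reg_N, hu.reg_one]; rfl
    rintro w ⟨h5, h6⟩
    refine ⟨?_, (h2.trans h4 (fun _ h => h) (up r 1)).trans h6 (fun _ h => h) ?_⟩
    · rw [h5, h3, hu.reg_N, hu.reg_one, h4.2.2.2 _ (not_isScratch_sc (by omega)), h1]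
      simp [eval]
    · rintro x (rfl | rfl | rfl)
      · exact isScratch_sc le_rfl
      · exact isScratch_sc (by omega)
      · exact isScratch_sc (by omega)
  | arr k e₁ e₂ ih₁ ih₂ =>
    refine Run.seq ((ih₁ (r + 1) s h).mono le_rfl ?_)
    rintro t ⟨h1, h2⟩
    have ht := h.congr_scratch h2
    refine Run.seq ((ih₂ (r + 2) t ht).mono le_rfl ?_)
    rintro u ⟨h3, h4⟩
    have hu := ht.congr_scratch h4
    refine Run.seq ((addr_run hu (k.idx + 1) 4 r (by omega)).mono (by rw [hu.reg_S]) ?_)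
    rintro w ⟨h5, h6⟩
    have hw := h6.mono (addrsub r)
    refine Run.instr ⟨?_, ((h2.trans h4 (up r 1) (up r 2)).trans hw (fun _ h => h)
      (fun _ h => h)).trans (single _ _ _) (fun _ h => h) (fun _ h => h)⟩
    simp only [Instr.run, Function.update_self]
    rw [h5, h3, h4.2.2.2 _ (not_isScratch_sc (by omega)), h1, h6.1, hu.reg_S,
      hu.arr _ _ _ (min_le_right _ _) (min_le_right _ _)]
    rfl
  | heap e ih =>
    refine Run.seq ((ih r s h).mono le_rfl ?_)
    rintro t ⟨h1, h2⟩
    have ht := h.congr_scratch h2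
    refine Run.seq ((addBase_run (by simp only [sc, ne_eq]; omega)
      (by simp only [sc, ne_eq]; omega) 7 t).mono (by rw [ht.reg_Q]; rfl) ?_)
    rintro u ⟨h3, h4⟩
    refine Run.instr ⟨?_, (h2.trans h4 (fun _ h => h) ?_).trans (single _ _ _) (fun _ h => h)
      (fun _ h => h)⟩
    · simp only [Instr.run, Function.update_self]
      rw [h3, h1, h4.1, ht.reg_Q, add_comm, ht.heap]
      rfl
    · rintro x (rfl | rfl)
      · exact isScratch_sc le_rfl
      · exact isScratch_sc (by omega)
  | inp e₁ e₂ ih₁ ih₂ =>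
    refine Run.seq ((ih₁ (r + 1) s h).mono le_rfl ?_)
    rintro t ⟨h1, h2⟩
    have ht := h.congr_scratch h2
    refine Run.seq ((ih₂ (r + 2) t ht).mono le_rfl ?_)
    rintro u ⟨h3, h4⟩
    have hu := ht.congr_scratch h4
    refine Run.seq ((addr_run hu 0 0 r (by omega)).mono (by rw [hu.reg_n]) ?_)
    rintro w ⟨h5, h6⟩
    have hw := h6.mono (addrsub r)
    refine Run.instr ⟨?_, ((h2.trans h4 (up r 1) (up r 2)).trans hw (fun _ h => h)
      (fun _ h => h)).trans (single _ _ _) (fun _ h => h) (fun _ h => h)⟩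
    simp only [Instr.run, Function.update_self]
    rw [h5, h3, h4.2.2.2 _ (not_isScratch_sc (by omega)), h1, h6.1, hu.reg_n, hu.inp]
    · simp [eval]
    · have i1 := min_le_right (e₁.eval ρ σ) (ρ.n + 2)
      have i2 := min_le_right (e₂.eval ρ σ) (ρ.n + 2)
      nlinarith [Nat.mul_le_mul_right ρ.n i1]
  | ite e₁ e₂ a b ih₁ ih₂ iha ihb =>
    refine Run.seq ((ih₁ r s h).mono le_rfl ?_)
    rintro t ⟨h1, h2⟩
    have ht := h.congr_scratch h2
    refine Run.seq ((ih₂ (r + 1) t ht).mono le_rfl ?_)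
    rintro u ⟨h3, h4⟩
    have hu := ht.congr_scratch h4
    have e1 : u.reg (sc r) = e₁.eval ρ σ := by
      rw [h4.2.2.2 _ (not_isScratch_sc (by omega)), h1]
    have h5 : Same (IsScratch r) s u.tick := h2.trans (u := u.tick) ⟨h4.1, h4.2.1, h4.2.2.1, h4.2.2.2⟩
      (fun _ h => h) (up r 1)
    have hu' : Rep ρ u.tick σ := h.congr_scratch h5
    refine Run.ifLt (fun hlt => ?_) (fun hlt => ?_)
    · refine (iha r _ hu').mono (le_max_left _ _) ?_
      rintro w ⟨h6, h7⟩
      rw [e1, h3] at hlt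
      exact ⟨by rw [h6, eval, if_pos hlt], h5.trans h7 (fun _ h => h) (fun _ h => h)⟩
    · refine (ihb r _ hu').mono (le_max_right _ _) ?_
      rintro w ⟨h6, h7⟩
      rw [e1, h3] at hlt
      exact ⟨by rw [h6, eval, if_neg hlt], h5.trans h7 (fun _ h => h) (fun _ h => h)⟩

theorem Rep.setv {ρ : Env} {s : State} {σ : HState} (h : Rep ρ s σ) (v : Var) (x : ℕ) :
    Rep ρ { s.tick with reg := Function.update s.reg (vr v) x } (σ.setv v x) := by
  have hv : ∀ y ≤ 5, y ≠ vr v := fun y hy => by simp only [vr, ne_eq]; omega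
  constructor
  all_goals first
    | exact h.inp
    | exact h.arr
    | exact h.heap
    | exact h.buf
    | simp [hv, h.reg_n, h.reg_N, h.reg_R, h.reg_Q, h.reg_S, h.reg_one]; done
    | skip
  intro w
  by_cases hw : w = v
  · simp [hw, HState.setv]
  · have : vr w ≠ vr v := fun h => hw (vr_inj h)
    simp [HState.setv, hw, this, h.var]

/-- The memory consists of blocks of length `(n + 3) ^ 2`: block 0 holds the input, blocks 1 to 6
the arrays. As both indices are at most `n + 2`, an address determines array, row and column by
division with remainder, and distinct cells do not collide. -/
theorem Rep.seta {ρ : Env} {s : State} {σ : HState} (h : Rep ρ s σ) (k : Arr) (i j x : ℕ)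
    (hi : i ≤ ρ.n + 2) (hj : j ≤ ρ.n + 2) :
    Rep ρ { s.tick with
      mem := Function.update s.mem ((k.idx + 1) * (ρ.n + 3) ^ 2 + i * (ρ.n + 3) + j) x }
      (σ.seta k i j x) := by
  have hb : ∀ i j, i ≤ ρ.n + 2 → j ≤ ρ.n + 2 → i * (ρ.n + 3) + j < (ρ.n + 3) ^ 2 := by
    intro i j hi hj
    nlinarith [Nat.mul_le_mul_right (ρ.n + 3) hi]
  have hk : k.idx + 1 ≤ 6 := k.idx_lt
  have hpos : 0 < ρ.n + 3 := by omega
  constructor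
  all_goals first
    | exact h.reg_n
    | exact h.reg_N
    | exact h.reg_R
    | exact h.reg_Q
    | exact h.reg_S
    | exact h.reg_one
    | exact h.var
    | exact h.buf
    | skip
  · intro a ha
    have : a ≠ (k.idx + 1) * (ρ.n + 3) ^ 2 + i * (ρ.n + 3) + j := by nlinarith
    simpa [this] using h.inp a ha
  · intro k' i' j' hi' hj'
    have e : (k'.idx + 1) * (ρ.n + 3) ^ 2 + i' * (ρ.n + 3) + j' =
        (k.idx + 1) * (ρ.n + 3) ^ 2 + i * (ρ.n + 3) + j ↔ k' = k ∧ i' = i ∧ j' = j := by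
      constructor
      · intro e
        have b1 := hb i j hi hj
        have b2 := hb i' j' hi' hj'
        have hQ : 0 < (ρ.n + 3) ^ 2 := by positivity
        have d1 : ((k'.idx + 1) * (ρ.n + 3) ^ 2 + i' * (ρ.n + 3) + j') / (ρ.n + 3) ^ 2 = k'.idx + 1 := by
          rw [add_assoc, Nat.mul_comm, Nat.mul_add_div hQ, Nat.div_eq_of_lt b2, add_zero]
        have d2 : ((k.idx + 1) * (ρ.n + 3) ^ 2 + i * (ρ.n + 3) + j) / (ρ.n + 3) ^ 2 = k.idx + 1 := by
          rw [add_assoc, Nat.mul_comm, Nat.mul_add_div hQ, Nat.div_eq_of_lt b1, add_zero]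
        have ek : k'.idx = k.idx := by rw [e, d2] at d1; omega
        rw [ek] at e
        have e' : i' * (ρ.n + 3) + j' = i * (ρ.n + 3) + j := by omega
        have d3 : (i' * (ρ.n + 3) + j') / (ρ.n + 3) = i' := by
          rw [Nat.mul_comm, Nat.mul_add_div hpos, Nat.div_eq_of_lt (by omega), add_zero]
        have d4 : (i * (ρ.n + 3) + j) / (ρ.n + 3) = i := by
          rw [Nat.mul_comm, Nat.mul_add_div hpos, Nat.div_eq_of_lt (by omega), add_zero]
        have ei : i' = i := by rw [e', d4] at d3; exact d3.symm
        subst ei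
        exact ⟨Arr.idx_inj ek, rfl, by omega⟩
      · rintro ⟨rfl, rfl, rfl⟩; rfl
    simp only [HState.seta, Function.update_apply, e]
    split_ifs
    · rfl
    · exact h.arr _ _ _ hi' hj'
  · intro y
    have := hb i j hi hj
    have : 7 * (ρ.n + 3) ^ 2 + y ≠ (k.idx + 1) * (ρ.n + 3) ^ 2 + i * (ρ.n + 3) + j := by
      have := Nat.mul_le_mul_right ((ρ.n + 3) ^ 2) hk
      omega
    simpa [this, HState.seta] using h.heap y

theorem Rep.seth {ρ : Env} {s : State} {σ : HState} (h : Rep ρ s σ) (a x : ℕ) :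
    Rep ρ { s.tick with mem := Function.update s.mem (7 * (ρ.n + 3) ^ 2 + a) x } (σ.seth a x) := by
  constructor
  all_goals first
    | exact h.reg_n
    | exact h.reg_N
    | exact h.reg_R
    | exact h.reg_Q
    | exact h.reg_S
    | exact h.reg_one
    | exact h.var
    | exact h.buf
    | skip
  · intro b hb
    have : b ≠ 7 * (ρ.n + 3) ^ 2 + a := by omega
    simpa [this] using h.inp b hb
  · intro k i j hi hj
    have hk : k.idx + 1 ≤ 6 := k.idx_lt
    have hb : i * (ρ.n + 3) + j < (ρ.n + 3) ^ 2 := by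
      nlinarith [Nat.mul_le_mul_right (ρ.n + 3) hi]
    have : (k.idx + 1) * (ρ.n + 3) ^ 2 + i * (ρ.n + 3) + j ≠ 7 * (ρ.n + 3) ^ 2 + a := by
      have := Nat.mul_le_mul_right ((ρ.n + 3) ^ 2) hk
      omega
    simpa [this, HState.seth] using h.arr k i j hi hj
  · intro y
    simp only [Function.update_apply, HState.seth]
    simp only [Nat.add_left_cancel_iff]
    split_ifs
    · rfl
    · exact h.heap y

/-- The counter of a loop lives in the scratch register `r` and is copied to the loop variable in
each round, while the body works from `r + 1` on. The last conjunct is what protects the counter;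
the body may overwrite the loop variable. -/
theorem St.comp_run {ρ : Env} (p : St) (r : ℕ) (s : State) (σ : HState) (h : Rep ρ s σ) :
    Run (p.comp r) s (p.cost ρ) fun t =>
      Rep ρ t (p.den ρ σ) ∧ t.log = s.log ∧ ∀ r' < r, t.reg (sc r') = s.reg (sc r') := by
  have up : ∀ (r k x : ℕ), IsScratch (r + k) x → IsScratch r x := fun r k x h => h.mono (by omega)
  have addrsub : ∀ r x, (x = sc r ∨ IsScratch (r + 3) x) → IsScratch r x := by
    rintro r x (h | h)
    · exact ⟨r, le_rfl, h⟩
    · exact up _ _ _ h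
  have below : ∀ {s t : State} {r : ℕ}, Same (IsScratch r) s t →
      ∀ r' < r, t.reg (sc r') = s.reg (sc r') := fun hs r' hr => hs.2.2.2 _ (not_isScratch_sc hr)
  have hne : ∀ v r, sc r ≠ vr v := fun v r => by simp only [sc, vr, ne_eq]; omega
  induction p generalizing r s σ with
  | skip =>
    have hs : Same (IsScratch r) s ((Instr.const (sc r) 0).run s) :=
      ⟨rfl, rfl, rfl, fun y hy => by
        have : y ≠ sc r := fun h => hy ⟨r, le_rfl, h⟩
        simp [Instr.run, this]⟩
    exact Run.instr ⟨h.congr_scratch hs, rfl, below hs⟩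
  | set v e =>
    refine Run.seq ((e.comp_run r s h).mono le_rfl ?_)
    rintro t ⟨h1, h2⟩
    refine Run.instr ⟨?_, h2.2.2.1, fun r' hr => ?_⟩
    · simp only [Instr.run, h1]
      exact (h.congr_scratch h2).setv _ _
    · simp [Instr.run, hne, below h2 r' hr]
  | aset k e₁ e₂ e =>
    refine Run.seq ((e₁.comp_run (r + 1) s h).mono le_rfl ?_)
    rintro t ⟨h1, h2⟩
    have ht := h.congr_scratch h2
    refine Run.seq ((e₂.comp_run (r + 2) t ht).mono le_rfl ?_)
    rintro u ⟨h3, h4⟩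
    have hu := ht.congr_scratch h4
    refine Run.seq ((addr_run hu (k.idx + 1) 4 r (by omega)).mono (by rw [hu.reg_S]) ?_)
    rintro w ⟨h5, h6⟩
    have hw := h6.mono (addrsub r)
    have hw' := hu.congr_scratch hw
    refine Run.seq ((e.comp_run (r + 1) w hw').mono le_rfl ?_)
    rintro x ⟨h7, h8⟩
    have h9 := ((h2.trans h4 (up r 1) (up r 2)).trans hw (fun _ h => h) (fun _ h => h)).trans h8
      (fun _ h => h) (up r 1)
    refine Run.instr ⟨?_, h9.2.2.1, fun r' hr => ?_⟩
    · simp only [Instr.run, h7]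
      rw [below h8 r (by omega), h5, h3, h4.2.2.2 _ (not_isScratch_sc (by omega)), h1, hu.reg_S]
      exact (hw'.congr_scratch h8).seta k _ _ _ (min_le_right _ _) (min_le_right _ _)
    · exact below h9 r' hr
  | hset e₁ e =>
    refine Run.seq ((e₁.comp_run r s h).mono le_rfl ?_)
    rintro t ⟨h1, h2⟩
    have ht := h.congr_scratch h2
    refine Run.seq ((addBase_run (by simp only [sc, ne_eq]; omega)
      (by simp only [sc, ne_eq]; omega) 7 t).mono (by rw [ht.reg_Q]; rfl) ?_)
    rintro u ⟨h3, h4⟩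
    have h4' : Same (IsScratch r) t u := h4.mono (by
      rintro x (rfl | rfl)
      · exact isScratch_sc le_rfl
      · exact isScratch_sc (by omega))
    have hu := ht.congr_scratch h4'
    refine Run.seq ((e.comp_run (r + 1) u hu).mono le_rfl ?_)
    rintro x ⟨h7, h8⟩
    have h9 := (h2.trans h4' (fun _ h => h) (fun _ h => h)).trans h8 (fun _ h => h) (up r 1)
    refine Run.instr ⟨?_, h9.2.2.1, fun r' hr => ?_⟩
    · simp only [Instr.run, h7]
      rw [below h8 r (by omega), h3, h1, ht.reg_Q, add_comm]
      exact (hu.congr_scratch h8).seth _ _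
    · exact below h9 r' hr
  | out e =>
    refine Run.seq ((e.comp_run r s h).mono le_rfl ?_)
    rintro t ⟨h1, h2⟩
    refine Run.instr ⟨?_, h2.2.2.1, fun r' hr => below h2 r' hr⟩
    have ht := h.congr_scratch h2
    exact ⟨ht.reg_n, ht.reg_N, ht.reg_R, ht.reg_Q, ht.reg_S, ht.reg_one, ht.var, ht.inp, ht.arr,
      ht.heap, by simp [Instr.run, den, h1, ht.buf]⟩
  | seq p q ihp ihq =>
    refine Run.seq ((ihp r s σ h).mono le_rfl ?_)
    rintro t ⟨h1, h2, h3⟩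
    refine (ihq r t _ h1).mono le_rfl ?_
    rintro u ⟨h4, h5, h6⟩
    exact ⟨h4, h5.trans h2, fun r' hr => (h6 r' hr).trans (h3 r' hr)⟩
  | ite e₁ e₂ p q ihp ihq =>
    refine Run.seq ((e₁.comp_run r s h).mono le_rfl ?_)
    rintro t ⟨h1, h2⟩
    have ht := h.congr_scratch h2
    refine Run.seq ((e₂.comp_run (r + 1) t ht).mono le_rfl ?_)
    rintro u ⟨h3, h4⟩
    have e1 : u.reg (sc r) = e₁.eval ρ σ := by
      rw [h4.2.2.2 _ (not_isScratch_sc (by omega)), h1]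
    have h5 : Same (IsScratch r) s u.tick :=
      h2.trans (u := u.tick) ⟨h4.1, h4.2.1, h4.2.2.1, h4.2.2.2⟩ (fun _ h => h) (up r 1)
    have hu' : Rep ρ u.tick σ := h.congr_scratch h5
    refine Run.ifLt (fun hlt => ?_) (fun hlt => ?_)
    · refine (ihp r _ _ hu').mono (le_max_left _ _) ?_
      rintro w ⟨h6, h7, h8⟩
      rw [e1, h3] at hlt
      exact ⟨by rw [den, if_pos hlt]; exact h6, h7.trans h5.2.2.1,
        fun r' hr => (h8 r' hr).trans (below h5 r' hr)⟩
    · refine (ihq r _ _ hu').mono (le_max_right _ _) ?_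
      rintro w ⟨h6, h7, h8⟩
      rw [e1, h3] at hlt
      exact ⟨by rw [den, if_neg hlt]; exact h6, h7.trans h5.2.2.1,
        fun r' hr => (h8 r' hr).trans (below h5 r' hr)⟩
  | loop l v p ih =>
    have hl : ∀ {s σ}, Rep ρ s σ → s.reg l.reg = l.val ρ := by
      intro s σ h
      cases l <;> simp [Lim.reg, Lim.val, h.reg_n, h.reg_N, h.reg_R]
    have hscr : ∀ (s : State) (x : ℕ), Same (IsScratch r) s
        { s.tick with reg := Function.update s.reg (sc r) x } := fun s x =>
      ⟨rfl, rfl, rfl, fun y hy => by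
        have : y ≠ sc r := fun h => hy ⟨r, le_rfl, h⟩
        simp [this]⟩
    refine Run.seq (Run.instr ?_)
    refine Run.whileLt (fun k t => t.reg (sc r) = k ∧
      Rep ρ t (iter (fun k τ => p.den ρ (τ.setv v k)) k σ) ∧ t.log = s.log ∧
      ∀ r' < r, t.reg (sc r') = s.reg (sc r')) (l.val ρ) ?_ ?_ ?_ ?_
    · exact ⟨by simp [Instr.run], h.congr_scratch (hscr _ _), rfl, below (hscr _ _)⟩
    · rintro k t ⟨h1, h2, -⟩ -
      rw [h1, hl h2]
    · rintro k hk t ⟨h1, h2, h3, h4⟩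
      have hr : Rep ρ ((Instr.copy (vr v) (sc r)).run t.tick) (HState.setv
          (iter (fun k τ => p.den ρ (τ.setv v k)) k σ) v k) := by
        have := h2.setv v k
        rw [← h1] at this ⊢
        exact ⟨this.reg_n, this.reg_N, this.reg_R, this.reg_Q, this.reg_S, this.reg_one,
          this.var, this.inp, this.arr, this.heap, this.buf⟩
      refine Run.seq (b := 1) (b' := p.cost ρ + 1) (Run.instr (Run.seq
        ((ih (r + 1) _ _ hr).mono le_rfl ?_)))
      rintro u ⟨h5, h6, h7⟩
      refine Run.instr ⟨?_, h5.congr_scratch (hscr _ _), h6.trans h3, fun r' hr => ?_⟩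
      · simp only [Instr.run, Function.update_self, h7 r (by omega)]
        simp [hne, h1]
      · refine (below (hscr u _) r' hr).trans ((h7 r' (by omega)).trans ?_)
        rw [← h4 r' hr]
        simp [Instr.run, hne]
    · rintro t ⟨h1, h2, h3, h4⟩
      exact ⟨h2.congr_scratch (r := 0) (s := t) ⟨rfl, rfl, rfl, fun _ _ => rfl⟩, h3, h4⟩

end RAM

/-! ### Assignment problems and the exchange of vertices -/

open Finset in
/-- The pairs of numbers below `n`. -/
def grid (n : ℕ) : Finset (ℕ × ℕ) := range n ×ˢ range n

theorem mem_grid {n : ℕ} {d : ℕ × ℕ} : d ∈ grid n ↔ d.1 < n ∧ d.2 < n := by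
  simp [grid]

/-- An assignment problem: the demands `d` with `Real d` are to be assigned to distinct allowed
slots. Slot `(v, i)` is one of the slots of vertex `v`. -/
structure Assignment (n : ℕ) where
  Real : ℕ × ℕ → Prop
  Allow : ℕ × ℕ → ℕ × ℕ → Prop
  real_mem : ∀ d, Real d → d ∈ grid n
  allow_mem : ∀ d j, Allow d j → j ∈ grid n

namespace Assignment

variable {n : ℕ} (A : Assignment n)

/-- An assignment of the demands to distinct allowed slots. -/
def Valid (f : ℕ × ℕ → ℕ × ℕ) : Prop :=
  (∀ d, A.Real d → A.Allow d (f d)) ∧ Set.InjOn f {d | A.Real d}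

/-- The slots of the vertices in `X` suffice. -/
def Sol (X : Finset ℕ) : Prop := ∃ f, A.Valid f ∧ ∀ d, A.Real d → (f d).1 ∈ X

/-- `X` is a minimal set of vertices whose slots suffice. -/
def MinSol (X : Finset ℕ) : Prop :=
  X ⊆ Finset.range n ∧ A.Sol X ∧ ∀ Y ⊆ X, A.Sol Y → Y = X

/-- Each vertex serves at most `m` demands. -/
def Bounded (m : ℕ) : Prop :=
  ∀ f, A.Valid f → ∀ (v : ℕ) (D : Finset (ℕ × ℕ)), (∀ d ∈ D, A.Real d ∧ (f d).1 = v) → D.card ≤ m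

variable {A}

theorem Sol.mono {X Y : Finset ℕ} (h : A.Sol X) (hXY : X ⊆ Y) : A.Sol Y := by
  obtain ⟨f, hf, hX⟩ := h
  exact ⟨f, hf, fun d hd => hXY (hX d hd)⟩

/-- If `v` is removed from `X`, few new vertices suffice to repair the assignment. -/
theorem Sol.exchange {m : ℕ} (hm : A.Bounded m) {X Y : Finset ℕ} {v : ℕ} (hX : A.Sol X)
    (hY : A.Sol Y) (hv : v ∉ Y) : ∃ S ⊆ Y, S.card ≤ m ∧ A.Sol (X.erase v ∪ S) := by
  classical
  obtain ⟨f, ⟨hf, hfi⟩, hfX⟩ := hX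
  obtain ⟨g, ⟨hg, hgi⟩, hgY⟩ := hY
  -- One step of an alternating path: when `a` moves to its slot under `g`, it displaces `b`. The
  -- set `C` collects all demands displaced, directly or not, by clearing `v`; exactly these will
  -- switch from `f` to `g`.
  let r : ℕ × ℕ → ℕ × ℕ → Prop := fun a b => A.Real b ∧ g a = f b
  let C : ℕ × ℕ → Prop := fun d => ∃ a, (A.Real a ∧ (f a).1 = v) ∧ Relation.ReflTransGen r a d
  have hCR : ∀ d, C d → A.Real d := by
    rintro d ⟨a, ha, had⟩
    cases had with
    | refl => exact ha.1
    | tail _ h => exact h.1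
  have hCstep : ∀ d d', C d → A.Real d' → g d = f d' → C d' := by
    rintro d d' ⟨a, ha, had⟩ hd' e
    exact ⟨a, ha, had.tail ⟨hd', e⟩⟩
  have hCcase : ∀ d, C d → (f d).1 ≠ v → ∃ b, C b ∧ g b = f d := by
    rintro d ⟨a, ha, had⟩ hne
    cases had with
    | refl => exact absurd ha.2 hne
    | tail h1 h2 => exact ⟨_, ⟨a, ha, h1⟩, h2.2⟩
  let P := (grid n).filter C
  have hP : ∀ d, d ∈ P ↔ C d := fun d => by
    simp only [P, Finset.mem_filter, and_iff_right_iff_imp]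
    exact fun h => A.real_mem d (hCR d h)
  -- The ends of the paths: demands whose slot under `g` is unused by `f`. Only they can require new
  -- vertices.
  let E := P.filter fun d => ¬ ∃ d', A.Real d' ∧ g d = f d'
  -- A demand of `C` that is not served by `v` was displaced by a member of `C` outside `E`. As `f`
  -- is injective, there are at least as many demands outside `E` as demands not at `v`; taking
  -- complements in `P` bounds the ends by the starts.
  have hcard : E.card ≤ (P.filter fun d => (f d).1 = v).card := by
    have h1 := Finset.card_filter_add_card_filter_not (s := P) (fun d => (f d).1 = v)
    have h2 := Finset.card_filter_add_card_filter_not (s := P)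
      (fun d => ∃ d', A.Real d' ∧ g d = f d')
    have h3 : (P.filter fun d => ¬ (f d).1 = v).card ≤
        (P.filter fun d => ∃ d', A.Real d' ∧ g d = f d').card := by
      rw [← Finset.card_image_of_injOn (f := f)]
      · refine (Finset.card_le_card ?_).trans (Finset.card_image_le (f := g))
        intro j hj
        obtain ⟨d, hd, rfl⟩ := Finset.mem_image.1 hj
        rw [Finset.mem_filter, hP] at hd
        obtain ⟨b, hb, hbd⟩ := hCcase d hd.1 hd.2
        exact Finset.mem_image.2 ⟨b, Finset.mem_filter.2 ⟨(hP b).2 hb, d, hCR d hd.1, hbd⟩, hbd⟩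
      · intro a ha b hb
        have ha' := (hP a).1 (Finset.mem_filter.1 ha).1
        have hb' := (hP b).1 (Finset.mem_filter.1 hb).1
        exact hfi (hCR a ha') (hCR b hb')
    change _ + E.card = _ at h2
    omega
  refine ⟨E.image fun d => (g d).1, ?_, ?_, fun d => if C d then g d else f d, ⟨?_, ?_⟩, ?_⟩
  · intro x hx
    obtain ⟨d, hd, rfl⟩ := Finset.mem_image.1 hx
    exact hgY d (hCR d ((hP d).1 (Finset.mem_filter.1 hd).1))
  · refine Finset.card_image_le.trans (hcard.trans (hm f ⟨hf, hfi⟩ v _ ?_))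
    intro d hd
    rw [Finset.mem_filter, hP] at hd
    exact ⟨hCR d hd.1, hd.2⟩
  · intro d hd
    dsimp only
    split_ifs
    exacts [hg d hd, hf d hd]
  -- A clash between a switched and an unswitched demand is a step of an alternating path, so both
  -- would belong to `C`.
  · intro a ha b hb hab
    dsimp only at hab
    split_ifs at hab with h1 h2 h2
    · exact hgi ha hb hab
    · exact absurd (hCstep a b h1 hb hab) h2
    · exact absurd (hCstep b a h2 ha hab.symm) h1
    · exact hfi ha hb hab
  · intro d hd
    dsimp only
    split_ifs with hC
    -- A slot under `g` that `f` uses too belongs to a vertex of `X`; this vertex is not `v` because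
    -- `g` avoids `v`.
    · by_cases h : ∃ d', A.Real d' ∧ g d = f d'
      · obtain ⟨d', hd', e⟩ := h
        have hne : (g d).1 ≠ v := fun h => hv (h ▸ hgY d hd)
        exact Finset.mem_union_left _ (Finset.mem_erase.2 ⟨hne, e ▸ hfX d' hd'⟩)
      · exact Finset.mem_union_right _ (Finset.mem_image.2
          ⟨d, Finset.mem_filter.2 ⟨(hP d).2 hC, h⟩, rfl⟩)
    · refine Finset.mem_union_left _ (Finset.mem_erase.2 ⟨fun h => hC ?_, hfX d hd⟩)
      exact ⟨d, ⟨hd, h⟩, .refl⟩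

/-- A nonempty family of minimal solutions that is closed under exchange contains all of them. -/
theorem MinSol.mem_of_closed {m : ℕ} (hm : A.Bounded m) (F : Set (Finset ℕ))
    (hF : ∀ X ∈ F, A.MinSol X) (hne : F.Nonempty)
    (hcl : ∀ X ∈ F, ∀ v ∈ X, ∀ S ⊆ Finset.range n, S.Nonempty → S.card ≤ m →
      A.Sol ((X ∪ S).erase v) → ∃ Y ∈ F, Y ⊆ (X ∪ S).erase v)
    {T : Finset ℕ} (hT : A.MinSol T) : T ∈ F := by
  -- The potential is the number of elements of `X` outside `T`, written without subtraction.
  have key : ∀ k, ∀ X ∈ F, (X ∪ T).card ≤ T.card + k → T ∈ F := by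
    intro k
    induction k with
    | zero =>
      intro X hX hc
      have h1 : T = X ∪ T := Finset.eq_of_subset_of_card_le Finset.subset_union_right hc
      have h2 : X ⊆ T := by rw [h1]; exact Finset.subset_union_left
      rw [← hT.2.2 X h2 (hF X hX).2.1]
      exact hX
    | succ k ih =>
      intro X hX hc
      by_cases hXT : X ⊆ T
      · rw [← hT.2.2 X hXT (hF X hX).2.1]
        exact hX
      obtain ⟨v, hvX, hvT⟩ := Finset.not_subset.1 hXT
      have hsol : A.Sol ((X ∪ T).erase v) := hT.2.1.mono fun x hx =>
        Finset.mem_erase.2 ⟨fun h => hvT (h ▸ hx), Finset.mem_union_right _ hx⟩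
      -- The exchange partner is `(X ∪ T) \ {v}` rather than `T`; all that matters is that `S` adds
      -- nothing outside `X ∪ T`.
      obtain ⟨S, hSY, hSm, hS⟩ := (hF X hX).2.1.exchange hm hsol (v := v) (by simp)
      have hvS : v ∉ S := fun h => by simpa using hSY h
      have hXn := (hF X hX).1
      have e : X.erase v ∪ S = (X ∪ S).erase v := by
        rw [Finset.erase_union_distrib, Finset.erase_eq_of_notMem hvS]
      -- By minimality of `X`, deleting `v` alone destroys the solution. The empty set may thus be
      -- left out of the moves, which suits the encoding of sets by digits.
      have hSne : S.Nonempty := by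
        by_contra h
        rw [Finset.not_nonempty_iff_eq_empty] at h
        rw [h, Finset.union_empty] at hS
        have := (hF X hX).2.2 _ (Finset.erase_subset v X) hS
        exact (Finset.notMem_erase v X) (this.symm ▸ hvX)
      have hSn : S ⊆ Finset.range n := fun x hx => by
        have := Finset.mem_of_mem_erase (hSY hx)
        rcases Finset.mem_union.1 this with h | h
        exacts [hXn h, hT.1 h]
      rw [e] at hS
      obtain ⟨Y, hYF, hY⟩ := hcl X hX v hvX S hSn hSne hSm hS
      refine ih Y hYF ?_
      -- No element outside `X ∪ T` has come in and `v` has left, so the potential drops.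
      have hsub : Y ∪ T ⊆ (X ∪ T).erase v := by
        refine Finset.union_subset (hY.trans ?_) ?_
        · intro x hx
          obtain ⟨h1, h2⟩ := Finset.mem_erase.1 hx
          rcases Finset.mem_union.1 h2 with h | h
          · exact Finset.mem_erase.2 ⟨h1, Finset.mem_union_left _ h⟩
          · exact hSY h
        · exact fun x hx =>
            Finset.mem_erase.2 ⟨fun h => hvT (h ▸ hx), Finset.mem_union_right _ hx⟩
      have := Finset.card_le_card hsub
      rw [Finset.card_erase_of_mem (Finset.mem_union_left _ hvX)] at this
      omega
  obtain ⟨X, hX⟩ := hne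
  exact key (X ∪ T).card X hX (by omega)

/-! ### Auctions -/

variable (A)

/-- A state of the auction: the demand `d` is marked if `mt d ≠ 0`, the slot `j` is taken if
`0 < pr j`, and then it is assigned to the demand `hd j`. The price of a slot is at most one more
than the price of any other slot that its holder could have. -/
structure Auction (X : Finset ℕ) (mt : ℕ × ℕ → ℕ) (hd : ℕ × ℕ → ℕ × ℕ) (pr : ℕ × ℕ → ℕ) :
    Prop where
  real : ∀ j ∈ grid n, 0 < pr j → A.Real (hd j)
  allow : ∀ j ∈ grid n, 0 < pr j → A.Allow (hd j) j
  mem : ∀ j ∈ grid n, 0 < pr j → j.1 ∈ X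
  mark : ∀ j ∈ grid n, 0 < pr j → mt (hd j) ≠ 0
  price : ∀ j ∈ grid n, 0 < pr j → ∀ j', A.Allow (hd j) j' → j'.1 ∈ X → pr j ≤ pr j' + 1
  inj : ∀ j ∈ grid n, 0 < pr j → ∀ j' ∈ grid n, 0 < pr j' → hd j = hd j' → j = j'
  taken : ∀ d, A.Real d → mt d ≠ 0 → ∃ j ∈ grid n, 0 < pr j ∧ hd j = d

variable {A} {X : Finset ℕ} {mt : ℕ × ℕ → ℕ} {hd : ℕ × ℕ → ℕ × ℕ} {pr : ℕ × ℕ → ℕ}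

/-- If all demands are marked, the assignment is complete. -/
theorem Auction.sol (h : A.Auction X mt hd pr) (hall : ∀ d, A.Real d → mt d ≠ 0) : A.Sol X := by
  classical
  choose! f hf using fun d hd => h.taken d hd (hall d hd)
  refine ⟨f, ⟨fun d hd => ?_, fun d hd d' hd' e => ?_⟩, fun d hd => ?_⟩
  · have := h.allow (f d) (hf d hd).1 (hf d hd).2.1
    rwa [(hf d hd).2.2] at this
  · rw [← (hf d hd).2.2, ← (hf d' hd').2.2, e]
  · exact h.mem (f d) (hf d hd).1 (hf d hd).2.1

/-- If there is a solution, an unmarked demand has a cheap slot. -/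
theorem Auction.le_of_sol (h : A.Auction X mt hd pr) (hs : A.Sol X) {d : ℕ × ℕ} (hd0 : A.Real d)
    (hmt : mt d = 0) {K : ℕ} (hK : ∀ j, A.Allow d j → j.1 ∈ X → K ≤ pr j) : K ≤ n * n := by
  classical
  obtain ⟨f, ⟨hf, hfi⟩, hfX⟩ := hs
  -- The slots of price at least `k`.
  let B : ℕ → Finset (ℕ × ℕ) := fun k => (grid n).filter fun j => k ≤ pr j
  -- In the solution `f`, the holders of the slots in `B (k + 1)` together with the unmarked demand
  -- `d` need distinct slots. The price condition puts all of these into `B k`, so `B k` is larger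
  -- by at least one. With at most `n * n` slots this cannot happen more than `n * n` times.
  have hstep : ∀ k, k + 1 ≤ K → (B (k + 1)).card + 1 ≤ (B k).card := by
    intro k hk
    have hB : ∀ j ∈ B (k + 1), j ∈ grid n ∧ k + 1 ≤ pr j := fun j hj => Finset.mem_filter.1 hj
    have hnot : f d ∉ (B (k + 1)).image fun j => f (hd j) := by
      intro hm
      obtain ⟨j, hj, e⟩ := Finset.mem_image.1 hm
      obtain ⟨h1, h2⟩ := hB j hj
      have := hfi (h.real j h1 (by omega)) hd0 e
      exact h.mark j h1 (by omega) (this ▸ hmt)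
    have hinj : Set.InjOn (fun j => f (hd j)) (B (k + 1)) := by
      intro j hj j' hj' e
      obtain ⟨h1, h2⟩ := hB j hj
      obtain ⟨h3, h4⟩ := hB j' hj'
      exact h.inj j h1 (by omega) j' h3 (by omega)
        (hfi (h.real j h1 (by omega)) (h.real j' h3 (by omega)) e)
    rw [← Finset.card_image_of_injOn hinj, ← Finset.card_insert_of_notMem hnot]
    refine Finset.card_le_card (Finset.insert_subset ?_ ?_)
    · refine Finset.mem_filter.2 ⟨A.allow_mem _ _ (hf d hd0), ?_⟩
      have := hK (f d) (hf d hd0) (hfX d hd0)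
      omega
    · intro x hx
      obtain ⟨j, hj, rfl⟩ := Finset.mem_image.1 hx
      obtain ⟨h1, h2⟩ := hB j hj
      have hr := h.real j h1 (by omega)
      refine Finset.mem_filter.2 ⟨A.allow_mem _ _ (hf _ hr), ?_⟩
      have := h.price j h1 (by omega) (f (hd j)) (hf _ hr) (hfX _ hr)
      omega
  have hall : ∀ k ≤ K, k + (B k).card ≤ (B 0).card := by
    intro k
    induction k with
    | zero => intro _; omega
    | succ k ih =>
      intro hk
      have := ih (by omega)
      have := hstep k hk
      omega
  have h0 : (B 0).card ≤ n * n := (Finset.card_filter_le _ _).trans (by simp [grid])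
  have := hall K le_rfl
  omega

/-- A round of the auction: an unmarked demand takes the cheapest slot it can have. -/
theorem Auction.step (h : A.Auction X mt hd pr) {d j : ℕ × ℕ} (hdr : A.Real d) (hmt : mt d = 0)
    (hj : A.Allow d j) (hjX : j.1 ∈ X) (hmin : ∀ j', A.Allow d j' → j'.1 ∈ X → pr j ≤ pr j')
    {mt' : ℕ × ℕ → ℕ} {hd' : ℕ × ℕ → ℕ × ℕ} {pr' : ℕ × ℕ → ℕ}
    (hmt' : ∀ e, mt' e ≠ 0 ↔ e = d ∨ mt e ≠ 0 ∧ ¬ (0 < pr j ∧ e = hd j))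
    (hhd' : ∀ i, hd' i = if i = j then d else hd i)
    (hpr' : ∀ i, pr' i = if i = j then pr j + 1 else pr i) : A.Auction X mt' hd' pr' := by
  have hjn := A.allow_mem d j hj
  -- Prices never fall, so the price condition of the other holders is preserved.
  have hle : ∀ i, pr i ≤ pr' i := fun i => by
    rw [hpr']; split_ifs with e
    · rw [e]; omega
    · rfl
  constructor
  · intro i hi hp
    rw [hpr'] at hp; rw [hhd']
    split_ifs with e
    · exact hdr
    · rw [if_neg e] at hp; exact h.real i hi hp
  · intro i hi hp
    rw [hpr'] at hp; rw [hhd']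
    split_ifs with e
    · rwa [e]
    · rw [if_neg e] at hp; exact h.allow i hi hp
  · intro i hi hp
    rw [hpr'] at hp
    by_cases e : i = j
    · rwa [e]
    · rw [if_neg e] at hp; exact h.mem i hi hp
  · intro i hi hp
    rw [hpr'] at hp; rw [hhd', hmt']
    split_ifs with e
    · exact Or.inl rfl
    · rw [if_neg e] at hp
      refine Or.inr ⟨h.mark i hi hp, ?_⟩
      rintro ⟨h1, h2⟩
      exact e (h.inj i hi hp j hjn h1 h2)
  · intro i hi hp i' hi' hiX
    have := hle i'
    rw [hpr' i] at hp ⊢; rw [hhd'] at hi'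
    split_ifs at * with e
    · have := hmin i' hi' hiX
      omega
    · have := h.price i hi hp i' hi' hiX
      omega
  · have aux : ∀ i ∈ grid n, 0 < pr i → hd i ≠ d := fun i hi hp e =>
      h.mark i hi hp (e ▸ hmt)
    intro i hi hp i' hi' hp' e
    rw [hpr'] at hp hp'; rw [hhd', hhd'] at e
    split_ifs at * with e1 e2 e2
    · rw [e1, e2]
    · exact absurd e.symm (aux i' hi' hp')
    · exact absurd e (aux i hi hp)
    · exact h.inj i hi hp i' hi' hp' e
  · intro e he hm
    rw [hmt'] at hm
    by_cases hed : e = d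
    · exact ⟨j, hjn, by rw [hpr', if_pos rfl]; omega, by rw [hhd', if_pos rfl, hed]⟩
    obtain ⟨h1, h2⟩ := hm.resolve_left hed
    obtain ⟨i, hi, hp, hie⟩ := h.taken e he h1
    have : i ≠ j := fun hij => h2 ⟨hij ▸ hp, by rw [← hij, hie]⟩
    exact ⟨i, hi, by rwa [hpr', if_neg this], by rw [hhd', if_neg this, hie]⟩

/-- Initially nothing is assigned. -/
theorem Auction.init (h : ∀ d ∈ grid n, mt d = 0) (h' : ∀ j ∈ grid n, pr j = 0) :
    A.Auction X mt hd pr where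
  real j hj hp := by simp [h' j hj] at hp
  allow j hj hp := by simp [h' j hj] at hp
  mem j hj hp := by simp [h' j hj] at hp
  mark j hj hp := by simp [h' j hj] at hp
  price j hj hp := by simp [h' j hj] at hp
  inj j hj hp := by simp [h' j hj] at hp
  taken d hd hm := absurd (h d (A.real_mem d hd)) hm

end Assignment

namespace RAM

/-! ### Reasoning about statements -/

infixr:65 " ;; " => St.seq

/-- The statement does not change the variable `x`. -/
def St.keepsVar (x : Var) : St → Bool
  | .skip => true
  | .set v _ => x ≠ v
  | .aset _ _ _ _ => true
  | .hset _ _ => true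
  | .out _ => true
  | .seq p q => p.keepsVar x && q.keepsVar x
  | .ite _ _ p q => p.keepsVar x && q.keepsVar x
  | .loop _ v p => x ≠ v && p.keepsVar x

/-- The statement does not change the array `k`. -/
def St.keepsArr (k : Arr) : St → Bool
  | .skip => true
  | .set _ _ => true
  | .aset k' _ _ _ => k ≠ k'
  | .hset _ _ => true
  | .out _ => true
  | .seq p q => p.keepsArr k && q.keepsArr k
  | .ite _ _ p q => p.keepsArr k && q.keepsArr k
  | .loop _ _ p => p.keepsArr k

/-- The statement does not change the heap. -/
def St.keepsHeap : St → Bool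
  | .skip => true
  | .set _ _ => true
  | .aset _ _ _ _ => true
  | .hset _ _ => false
  | .out _ => true
  | .seq p q => p.keepsHeap && q.keepsHeap
  | .ite _ _ p q => p.keepsHeap && q.keepsHeap
  | .loop _ _ p => p.keepsHeap

/-- The statement does not change the output buffer. -/
def St.keepsBuf : St → Bool
  | .skip => true
  | .set _ _ => true
  | .aset _ _ _ _ => true
  | .hset _ _ => true
  | .out _ => false
  | .seq p q => p.keepsBuf && q.keepsBuf
  | .ite _ _ p q => p.keepsBuf && q.keepsBuf
  | .loop _ _ p => p.keepsBuf

@[simp] theorem setv_arr (σ : HState) (v : Var) (x : ℕ) : (σ.setv v x).arr = σ.arr := rfl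
@[simp] theorem setv_heap (σ : HState) (v : Var) (x : ℕ) : (σ.setv v x).heap = σ.heap := rfl
@[simp] theorem setv_buf (σ : HState) (v : Var) (x : ℕ) : (σ.setv v x).buf = σ.buf := rfl
@[simp] theorem setv_var (σ : HState) (v w : Var) (x : ℕ) :
    (σ.setv v x).var w = if w = v then x else σ.var w := by
  simp [HState.setv, Function.update_apply]
@[simp] theorem seta_var (σ : HState) (k : Arr) (i j x : ℕ) : (σ.seta k i j x).var = σ.var := rfl
@[simp] theorem seta_heap (σ : HState) (k : Arr) (i j x : ℕ) : (σ.seta k i j x).heap = σ.heap := rfl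
@[simp] theorem seta_arr (σ : HState) (k k' : Arr) (i j i' j' x : ℕ) :
    (σ.seta k i j x).arr k' i' j' = if k' = k ∧ i' = i ∧ j' = j then x else σ.arr k' i' j' := rfl
@[simp] theorem seth_var (σ : HState) (a x : ℕ) : (σ.seth a x).var = σ.var := rfl
@[simp] theorem seth_arr (σ : HState) (a x : ℕ) : (σ.seth a x).arr = σ.arr := rfl
@[simp] theorem seth_heap (σ : HState) (a x b : ℕ) :
    (σ.seth a x).heap b = if b = a then x else σ.heap b := by
  simp [HState.seth, Function.update_apply]

theorem iter_inv {f : ℕ → HState → HState} {σ : HState} (I : ℕ → HState → Prop) {m : ℕ}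
    (h0 : I 0 σ) (hs : ∀ k < m, ∀ τ, I k τ → I (k + 1) (f k τ)) : I m (iter f m σ) := by
  induction m with
  | zero => exact h0
  | succ m ih => exact hs m (by omega) _ (ih fun k hk => hs k (by omega))

variable {ρ : Env}

/-- Together with its analogues for arrays, heap and buffer, this turns frame conditions into a
syntactic check that `rfl` decides for the concrete programs. -/
theorem St.var_of_keeps {x : Var} {p : St} (h : p.keepsVar x = true) (σ : HState) :
    (p.den ρ σ).var x = σ.var x := by
  induction p generalizing σ with
  | skip | aset | hset | out => rfl
  | set v e =>
    have : x ≠ v := by simpa [keepsVar] using h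
    simp [den, this]
  | seq p q ihp ihq =>
    simp only [keepsVar, Bool.and_eq_true] at h
    rw [den, ihq h.2, ihp h.1]
  | ite a b p q ihp ihq =>
    simp only [keepsVar, Bool.and_eq_true] at h
    rw [den]; split_ifs
    exacts [ihp h.1 σ, ihq h.2 σ]
  | loop l v p ih =>
    simp only [keepsVar, Bool.and_eq_true, decide_eq_true_eq] at h
    refine iter_inv (fun _ τ => τ.var x = σ.var x) rfl ?_
    intro k _ τ hτ
    rw [ih h.2, setv_var, if_neg h.1, hτ]

theorem St.arr_of_keeps {k : Arr} {p : St} (h : p.keepsArr k = true) (σ : HState) :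
    (p.den ρ σ).arr k = σ.arr k := by
  induction p generalizing σ with
  | skip | set | hset | out => rfl
  | aset k' e₁ e₂ e =>
    have : k ≠ k' := by simpa [keepsArr] using h
    funext i j
    simp [den, this]
  | seq p q ihp ihq =>
    simp only [keepsArr, Bool.and_eq_true] at h
    rw [den, ihq h.2, ihp h.1]
  | ite a b p q ihp ihq =>
    simp only [keepsArr, Bool.and_eq_true] at h
    rw [den]; split_ifs
    exacts [ihp h.1 σ, ihq h.2 σ]
  | loop l v p ih =>
    refine iter_inv (fun _ τ => τ.arr k = σ.arr k) rfl ?_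
    intro k _ τ hτ
    rw [ih h, setv_arr, hτ]

theorem St.heap_of_keeps {p : St} (h : p.keepsHeap = true) (σ : HState) :
    (p.den ρ σ).heap = σ.heap := by
  induction p generalizing σ with
  | skip | set | aset | out => rfl
  | hset => cases h
  | seq p q ihp ihq =>
    simp only [keepsHeap, Bool.and_eq_true] at h
    rw [den, ihq h.2, ihp h.1]
  | ite a b p q ihp ihq =>
    simp only [keepsHeap, Bool.and_eq_true] at h
    rw [den]; split_ifs
    exacts [ihp h.1 σ, ihq h.2 σ]
  | loop l v p ih =>
    refine iter_inv (fun _ τ => τ.heap = σ.heap) rfl ?_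
    intro k _ τ hτ
    rw [ih h, setv_heap, hτ]

theorem St.buf_of_keeps {p : St} (h : p.keepsBuf = true) (σ : HState) :
    (p.den ρ σ).buf = σ.buf := by
  induction p generalizing σ with
  | skip | set | aset | hset => rfl
  | out => cases h
  | seq p q ihp ihq =>
    simp only [keepsBuf, Bool.and_eq_true] at h
    rw [den, ihq h.2, ihp h.1]
  | ite a b p q ihp ihq =>
    simp only [keepsBuf, Bool.and_eq_true] at h
    rw [den]; split_ifs
    exacts [ihp h.1 σ, ihq h.2 σ]
  | loop l v p ih =>
    refine iter_inv (fun _ τ => τ.buf = σ.buf) rfl ?_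
    intro k _ τ hτ
    rw [ih h, setv_buf, hτ]

theorem St.loop_inv {l : Lim} {v : Var} {p : St} {σ : HState} (I : ℕ → HState → Prop)
    (h0 : I 0 σ)
    (hs : ∀ k < l.val ρ, ∀ τ, I k τ → I (k + 1) (p.den ρ (τ.setv v k))) :
    I (l.val ρ) ((St.loop l v p).den ρ σ) :=
  iter_inv I h0 hs

/-- For all pairs `(v, w)` of numbers below `n` do `p`. -/
def St.loop2 (v w : Var) (p : St) : St := .loop .n v (.loop .n w p)

/-- The invariant is indexed by the set of pairs already visited instead of two counters. The body
must keep the outer variable, since the inner loop does not restore it; the inner variable is reset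
in each round. -/
theorem St.loop2_inv {v w : Var} {p : St} {σ : HState} (hvw : v ≠ w) (hk : p.keepsVar v = true)
    (I : Set (ℕ × ℕ) → HState → Prop) (h0 : I ∅ σ)
    (hv : ∀ D τ x, I D τ → I D (τ.setv v x)) (hw : ∀ D τ x, I D τ → I D (τ.setv w x))
    (hs : ∀ D τ, τ.var v < ρ.n → τ.var w < ρ.n → I D τ →
      I (insert (τ.var v, τ.var w) D) (p.den ρ τ)) :
    I {d | d.1 < ρ.n ∧ d.2 < ρ.n} ((St.loop2 v w p).den ρ σ) := by
  refine St.loop_inv (l := .n) (fun k τ => I {d | d.1 < k ∧ d.2 < ρ.n} τ) (by simpa using h0) ?_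
  intro k hk' τ hτ
  have := St.loop_inv (ρ := ρ) (l := .n) (v := w) (p := p) (σ := τ.setv v k)
    (fun j τ => τ.var v = k ∧ I {d | d.1 < k ∧ d.2 < ρ.n ∨ d.1 = k ∧ d.2 < j} τ)
    ⟨by simp, by simpa using hv _ _ _ hτ⟩ ?_
  · convert this.2 using 1
    ext d
    simp only [Set.mem_ofPred_eq, Lim.val]
    omega
  · rintro j hj τ' ⟨h1, h2⟩
    refine ⟨by rw [var_of_keeps hk]; simpa [hvw] using h1, ?_⟩
    have := hs _ (τ'.setv w j) (by simpa [hvw, h1] using (show k < ρ.n from hk'))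
      (by simpa using (show j < ρ.n from hj)) (hw _ _ _ h2)
    convert this using 1
    ext ⟨a, b⟩
    simp only [setv_var, hvw, h1, Set.mem_ofPred_eq, Set.mem_insert_iff, Prod.mk.injEq, if_true,
      if_false]
    omega

/-- `(n + 2) ^ k` rounds of `p`. -/
def St.rep (p : St) : ℕ → St
  | 0 => p
  | k + 1 => .loop .N .round (p.rep k)

/-- All nested loops share the variable `round`, so the invariant has to ignore it. The offset `b`
counts the rounds made before, which lets the induction pass through the outer loop. -/
theorem St.rep_inv {p : St} {σ : HState} (I : ℕ → HState → Prop)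
    (hr : ∀ k τ x, I k τ → I k (τ.setv .round x))
    (hs : ∀ k τ, I k τ → I (k + 1) (p.den ρ τ)) (m b : ℕ) (h0 : I b σ) :
    I (b + (ρ.n + 2) ^ m) ((p.rep m).den ρ σ) := by
  induction m generalizing σ b with
  | zero => exact hs _ _ h0
  | succ m ih =>
    have := St.loop_inv (ρ := ρ) (l := .N) (v := .round) (p := p.rep m) (σ := σ)
      (fun k τ => I (b + k * (ρ.n + 2) ^ m) τ) (by simpa using h0) ?_
    · rw [pow_succ, Nat.mul_comm]; exact this
    · intro k _ τ hτ
      have := ih _ (hr _ _ k hτ)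
      rwa [add_assoc, ← Nat.succ_mul] at this

/-! ### The auction -/

/-- A cell of a one-dimensional array. -/
def Ex.arr1 (k : Arr) (e : Ex) : Ex := .arr k e (.const 0)

/-- Assignment to a cell of a one-dimensional array. -/
def St.aset1 (k : Arr) (e e' : Ex) : St := .aset k e (.const 0) e'

/-- If `0 < e` then `p` else `q`. -/
def St.cond (e : Ex) (p q : St) : St := .ite (.const 0) e p q

@[simp] theorem St.den_skip (σ : HState) : St.skip.den ρ σ = σ := rfl

theorem St.den_seq (p q : St) (σ : HState) : (p ;; q).den ρ σ = q.den ρ (p.den ρ σ) := rfl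

theorem St.den_cond_pos {e : Ex} {p q : St} {σ : HState} (h : 0 < e.eval ρ σ) :
    (St.cond e p q).den ρ σ = p.den ρ σ := if_pos h

theorem St.den_cond_neg {e : Ex} {p q : St} {σ : HState} (h : e.eval ρ σ = 0) :
    (St.cond e p q).den ρ σ = q.den ρ σ := if_neg (by simp [h, Ex.eval])

/-- The price of the best slot found so far. -/
def bestPrice : Ex := .arr .price (.var .bestV) (.var .bestI)

/-- Searches for an unmarked demand. -/
def findUnmet (real : Ex) : St :=
  .set .unmet (.const 0) ;;
  .loop2 .demU .demW (.cond real
    (.cond (.arr .mark (.var .demU) (.var .demW)) .skip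
      (.set .unmet (.const 1) ;; .set .curU (.var .demU) ;; .set .curW (.var .demW)))
    .skip)

/-- Searches for the cheapest slot for the current demand. -/
def findSlot (allow : Ex) : St :=
  .set .seen (.const 0) ;;
  .loop2 .slotV .slotI (.cond (.arr1 .cand (.var .slotV)) (.cond allow
    (.ite (.ite (.const 0) (.var .seen) (.arr .price (.var .slotV) (.var .slotI)) (.const 0))
      (.ite (.const 0) (.var .seen) bestPrice (.const 1))
      (.set .seen (.const 1) ;; .set .bestV (.var .slotV) ;; .set .bestI (.var .slotI)) .skip)
    .skip) .skip)

/-- Gives the best slot to the current demand. -/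
def takeSlot : St :=
  .cond bestPrice (.aset .mark (.arr .holdU (.var .bestV) (.var .bestI))
    (.arr .holdW (.var .bestV) (.var .bestI)) (.const 0)) .skip ;;
  .aset .mark (.var .curU) (.var .curW) (.const 1) ;;
  .aset .holdU (.var .bestV) (.var .bestI) (.var .curU) ;;
  .aset .holdW (.var .bestV) (.var .bestI) (.var .curW) ;;
  .aset .price (.var .bestV) (.var .bestI) (.succ bestPrice)

/-- A round of the auction. -/
def auctionRound (real allow : Ex) : St :=
  findUnmet real ;;
  .cond (.var .unmet) (findSlot allow ;; .cond (.var .seen) takeSlot .skip) .skip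

/-- The auction; in the end, `unmet` is `0` if and only if the candidate is a solution. -/
def auction (real allow : Ex) : St :=
  .loop2 .demU .demW (.aset .mark (.var .demU) (.var .demW) (.const 0) ;;
    .aset .price (.var .demU) (.var .demW) (.const 0)) ;;
  (auctionRound real allow).rep 5 ;; findUnmet real

/-- The expressions `real` and `allow` express the conditions of the assignment problem `A`. -/
structure Expresses (ρ : Env) (real allow : Ex) (A : Assignment ρ.n) : Prop where
  real : ∀ σ : HState, σ.var .demU < ρ.n → σ.var .demW < ρ.n →
    (0 < real.eval ρ σ ↔ A.Real (σ.var .demU, σ.var .demW))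
  allow : ∀ σ : HState, σ.var .curU < ρ.n → σ.var .curW < ρ.n →
    σ.var .slotV < ρ.n → σ.var .slotI < ρ.n →
    (0 < allow.eval ρ σ ↔
      A.Allow (σ.var .curU, σ.var .curW) (σ.var .slotV, σ.var .slotI))

/-- The candidate is the set `X`. -/
def Cand (ρ : Env) (σ : HState) (X : Finset ℕ) : Prop :=
  ∀ l < ρ.n, σ.arr .cand l 0 = if l ∈ X then 1 else 0

/-- The arrays hold a state of an auction. -/
def InAuction (ρ : Env) (A : Assignment ρ.n) (X : Finset ℕ) (σ : HState) : Prop :=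
  A.Auction X (fun d => σ.arr .mark d.1 d.2) (fun j => (σ.arr .holdU j.1 j.2, σ.arr .holdW j.1 j.2))
    (fun j => σ.arr .price j.1 j.2)

variable {real allow : Ex} {A : Assignment ρ.n} {X : Finset ℕ} {σ : HState}

/-- The cut-off built into expressions does not affect indices of vertices. -/
theorem min_var {a n : ℕ} (h : a < n) : min a (n + 2) = a := by omega

theorem findUnmet_den (hE : Expresses ρ real allow A) (σ : HState) :
    (((findUnmet real).den ρ σ).var .unmet = 0 ∧ ∀ d, A.Real d → σ.arr .mark d.1 d.2 ≠ 0) ∨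
    (((findUnmet real).den ρ σ).var .unmet = 1 ∧
      A.Real (((findUnmet real).den ρ σ).var .curU, ((findUnmet real).den ρ σ).var .curW) ∧
      σ.arr .mark (((findUnmet real).den ρ σ).var .curU)
        (((findUnmet real).den ρ σ).var .curW) = 0) := by
  classical
  have key := St.loop2_inv (ρ := ρ) (v := .demU) (w := .demW)
    (p := .cond real
    (.cond (.arr .mark (.var .demU) (.var .demW)) .skip
      (.set .unmet (.const 1) ;; .set .curU (.var .demU) ;; .set .curW (.var .demW)))
    .skip) (σ := σ.setv .unmet 0) (by decide) rfl
    (fun D τ => τ.arr = σ.arr ∧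
      ((τ.var .unmet = 0 ∧ ∀ d ∈ D, A.Real d → σ.arr .mark d.1 d.2 ≠ 0) ∨
      (τ.var .unmet = 1 ∧ A.Real (τ.var .curU, τ.var .curW) ∧
        σ.arr .mark (τ.var .curU) (τ.var .curW) = 0))) (by simp)
    (by intro D τ x h; simpa using h) (by intro D τ x h; simpa using h) ?_
  · obtain ⟨-, h | h⟩ := key
    · exact Or.inl ⟨h.1, fun d hd => h.2 d (mem_grid.1 (A.real_mem d hd)) hd⟩
    · exact Or.inr h
  · rintro D τ hu hw ⟨ha, h⟩
    have hr := hE.real τ hu hw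
    simp only [St.den, St.cond, Ex.eval, min_var hu, min_var hw, hr, ha]
    split_ifs with h1 h2
    · refine ⟨ha, h.imp (fun h => ⟨h.1, ?_⟩) id⟩
      rintro d (rfl | hd) hdr
      · exact h2.ne'
      · exact h.2 d hd hdr
    · refine ⟨by simp [ha], Or.inr ⟨by simp, by simpa using h1, by simpa using h2⟩⟩
    · refine ⟨ha, h.imp (fun h => ⟨h.1, ?_⟩) id⟩
      rintro d (rfl | hd) hdr
      · exact absurd hdr h1
      · exact h.2 d hd hdr

theorem findSlot_den (hE : Expresses ρ real allow A) (hX : Cand ρ σ X)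
    (hu : σ.var .curU < ρ.n) (hw : σ.var .curW < ρ.n) :
    (((findSlot allow).den ρ σ).var .seen = 0 ∧
      ∀ j, A.Allow (σ.var .curU, σ.var .curW) j → j.1 ∉ X) ∨
    (((findSlot allow).den ρ σ).var .seen = 1 ∧
      A.Allow (σ.var .curU, σ.var .curW)
        (((findSlot allow).den ρ σ).var .bestV, ((findSlot allow).den ρ σ).var .bestI) ∧
      ((findSlot allow).den ρ σ).var .bestV ∈ X ∧
      ∀ j, A.Allow (σ.var .curU, σ.var .curW) j → j.1 ∈ X →
        σ.arr .price (((findSlot allow).den ρ σ).var .bestV)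
          (((findSlot allow).den ρ σ).var .bestI) ≤ σ.arr .price j.1 j.2) := by
  classical
  have key := St.loop2_inv (ρ := ρ) (v := .slotV) (w := .slotI)
    (p := .cond (.arr1 .cand (.var .slotV)) (.cond allow
    (.ite (.ite (.const 0) (.var .seen) (.arr .price (.var .slotV) (.var .slotI)) (.const 0))
      (.ite (.const 0) (.var .seen) bestPrice (.const 1))
      (.set .seen (.const 1) ;; .set .bestV (.var .slotV) ;; .set .bestI (.var .slotI)) .skip)
    .skip) .skip) (σ := σ.setv .seen 0) (by decide) rfl
    (fun D τ => τ.arr = σ.arr ∧ τ.var .curU = σ.var .curU ∧ τ.var .curW = σ.var .curW ∧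
      ((τ.var .seen = 0 ∧ ∀ j ∈ D, A.Allow (σ.var .curU, σ.var .curW) j → j.1 ∉ X) ∨
      (τ.var .seen = 1 ∧ A.Allow (σ.var .curU, σ.var .curW) (τ.var .bestV, τ.var .bestI) ∧
        τ.var .bestV ∈ X ∧
        ∀ j ∈ D, A.Allow (σ.var .curU, σ.var .curW) j → j.1 ∈ X →
        σ.arr .price (τ.var .bestV) (τ.var .bestI) ≤ σ.arr .price j.1 j.2))) (by simp)
    (by intro D τ x h; simpa using h) (by intro D τ x h; simpa using h) ?_
  · obtain ⟨-, -, -, h | h⟩ := key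
    · exact Or.inl ⟨h.1, fun j hj => h.2 j (mem_grid.1 (A.allow_mem _ j hj)) hj⟩
    · exact Or.inr ⟨h.1, h.2.1, h.2.2.1,
        fun j hj => h.2.2.2 j (mem_grid.1 (A.allow_mem _ j hj)) hj⟩
  · rintro D τ hv hi ⟨ha, hcu, hcw, h⟩
    have hal := hE.allow τ (hcu ▸ hu) (hcw ▸ hw) hv hi
    rw [hcu, hcw] at hal
    have hc : 0 < σ.arr .cand (τ.var .slotV) 0 ↔ τ.var .slotV ∈ X := by
      rw [hX _ hv]; split_ifs with h <;> simp [h]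
    simp only [St.den, St.cond, Ex.eval, Ex.arr1, bestPrice, min_var hv, min_var hi, hal, ha, hc,
      Nat.zero_min]
    by_cases h1 : τ.var .slotV ∈ X
    swap
    · rw [if_neg h1]
      refine ⟨ha, hcu, hcw, h.imp (fun h => ⟨h.1, ?_⟩) (fun h => ⟨h.1, h.2.1, h.2.2.1, ?_⟩)⟩
      · rintro j (rfl | hj) hjA
        · exact h1
        · exact h.2 j hj hjA
      · rintro j (rfl | hj) hjA hjX
        · exact absurd hjX h1
        · exact h.2.2.2 j hj hjA hjX
    rw [if_pos h1]
    by_cases h2 : A.Allow (σ.var .curU, σ.var .curW) (τ.var .slotV, τ.var .slotI)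
    swap
    · rw [if_neg h2]
      refine ⟨ha, hcu, hcw, h.imp (fun h => ⟨h.1, ?_⟩) (fun h => ⟨h.1, h.2.1, h.2.2.1, ?_⟩)⟩
      · rintro j (rfl | hj) hjA
        · exact absurd hjA h2
        · exact h.2 j hj hjA
      · rintro j (rfl | hj) hjA hjX
        · exact absurd hjA h2
        · exact h.2.2.2 j hj hjA hjX
    rw [if_pos h2]
    -- While `seen` is 0, the comparison in the program reads `0 < 1`, and the first admissible slot
    -- is taken whatever its price. Afterwards it compares the actual prices.
    rcases h with ⟨hs, h⟩ | ⟨hs, hb, hbX, h⟩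
    · simp only [hs, lt_irrefl, if_false, Nat.lt_one_iff, if_true]
      refine ⟨by simp [ha], by simp [hcu], by simp [hcw], Or.inr ⟨by simp, by simpa using h2,
        by simpa using h1, ?_⟩⟩
      rintro j (rfl | hj) hjA hjX
      · simp
      · exact absurd hjX (h j hj hjA)
    · have hbg := mem_grid.1 (A.allow_mem _ _ hb)
      simp only [hs, zero_lt_one, if_true, min_var hbg.1, min_var hbg.2]
      split_ifs with h3
      · refine ⟨by simp [ha], by simp [hcu], by simp [hcw], Or.inr ⟨by simp, by simpa using h2,
          by simpa using h1, ?_⟩⟩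
        rintro j (rfl | hj) hjA hjX
        · simp
        · have := h j hj hjA hjX
          simp
          omega
      · refine ⟨ha, hcu, hcw, Or.inr ⟨hs, hb, hbX, ?_⟩⟩
        rintro j (rfl | hj) hjA hjX
        · simpa using h3
        · exact h j hj hjA hjX

end RAM

namespace RAM

variable {ρ : Env} {real allow : Ex} {A : Assignment ρ.n} {X : Finset ℕ} {σ : HState}

/-- The holder of a taken slot must be a pair of numbers below `n`, so that unmarking it is not
diverted by the cut-off of indices. -/
theorem takeSlot_den {cu cw bv bi : ℕ} (hcu : σ.var .curU = cu) (hcw : σ.var .curW = cw)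
    (hbv : σ.var .bestV = bv) (hbi : σ.var .bestI = bi) (hcu' : cu < ρ.n) (hcw' : cw < ρ.n)
    (hbv' : bv < ρ.n) (hbi' : bi < ρ.n)
    (hh : 0 < σ.arr .price bv bi → σ.arr .holdU bv bi < ρ.n ∧ σ.arr .holdW bv bi < ρ.n) :
    (∀ a b, (takeSlot.den ρ σ).arr .mark a b ≠ 0 ↔ (a, b) = (cu, cw) ∨ σ.arr .mark a b ≠ 0 ∧
      ¬ (0 < σ.arr .price bv bi ∧ (a, b) = (σ.arr .holdU bv bi, σ.arr .holdW bv bi))) ∧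
    (∀ a b, ((takeSlot.den ρ σ).arr .holdU a b, (takeSlot.den ρ σ).arr .holdW a b) =
      if (a, b) = (bv, bi) then (cu, cw) else (σ.arr .holdU a b, σ.arr .holdW a b)) ∧
    (∀ a b, (takeSlot.den ρ σ).arr .price a b =
      if (a, b) = (bv, bi) then σ.arr .price bv bi + 1 else σ.arr .price a b) := by
  subst hcu hcw hbv hbi
  have m1 := min_var hcu'
  have m2 := min_var hcw'
  have m3 := min_var hbv'
  have m4 := min_var hbi'
  simp only [takeSlot, St.den, St.cond, Ex.eval, bestPrice, m1, m2, m3, m4]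
  by_cases h : 0 < σ.arr .price (σ.var .bestV) (σ.var .bestI)
  · have m5 := min_var (hh h).1
    have m6 := min_var (hh h).2
    clear hh
    simp only [if_pos h, m5, m6, seta_var, m1, m2, m3, m4, h]
    refine ⟨fun a b => ?_, fun a b => ?_, fun a b => ?_⟩ <;>
    simp only [seta_arr, Prod.mk.injEq, m1, m2, m3, m4, reduceCtorEq, false_and, if_false,
      true_and] <;> split_ifs <;> simp_all <;> tauto
  · clear hh
    simp only [if_neg h, seta_var, m1, m2, m3, m4, h]
    refine ⟨fun a b => ?_, fun a b => ?_, fun a b => ?_⟩ <;>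
    simp only [seta_arr, Prod.mk.injEq, m1, m2, m3, m4, reduceCtorEq, false_and, if_false,
      true_and] <;> split_ifs <;> simp_all

/-! ### Progress and correctness of the auction -/

/-- The sum of the prices. -/
def priceSum (ρ : Env) (σ : HState) : ℕ := ∑ j ∈ grid ρ.n, σ.arr .price j.1 j.2

/-- The state after `k` rounds of the auction. -/
structure AuctionInv (ρ : Env) (A : Assignment ρ.n) (X : Finset ℕ) (k : ℕ) (σ : HState) : Prop where
  cand : Cand ρ σ X
  auction : InAuction ρ A X σ
  price_le : A.Sol X → ∀ j ∈ grid ρ.n, σ.arr .price j.1 j.2 ≤ ρ.n * ρ.n + 1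
  progress : (∀ d, A.Real d → σ.arr .mark d.1 d.2 ≠ 0) ∨ ¬ A.Sol X ∨ priceSum ρ σ = k

theorem AuctionInv.congr {k : ℕ} {τ : HState} (h : AuctionInv ρ A X k σ) (e : τ.arr = σ.arr) :
    AuctionInv ρ A X k τ := by
  obtain ⟨h1, h2, h3, h4⟩ := h
  constructor
  · rwa [Cand, e]
  · rwa [InAuction, e]
  · rwa [e]
  · rwa [priceSum, e]

theorem St.arr_eq {p : St} (h : ∀ k, p.keepsArr k = true) (σ : HState) :
    (p.den ρ σ).arr = σ.arr := funext fun k => St.arr_of_keeps (h k) σ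

/-- A round finds every demand marked, or finds a demand without an admissible slot in `X` and so
refutes solvability, or raises exactly one price by one. -/
theorem AuctionInv.round (hE : Expresses ρ real allow A) {k : ℕ} (h : AuctionInv ρ A X k σ) :
    AuctionInv ρ A X (k + 1) ((auctionRound real allow).den ρ σ) := by
  have hf := findUnmet_den hE σ
  have hfa : ((findUnmet real).den ρ σ).arr = σ.arr :=
    St.arr_eq (fun k => by cases k <;> rfl) σ
  rw [auctionRound, St.den_seq]
  generalize (findUnmet real).den ρ σ = τ at hf hfa ⊢
  have hτ := h.congr hfa
  rw [← hfa] at hf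
  rcases hf with ⟨h1, h2⟩ | ⟨h1, h2, h3⟩
  · rw [St.den_cond_neg (by simp [Ex.eval, h1])]
    exact ⟨hτ.1, hτ.2, hτ.3, Or.inl h2⟩
  rw [St.den_cond_pos (by simp [Ex.eval, h1]), St.den_seq]
  have hd := mem_grid.1 (A.real_mem _ h2)
  have hs := findSlot_den hE hτ.cand hd.1 hd.2
  have hsa : ((findSlot allow).den ρ τ).arr = τ.arr :=
    St.arr_eq (fun k => by cases k <;> rfl) τ
  have hcu : ((findSlot allow).den ρ τ).var .curU = τ.var .curU := St.var_of_keeps rfl τ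
  have hcw : ((findSlot allow).den ρ τ).var .curW = τ.var .curW := St.var_of_keeps rfl τ
  generalize (findSlot allow).den ρ τ = υ at hs hsa hcu hcw ⊢
  have hυ := hτ.congr hsa
  rcases hs with ⟨h4, h5⟩ | ⟨h4, h5, h6, h7⟩
  · rw [St.den_cond_neg (by simp [Ex.eval, h4])]
    refine ⟨hυ.1, hυ.2, hυ.3, Or.inr (Or.inl ?_)⟩
    rintro ⟨f, hf, hfX⟩
    exact h5 _ (hf.1 _ h2) (hfX _ h2)
  rw [St.den_cond_pos (by simp [Ex.eval, h4])]
  rw [← hsa] at h3 h7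
  have hj := A.allow_mem _ _ h5
  have hb := mem_grid.1 hj
  obtain ⟨t1, t2, t3⟩ := takeSlot_den (ρ := ρ) hcu hcw rfl rfl hd.1 hd.2 hb.1 hb.2
    (fun hp => mem_grid.1 (A.real_mem _ (hυ.auction.real _ hj hp)))
  have hc : (takeSlot.den ρ υ).arr .cand = υ.arr .cand := St.arr_of_keeps rfl υ
  generalize takeSlot.den ρ υ = ω at t1 t2 t3 hc ⊢
  refine ⟨?_, hυ.auction.step h2 h3 h5 h6 h7 (fun e => t1 e.1 e.2) (fun e => t2 e.1 e.2)
    (fun e => t3 e.1 e.2), ?_, ?_⟩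
  · rw [Cand, hc]; exact hυ.cand
  · intro hsol j hjn
    rw [t3]
    split_ifs
    -- The cheapest slot of an unmarked demand costs at most `n * n` if a solution exists; it then
    -- rises by one.
    · have := hυ.auction.le_of_sol hsol h2 h3 h7
      omega
    · exact hυ.price_le hsol j hjn
  · rcases hυ.progress with hp | hp | hp
    · exact absurd h3 (hp _ h2)
    · exact Or.inr (Or.inl hp)
    · refine Or.inr (Or.inr ?_)
      rw [← hp, priceSum, priceSum, ← Finset.add_sum_erase _ _ hj, ← Finset.add_sum_erase _ _ hj]
      simp only [t3, if_true]
      rw [Finset.sum_congr rfl fun j hj' => if_neg (Finset.ne_of_mem_erase hj')]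
      ring

/-- If `X` is a solution, the prices sum to at most `n ^ 2 * (n ^ 2 + 1)`. This is less than the
number of rounds, so the sum cannot have grown in every round and all demands get marked.
Conversely, a complete marking is a valid assignment. -/
theorem auction_den (hE : Expresses ρ real allow A) (hX : Cand ρ σ X) :
    ((auction real allow).den ρ σ).var .unmet = 0 ↔ A.Sol X := by
  have hinit := St.loop2_inv (ρ := ρ) (v := .demU) (w := .demW)
    (p := .aset .mark (.var .demU) (.var .demW) (.const 0) ;;
      .aset .price (.var .demU) (.var .demW) (.const 0)) (σ := σ) (by decide) rfl
    (fun D τ => (∀ d ∈ D, τ.arr .mark d.1 d.2 = 0) ∧ (∀ d ∈ D, τ.arr .price d.1 d.2 = 0) ∧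
      τ.arr .cand = σ.arr .cand) (by simp)
    (by intro D τ x h; simpa using h) (by intro D τ x h; simpa using h) (by
      rintro D τ hu hw ⟨h1, h2, h3⟩
      simp only [St.den, Ex.eval, seta_var, min_var hu, min_var hw]
      refine ⟨?_, ?_, ?_⟩
      · rintro d (rfl | hd)
        · simp
        · simp [h1 d hd]
      · rintro d (rfl | hd)
        · simp
        · simp [h2 d hd]
      · rw [← h3]
        funext a b
        simp)
  rw [auction, St.den, St.den]
  generalize (St.loop2 .demU .demW (.aset .mark (.var .demU) (.var .demW) (.const 0) ;;
    .aset .price (.var .demU) (.var .demW) (.const 0))).den ρ σ = τ at hinit ⊢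
  obtain ⟨h1, h2, h3⟩ := hinit
  have h1' : ∀ d ∈ grid ρ.n, τ.arr .mark d.1 d.2 = 0 := fun d hd => h1 d (mem_grid.1 hd)
  have h2' : ∀ d ∈ grid ρ.n, τ.arr .price d.1 d.2 = 0 := fun d hd => h2 d (mem_grid.1 hd)
  have h0 : AuctionInv ρ A X 0 τ := by
    refine ⟨?_, Assignment.Auction.init h1' h2', fun _ j hj => by rw [h2' j hj]; omega,
      Or.inr (Or.inr ?_)⟩
    · rw [Cand, h3]; exact hX
    · exact Finset.sum_eq_zero h2'
  have hrep := St.rep_inv (ρ := ρ) (p := auctionRound real allow) (AuctionInv ρ A X)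
    (fun k τ x h => h.congr rfl) (fun k τ h => h.round hE) 5 0 h0
  rw [zero_add] at hrep
  generalize ((auctionRound real allow).rep 5).den ρ τ = υ at hrep ⊢
  rcases findUnmet_den hE υ with ⟨h4, h5⟩ | ⟨h4, h5, h6⟩
  · exact ⟨fun _ => hrep.auction.sol h5, fun _ => h4⟩
  · refine ⟨fun h => by omega, fun hsol => absurd hrep.progress ?_⟩
    rintro (hp | hp | hp)
    · exact hp _ h5 h6
    · exact hp hsol
    · have : priceSum ρ υ ≤ (grid ρ.n).card * (ρ.n * ρ.n + 1) :=
        Finset.sum_le_card_nsmul _ _ _ (hrep.price_le hsol)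
      rw [hp, grid, Finset.card_product, Finset.card_range] at this
      -- Already the fourth power exceeds the bound on the sum of the prices.
      have h7 : (ρ.n + 2) ^ 5 ≥ (ρ.n + 2) ^ 4 := Nat.pow_le_pow_right (by omega) (by omega)
      nlinarith

end RAM

namespace RAM

variable {ρ : Env} {real allow : Ex} {A : Assignment ρ.n} {X Y : Finset ℕ} {σ : HState}

/-! ### Minimal solutions -/

/-- Makes the candidate minimal. -/
def minimize (real allow : Ex) : St :=
  .loop .n .trial (.cond (.arr1 .cand (.var .trial))
    (.aset1 .cand (.var .trial) (.const 0) ;; auction real allow ;;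
      .cond (.var .unmet) (.aset1 .cand (.var .trial) (.const 1)) .skip) .skip)

/-- One pass suffices: since solutions are upward closed, a vertex that could not be removed from a
larger set cannot be removed from a smaller one. -/
theorem minimize_den (hE : Expresses ρ real allow A) (hX : Cand ρ σ X) (hXn : X ⊆ Finset.range ρ.n)
    (hs : A.Sol X) : ∃ Y ⊆ X, A.MinSol Y ∧ Cand ρ ((minimize real allow).den ρ σ) Y := by
  have key := St.loop_inv (ρ := ρ) (l := .n) (v := .trial)
    (p := .cond (.arr1 .cand (.var .trial))
    (.aset1 .cand (.var .trial) (.const 0) ;; auction real allow ;;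
      .cond (.var .unmet) (.aset1 .cand (.var .trial) (.const 1)) .skip) .skip) (σ := σ)
    (fun k τ => ∃ Y ⊆ X, Cand ρ τ Y ∧ A.Sol Y ∧ ∀ v ∈ Y, v < k → ¬ A.Sol (Y.erase v))
    ⟨X, subset_rfl, hX, hs, by simp⟩ ?_
  · obtain ⟨Y, hYX, hY, hYs, hmin⟩ := key
    refine ⟨Y, hYX, ⟨hYX.trans hXn, hYs, fun Z hZ hZs => ?_⟩, hY⟩
    by_contra hne
    obtain ⟨v, hv, hvZ⟩ := Finset.exists_of_ssubset (hZ.ssubset_of_ne hne)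
    exact hmin v hv (Finset.mem_range.1 (hXn (hYX hv)))
      (hZs.mono fun x hx => Finset.mem_erase.2 ⟨fun h => hvZ (h ▸ hx), hZ hx⟩)
  · rintro k hk τ ⟨Y, hYX, hY, hYs, hmin⟩
    have hk' : k < ρ.n := hk
    by_cases hkY : k ∈ Y
    · rw [St.den_cond_pos (by simp [Ex.eval, Ex.arr1, min_var hk', hY k hk', hkY]), St.den_seq,
        St.den_seq]
      have hY' : Cand ρ ((St.aset1 .cand (.var .trial) (.const 0)).den ρ (τ.setv .trial k))
          (Y.erase k) := by
        intro l hl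
        have := hY l hl
        by_cases h : l = k <;> simp [St.den, St.aset1, Ex.eval, min_var hk', h, this]
      have ht : ((St.aset1 .cand (.var .trial) (.const 0)).den ρ (τ.setv .trial k)).var .trial
          = k := by
        rw [St.var_of_keeps rfl]; simp
      generalize (St.aset1 .cand (.var .trial) (.const 0)).den ρ (τ.setv .trial k) = υ at hY' ht ⊢
      have ha := auction_den hE hY'
      have hc : ((auction real allow).den ρ υ).arr .cand = υ.arr .cand := St.arr_of_keeps rfl υ
      have ht' : ((auction real allow).den ρ υ).var .trial = k := by
        rw [St.var_of_keeps rfl, ht]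
      generalize (auction real allow).den ρ υ = ω at ha hc ht' ⊢
      have hω : Cand ρ ω (Y.erase k) := by rw [Cand, hc]; exact hY'
      by_cases hu : ω.var .unmet = 0
      · rw [St.den_cond_neg (by simp [Ex.eval, hu])]
        refine ⟨Y.erase k, (Finset.erase_subset _ _).trans hYX, hω, ha.1 hu, fun v hv hvk hvs => ?_⟩
        have hvY := Finset.mem_of_mem_erase hv
        have := Finset.ne_of_mem_erase hv
        exact hmin v hvY (by omega) (hvs.mono (Finset.erase_subset_erase _ (Finset.erase_subset _ _)))
      · rw [St.den_cond_pos (by simp only [Ex.eval]; omega)]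
        refine ⟨Y, hYX, ?_, hYs, fun v hv hvk hvs => ?_⟩
        · intro l hl
          have := hω l hl
          by_cases h : l = k <;> simp [St.den, St.aset1, Ex.eval, min_var hk', ht', h, this, hkY]
        · rcases Nat.lt_succ_iff_lt_or_eq.1 hvk with h | rfl
          · exact hmin v hv h hvs
          · exact hu (ha.2 hvs)
    · rw [St.den_cond_neg (by simp [Ex.eval, Ex.arr1, min_var hk', hY k hk', hkY])]
      refine ⟨Y, hYX, hY, hYs, fun v hv hvk => hmin v hv ?_⟩
      have : v ≠ k := fun h => hkY (h ▸ hv)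
      omega

/-! ### The store of solutions -/

/-- The search for the set `Y` in the tree of the sets `S i`: starting from `S 0`, whenever the
current set differs from `Y` in an element `l`, the search moves on to the set `alt i l`. -/
def walk (S : ℕ → Finset ℕ) (alt : ℕ → ℕ → ℕ) (Y : Finset ℕ) : ℕ → Option ℕ
  | 0 => some 0
  | l + 1 => (walk S alt Y l).bind fun i =>
    if l ∈ Y ↔ l ∈ S i then some i else if alt i l = 0 then none else some (alt i l)

/-- The size of a record in the store. -/
def stride (n : ℕ) : ℕ := 2 * (n + 2)

/-- The heap holds the distinct minimal solutions `S 0, …, S (m - 1)`. The record of `S i` has the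
bits of `S i` and a pointer for each bit. -/
structure Store (ρ : Env) (A : Assignment ρ.n) (S : ℕ → Finset ℕ) (alt : ℕ → ℕ → ℕ) (m : ℕ)
    (σ : HState) : Prop where
  free : σ.var .free = m * stride ρ.n
  bit : ∀ i < m, ∀ l < ρ.n, σ.heap (i * stride ρ.n + l) = if l ∈ S i then 1 else 0
  ptr : ∀ i < m, ∀ l < ρ.n, σ.heap (i * stride ρ.n + ρ.n + l) = alt i l * stride ρ.n
  zero : ∀ x, m * stride ρ.n ≤ x → σ.heap x = 0
  alt_lt : ∀ i < m, ∀ l < ρ.n, alt i l < m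
  agree : ∀ i < m, ∀ l < ρ.n, alt i l ≠ 0 → ∀ b < l, (b ∈ S (alt i l) ↔ b ∈ S i)
  differ : ∀ i < m, ∀ l < ρ.n, alt i l ≠ 0 → (l ∈ S (alt i l) ↔ l ∉ S i)
  found : ∀ j < m, ∃ i, walk S alt (S j) ρ.n = some i
  min : ∀ j < m, A.MinSol (S j)
  inj : ∀ i < m, ∀ j < m, S i = S j → i = j

variable {S : ℕ → Finset ℕ} {alt : ℕ → ℕ → ℕ} {m : ℕ}

theorem Store.congr (h : Store ρ A S alt m σ) {τ : HState} (hf : τ.var .free = σ.var .free)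
    (hh : τ.heap = σ.heap) : Store ρ A S alt m τ :=
  ⟨hf.trans h.free, hh ▸ h.bit, hh ▸ h.ptr, hh ▸ h.zero, h.alt_lt, h.agree, h.differ, h.found,
    h.min, h.inj⟩

/-- The pointer at position `l` leads to a set that agrees below `l` and differs at `l`. Following
it corrects bit `l` without spoiling earlier bits. -/
theorem Store.walk_agree (h : Store ρ A S alt m σ) (hm : 0 < m) {l i : ℕ} (hl : l ≤ ρ.n)
    (hw : walk S alt Y l = some i) : i < m ∧ ∀ b < l, (b ∈ Y ↔ b ∈ S i) := by
  induction l generalizing i with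
  | zero =>
    rw [walk, Option.some.injEq] at hw
    exact ⟨by omega, by simp⟩
  | succ l ih =>
    rw [walk, Option.bind_eq_some_iff] at hw
    obtain ⟨a, ha, hw⟩ := hw
    obtain ⟨h1, h2⟩ := ih (by omega) ha
    split_ifs at hw with h3 h4
    · cases hw
      refine ⟨h1, fun b hb => ?_⟩
      rcases Nat.lt_succ_iff_lt_or_eq.1 hb with h | rfl
      exacts [h2 b h, h3]
    · cases hw
      refine ⟨h.alt_lt a h1 l (by omega), fun b hb => ?_⟩
      rcases Nat.lt_succ_iff_lt_or_eq.1 hb with hb | rfl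
      · rw [h2 b hb, h.agree a h1 l (by omega) h4 b hb]
      · rw [h.differ a h1 b (by omega) h4]
        tauto

theorem walk_le {l k i : ℕ} (hlk : l ≤ k) (hw : walk S alt Y k = some i) :
    ∃ j, walk S alt Y l = some j := by
  induction k generalizing i with
  | zero => exact ⟨i, by rwa [Nat.le_zero.1 hlk]⟩
  | succ k ih =>
    rcases Nat.le_succ_iff.1 hlk with h | rfl
    · rw [walk, Option.bind_eq_some_iff] at hw
      obtain ⟨a, ha, -⟩ := hw
      exact ih h ha
    · exact ⟨i, hw⟩

/-- `1` if the values differ, `0` otherwise. -/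
def Ex.ne (a b : Ex) : Ex := .ite a b (.const 1) (.ite b a (.const 1) (.const 0))

theorem Ex.eval_ne (a b : Ex) (σ : HState) :
    (Ex.ne a b).eval ρ σ = if a.eval ρ σ = b.eval ρ σ then 0 else 1 := by
  simp only [ne, eval]
  split_ifs <;> omega

/-- Searches for the candidate in the store. -/
def findRecord : St :=
  .set .found (.const 1) ;; .set .ptr (.const 0) ;;
  .loop .n .pos (.cond (.var .found)
    (.cond (.ne (.heap (.add (.var .ptr) (.var .pos))) (.arr1 .cand (.var .pos)))
      (.set .cell (.add (.add (.var .ptr) (.lim .n)) (.var .pos)) ;;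
        .cond (.heap (.var .cell)) (.set .ptr (.heap (.var .cell))) (.set .found (.const 0)))
      .skip) .skip)

/-- Appends a record for the candidate. -/
def addRecord : St :=
  .loop .n .pos (.hset (.add (.var .free) (.var .pos)) (.arr1 .cand (.var .pos))) ;;
  .set .free (.add (.add (.var .free) (.lim .N)) (.lim .N))

/-- Searches for the candidate in the store, and links it if it is not there. -/
def linkRecord : St :=
  .cond (.var .free)
    (findRecord ;; .cond (.var .found) .skip (.hset (.var .cell) (.var .free)))
    (.set .found (.const 0))

/-- Inserts the candidate into the store, unless it is there already. -/
def insertRecord : St := linkRecord ;; .cond (.var .found) .skip addRecord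

/-- On failure, `cell` is the address of the null pointer at which the search got stuck, which is
where a new record must be linked. The value 0 can serve as null because it is the address of the
root, to which no pointer leads. -/
theorem findRecord_den (h : Store ρ A S alt m σ) (hm : 0 < m) (hY : Cand ρ σ Y) :
    ((findRecord.den ρ σ).var .found = 1 ∧ ∃ i, walk S alt Y ρ.n = some i) ∨
    ((findRecord.den ρ σ).var .found = 0 ∧ ∃ l < ρ.n, ∃ i, walk S alt Y l = some i ∧
      ¬ (l ∈ Y ↔ l ∈ S i) ∧ alt i l = 0 ∧
      (findRecord.den ρ σ).var .cell = i * stride ρ.n + ρ.n + l) := by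
  have hst : 0 < stride ρ.n := by simp [stride]
  have key := St.loop_inv (ρ := ρ) (l := .n) (v := .pos)
    (p := .cond (.var .found)
    (.cond (.ne (.heap (.add (.var .ptr) (.var .pos))) (.arr1 .cand (.var .pos)))
      (.set .cell (.add (.add (.var .ptr) (.lim .n)) (.var .pos)) ;;
        .cond (.heap (.var .cell)) (.set .ptr (.heap (.var .cell))) (.set .found (.const 0)))
      .skip) .skip) (σ := (σ.setv .found 1).setv .ptr 0)
    (fun k τ => τ.arr = σ.arr ∧ τ.heap = σ.heap ∧
      ((τ.var .found = 1 ∧ ∃ i, τ.var .ptr = i * stride ρ.n ∧ walk S alt Y k = some i) ∨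
      (τ.var .found = 0 ∧ ∃ l < k, ∃ i, walk S alt Y l = some i ∧
        ¬ (l ∈ Y ↔ l ∈ S i) ∧ alt i l = 0 ∧ τ.var .cell = i * stride ρ.n + ρ.n + l)))
    (by simp [walk]) ?_
  · obtain ⟨-, -, h | h⟩ := key
    · exact Or.inl ⟨h.1, h.2.imp fun i hi => hi.2⟩
    · exact Or.inr h
  · rintro k hk τ ⟨ha, hh, hw⟩
    have hk' : k < ρ.n := hk
    rcases hw with ⟨hf, i, hp, hw⟩ | ⟨hf, l, hl, hw⟩
    swap
    · rw [St.den_cond_neg (by simp [Ex.eval, hf])]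
      refine ⟨ha, hh, Or.inr ⟨by simpa using hf, l, by omega, ?_⟩⟩
      simpa using hw
    rw [St.den_cond_pos (by simp [Ex.eval, hf])]
    obtain ⟨him, -⟩ := h.walk_agree hm hk'.le hw
    have hb := h.bit i him k hk'
    have hc := hY k hk'
    by_cases hd : k ∈ Y ↔ k ∈ S i
    · rw [St.den_cond_neg (by
        simp [Ex.eval_ne, Ex.eval, Ex.arr1, min_var hk', ha, hh, hp, hb, hc, hd])]
      refine ⟨ha, hh, Or.inl ⟨by simpa using hf, i, by simpa using hp, ?_⟩⟩
      rw [walk, hw, Option.bind_some, if_pos hd]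
    · have hcell : ((St.set .cell (.add (.add (.var .ptr) (.lim .n)) (.var .pos))).den ρ
          (τ.setv .pos k)) = (τ.setv .pos k).setv .cell (i * stride ρ.n + ρ.n + k) := by
        simp [St.den, Ex.eval, Lim.val, min_var hk', hp]
      have hp' := h.ptr i him k hk'
      rw [St.den_cond_pos (by
        simp only [Ex.eval_ne, Ex.eval, Ex.arr1, min_var hk', setv_arr, setv_heap, setv_var, ha, hh,
          reduceCtorEq, if_false, if_true, hp, Nat.zero_min, hb, hc]
        by_cases k ∈ Y <;> by_cases k ∈ S i <;> simp_all), St.den_seq, hcell]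
      by_cases h0 : alt i k = 0
      · rw [St.den_cond_neg (by simp [Ex.eval, hh, hp', h0])]
        refine ⟨by simpa [St.den] using ha, by simpa [St.den] using hh, Or.inr
          ⟨by simp [St.den, Ex.eval], k, by omega, i, hw, hd, h0, by simp [St.den]⟩⟩
      · rw [St.den_cond_pos (by
          simp only [Ex.eval, setv_heap, setv_var, if_true, hh, hp']
          exact Nat.mul_pos (by omega) hst)]
        refine ⟨by simpa [St.den] using ha, by simpa [St.den] using hh, Or.inl
          ⟨by simpa [St.den] using hf, alt i k, by simp [St.den, Ex.eval, hh, hp'], ?_⟩⟩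
        rw [walk, hw, Option.bind_some, if_neg hd, if_neg h0]

/-- The effect of `addRecord`. -/
theorem addRecord_den (hY : Cand ρ σ Y) :
    (addRecord.den ρ σ).var .free = σ.var .free + stride ρ.n ∧
    (∀ l < ρ.n, (addRecord.den ρ σ).heap (σ.var .free + l) = if l ∈ Y then 1 else 0) ∧
    (∀ x, (x < σ.var .free ∨ σ.var .free + ρ.n ≤ x) → (addRecord.den ρ σ).heap x = σ.heap x) := by
  have key := St.loop_inv (ρ := ρ) (l := .n) (v := .pos)
    (p := .hset (.add (.var .free) (.var .pos)) (.arr1 .cand (.var .pos))) (σ := σ)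
    (fun k τ => τ.arr = σ.arr ∧ τ.var .free = σ.var .free ∧
      (∀ l < k, τ.heap (σ.var .free + l) = if l ∈ Y then 1 else 0) ∧
      ∀ x, (x < σ.var .free ∨ σ.var .free + k ≤ x) → τ.heap x = σ.heap x) (by simp) ?_
  · obtain ⟨-, h1, h2, h3⟩ := key
    rw [addRecord, St.den_seq]
    refine ⟨?_, h2, h3⟩
    rw [St.den]
    simp [Ex.eval, Lim.val, h1, stride]
    omega
  · rintro k hk τ ⟨h1, h2, h3, h4⟩
    have hk' : k < ρ.n := hk
    simp only [St.den, Ex.eval, Ex.arr1, min_var hk', setv_var, reduceCtorEq, if_false, if_true,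
      seth_var, seth_arr, setv_arr, seth_heap, setv_heap, h1, h2, Nat.zero_min, hY k hk']
    refine ⟨trivial, trivial, fun l hl => ?_, fun x hx => ?_⟩
    · by_cases h : l = k
      · simp [h]
      · rw [if_neg (by omega)]; exact h3 l (by omega)
    · rw [if_neg (by omega)]; exact h4 x (by omega)

/-- The store `S', m'` extends the store `S, m`. -/
def Extends (S : ℕ → Finset ℕ) (m : ℕ) (S' : ℕ → Finset ℕ) (m' : ℕ) : Prop :=
  m ≤ m' ∧ ∀ i < m, S' i = S i

theorem Extends.refl (S : ℕ → Finset ℕ) (m : ℕ) : Extends S m S m := ⟨le_rfl, fun _ _ => rfl⟩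

theorem Extends.trans {S S' S'' : ℕ → Finset ℕ} {m m' m'' : ℕ} (h : Extends S m S' m')
    (h' : Extends S' m' S'' m'') : Extends S m S'' m'' :=
  ⟨h.1.trans h'.1, fun i hi => (h'.2 i (hi.trans_le h.1)).trans (h.2 i hi)⟩

/-- A successful walk follows only nonzero pointers. Insertion overwrites only a null pointer, so
stored sets can still be found. -/
theorem walk_update {l i : ℕ} {alt' : ℕ → ℕ → ℕ} {S' : ℕ → Finset ℕ} {Z : Finset ℕ}
    (h : Store ρ A S alt m σ) (hm : 0 < m) (hl : l ≤ ρ.n) (hS : ∀ i < m, S' i = S i)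
    (halt : ∀ i < m, ∀ b < l, alt i b ≠ 0 → alt' i b = alt i b)
    (hw : walk S alt Z l = some i) : walk S' alt' Z l = some i := by
  induction l generalizing i with
  | zero => exact hw
  | succ l ih =>
    rw [walk, Option.bind_eq_some_iff] at hw
    obtain ⟨a, ha, hw⟩ := hw
    obtain ⟨ham, -⟩ := h.walk_agree hm (by omega) ha
    rw [walk, ih (by omega) (fun i hi b hb => halt i hi b (by omega)) ha, Option.bind_some, hS a ham]
    split_ifs at hw with h1 h2
    · rw [if_pos h1, hw]
    · rw [if_neg h1, halt a ham l (by omega) h2, if_neg h2, hw]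

theorem walk_stay {l k i : ℕ} (hlk : l ≤ k) (hw : walk S alt Y l = some i) (hY : S i = Y) :
    walk S alt Y k = some i := by
  induction k, hlk using Nat.le_induction with
  | base => exact hw
  | succ k _ ih => rw [walk, ih, Option.bind_some, if_pos (by rw [hY])]

/-- If the walk for `Y` completes, it ends at a record agreeing with `Y` in all `n` bits, so `Y` is
stored already. Otherwise the null pointer at which it stopped is redirected to the new record `m`,
and the walk for `Y` now ends there. -/
theorem insertRecord_den (h : Store ρ A S alt m σ) (hY : Cand ρ σ Y) (hYm : A.MinSol Y) :
    ∃ S' alt' m', Store ρ A S' alt' m' (insertRecord.den ρ σ) ∧ Extends S m S' m' ∧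
      ∃ j < m', S' j = Y := by
  -- Records have positive length even when `n = 0`. Therefore `free` is positive exactly when
  -- something is stored.
  have hst : 0 < stride ρ.n := by simp [stride]
  have hsn : 2 * ρ.n < stride ρ.n := by simp only [stride]; omega
  rw [insertRecord, St.den_seq]
  rcases Nat.eq_zero_or_pos m with rfl | hm
  · have hfree : σ.var .free = 0 := by simpa using h.free
    have hl : linkRecord.den ρ σ = (St.set .found (.const 0)).den ρ σ :=
      St.den_cond_neg (by simp [Ex.eval, hfree])
    rw [hl, St.den_cond_neg (by simp [Ex.eval, St.den])]
    obtain ⟨h1, h2, h3⟩ := addRecord_den (ρ := ρ) (Y := Y)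
      (σ := (St.set .found (.const 0)).den ρ σ) (by simpa [Cand, St.den] using hY)
    generalize addRecord.den ρ ((St.set .found (.const 0)).den ρ σ) = τ at h1 h2 h3
    simp only [St.den, setv_var, reduceCtorEq, if_false, hfree, zero_add, setv_heap] at h1 h2 h3
    have hz : ∀ x, ρ.n ≤ x → τ.heap x = 0 := fun x hx => by
      rw [h3 x (Or.inr hx)]; exact h.zero x (by simp)
    refine ⟨fun _ => Y, fun _ _ => 0, 1, ⟨by simpa using h1, ?_, ?_, ?_, ?_, ?_, ?_, ?_, ?_, ?_⟩,
      ⟨by omega, by simp⟩, 0, by omega, rfl⟩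
    · intro i hi l hl
      simpa [Nat.lt_one_iff.1 hi] using h2 l hl
    · intro i hi l hl
      rw [hz _ (by omega), zero_mul]
    · intro x hx
      exact hz x (by omega)
    · simp
    · simp
    · simp
    · intro j _
      exact ⟨0, walk_stay (l := 0) (by omega) rfl rfl⟩
    · intro _ _; exact hYm
    · intro i hi j hj _; omega
  · have hfree := h.free
    have hl : linkRecord.den ρ σ =
        (St.cond (.var .found) .skip (.hset (.var .cell) (.var .free))).den ρ
          (findRecord.den ρ σ) :=
      St.den_cond_pos (by simp only [Ex.eval, hfree]; exact Nat.mul_pos hm hst)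
    rw [hl]
    have hfr := findRecord_den h hm hY
    have ha : (findRecord.den ρ σ).arr = σ.arr := St.arr_eq (fun k => by cases k <;> rfl) σ
    have hh : (findRecord.den ρ σ).heap = σ.heap := St.heap_of_keeps rfl σ
    have hf : (findRecord.den ρ σ).var .free = σ.var .free := St.var_of_keeps rfl σ
    generalize findRecord.den ρ σ = τ at hfr ha hh hf ⊢
    have hτ := h.congr hf hh
    rcases hfr with ⟨h1, i, hw⟩ | ⟨h1, l, hl, i, hw, hd, h0, hcell⟩
    · have e : (St.cond (.var .found) .skip (.hset (.var .cell) (.var .free))).den ρ τ = τ :=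
        St.den_cond_pos (by simp [Ex.eval, h1])
      rw [e, St.den_cond_pos (by simp [Ex.eval, h1]), St.den_skip]
      refine ⟨S, alt, m, hτ, Extends.refl _ _, i, ?_⟩
      obtain ⟨him, hag⟩ := h.walk_agree hm le_rfl hw
      refine ⟨him, ?_⟩
      ext b
      by_cases hb : b < ρ.n
      · exact (hag b hb).symm
      · have e1 : b ∉ S i := fun hbS => hb (Finset.mem_range.1 ((h.min i him).1 hbS))
        have e2 : b ∉ Y := fun hbS => hb (Finset.mem_range.1 (hYm.1 hbS))
        simp [e1, e2]
    · have e : (St.cond (.var .found) .skip (.hset (.var .cell) (.var .free))).den ρ τ =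
          (St.hset (.var .cell) (.var .free)).den ρ τ := St.den_cond_neg (by simp [Ex.eval, h1])
      rw [e, St.den_cond_neg (by simp [Ex.eval, St.den, h1])]
      obtain ⟨h2, h3, h4⟩ := addRecord_den (ρ := ρ) (Y := Y)
        (σ := (St.hset (.var .cell) (.var .free)).den ρ τ) (by simpa [Cand, St.den, ha] using hY)
      generalize addRecord.den ρ ((St.hset (.var .cell) (.var .free)).den ρ τ) = υ at h2 h3 h4 ⊢
      simp only [St.den, Ex.eval, seth_var, seth_heap, hf, hfree, hh, hcell] at h2 h3 h4
      obtain ⟨him, hag⟩ := h.walk_agree hm hl.le hw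
      have hrec : ∀ j < m, j * stride ρ.n + stride ρ.n ≤ m * stride ρ.n := fun j hj => by
        rw [← Nat.succ_mul]; exact Nat.mul_le_mul_right _ hj
      -- two positions in records coincide only if they are the same
      have hpos : ∀ a b c d, b < stride ρ.n → d < stride ρ.n →
          a * stride ρ.n + b = c * stride ρ.n + d → a = c ∧ b = d := by
        intro a b c d hb hd e
        have h5 : (a * stride ρ.n + b) / stride ρ.n = a := by
          rw [Nat.mul_comm, Nat.mul_add_div hst, Nat.div_eq_of_lt hb, add_zero]
        have h6 : (c * stride ρ.n + d) / stride ρ.n = c := by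
          rw [Nat.mul_comm, Nat.mul_add_div hst, Nat.div_eq_of_lt hd, add_zero]
        have : a = c := by rw [← h5, e, h6]
        subst this
        exact ⟨rfl, by omega⟩
      let S' : ℕ → Finset ℕ := fun j => if j = m then Y else S j
      let alt' : ℕ → ℕ → ℕ := fun j b => if j = m then 0 else if j = i ∧ b = l then m else alt j b
      have hS' : ∀ j < m, S' j = S j := fun j hj => if_neg (by omega)
      have hS'm : S' m = Y := if_pos rfl
      have halt' : ∀ j < m, ∀ b, ¬ (j = i ∧ b = l) → alt' j b = alt j b := fun j hj b hjb => by
        simp only [alt']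
        rw [if_neg (by omega), if_neg hjb]
      have halti : alt' i l = m := by
        simp only [alt']
        rw [if_neg (by omega), if_pos ⟨trivial, trivial⟩]
      have haltm : ∀ b, alt' m b = 0 := fun b => if_pos rfl
      have hold : ∀ j < m, ∀ b, alt j b ≠ 0 → alt' j b = alt j b := fun j hj b hjb =>
        halt' j hj b (by rintro ⟨rfl, rfl⟩; exact hjb h0)
      -- Were `Y` stored, its walk would run through all `n` positions, whereas it is stuck at
      -- position `l`.
      have hnew : ∀ j < m, S j ≠ Y := by
        rintro j hj rfl
        obtain ⟨i', hi'⟩ := h.found j hj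
        obtain ⟨i'', hi''⟩ := walk_le (l := l + 1) (by omega) hi'
        rw [walk, hw, Option.bind_some, if_neg hd, if_pos h0] at hi''
        cases hi''
      refine ⟨S', alt', m + 1, ⟨?_, ?_, ?_, ?_, ?_, ?_, ?_, ?_, ?_, ?_⟩,
        ⟨by omega, hS'⟩, m, by omega, hS'm⟩
      · rw [h2, Nat.succ_mul]
      · intro j hj b hb
        rcases Nat.lt_succ_iff_lt_or_eq.1 hj with hjm | rfl
        · have := hrec j hjm
          rw [h4 _ (Or.inl (by omega)), if_neg, hS' j hjm, h.bit j hjm b hb]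
          intro e
          have := (hpos j b i (ρ.n + l) (by omega) (by omega) (by omega)).2
          omega
        · rw [hS'm]; exact h3 b hb
      · intro j hj b hb
        rcases Nat.lt_succ_iff_lt_or_eq.1 hj with hjm | rfl
        · have := hrec j hjm
          rw [h4 _ (Or.inl (by omega))]
          by_cases hjb : j = i ∧ b = l
          · rw [hjb.1, hjb.2, if_pos rfl, halti]
          · rw [if_neg, h.ptr j hjm b hb, halt' j hjm b hjb]
            intro e
            have := hpos j (ρ.n + b) i (ρ.n + l) (by omega) (by omega) (by omega)
            exact hjb ⟨this.1, by omega⟩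
        · have := hrec i him
          rw [h4 _ (Or.inr (by omega)), if_neg (by omega), haltm, zero_mul]
          exact h.zero _ (by omega)
      · intro x hx
        rw [Nat.succ_mul] at hx
        have := hrec i him
        rw [h4 _ (Or.inr (by omega)), if_neg (by omega)]
        exact h.zero x (by omega)
      · intro j hj b hb
        rcases Nat.lt_succ_iff_lt_or_eq.1 hj with hjm | rfl
        · by_cases hjb : j = i ∧ b = l
          · rw [hjb.1, hjb.2, halti]; omega
          · rw [halt' j hjm b hjb]
            have := h.alt_lt j hjm b hb
            omega
        · rw [haltm]; omega
      · intro j hj b hb hne c hc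
        rcases Nat.lt_succ_iff_lt_or_eq.1 hj with hjm | rfl
        · by_cases hjb : j = i ∧ b = l
          · obtain ⟨rfl, rfl⟩ := hjb
            rw [halti, hS'm, hS' j hjm]
            exact hag c hc
          · rw [halt' j hjm b hjb] at hne ⊢
            rw [hS' j hjm, hS' _ (h.alt_lt j hjm b hb)]
            exact h.agree j hjm b hb hne c hc
        · exact absurd (haltm b) hne
      · intro j hj b hb hne
        rcases Nat.lt_succ_iff_lt_or_eq.1 hj with hjm | rfl
        · by_cases hjb : j = i ∧ b = l
          · obtain ⟨rfl, rfl⟩ := hjb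
            rw [halti, hS'm, hS' j hjm]
            tauto
          · rw [halt' j hjm b hjb] at hne ⊢
            rw [hS' j hjm, hS' _ (h.alt_lt j hjm b hb)]
            exact h.differ j hjm b hb hne
        · exact absurd (haltm b) hne
      · intro j hj
        rcases Nat.lt_succ_iff_lt_or_eq.1 hj with hjm | rfl
        · obtain ⟨i', hi'⟩ := h.found j hjm
          rw [hS' j hjm]
          exact ⟨i', walk_update h hm le_rfl hS' (fun j hj b _ => hold j hj b) hi'⟩
        -- The walk for `Y` up to position `l` is as before; the new pointer takes it to record `m`,
        -- where it stays as no bit differs.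
        · have h5 : walk S' alt' Y l = some i :=
            walk_update h hm hl.le hS' (fun j hj b _ => hold j hj b) hw
          have h6 : walk S' alt' Y (l + 1) = some j := by
            rw [walk, h5, Option.bind_some, hS' i him, if_neg hd, halti, if_neg (by omega)]
          rw [hS'm]
          exact ⟨j, walk_stay hl h6 hS'm⟩
      · intro j hj
        rcases Nat.lt_succ_iff_lt_or_eq.1 hj with hjm | rfl
        · rw [hS' j hjm]; exact h.min j hjm
        · rw [hS'm]; exact hYm
      · intro j hj k hk e
        rcases Nat.lt_succ_iff_lt_or_eq.1 hj with hjm | rfl <;>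
        rcases Nat.lt_succ_iff_lt_or_eq.1 hk with hkm | rfl
        · rw [hS' j hjm, hS' k hkm] at e
          exact h.inj j hjm k hkm e
        · rw [hS' j hjm, hS'm] at e
          exact absurd e (hnew j hjm)
        · rw [hS' k hkm, hS'm] at e
          exact absurd e.symm (hnew k hkm)
        · rfl

/-- If the candidate is a solution, makes it minimal and inserts it into the store. -/
def processCand (real allow : Ex) : St :=
  auction real allow ;; .cond (.var .unmet) .skip (minimize real allow ;; insertRecord)

theorem processCand_den (hE : Expresses ρ real allow A) (h : Store ρ A S alt m σ)
    (hX : Cand ρ σ X) (hXn : X ⊆ Finset.range ρ.n) :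
    ∃ S' alt' m', Store ρ A S' alt' m' ((processCand real allow).den ρ σ) ∧ Extends S m S' m' ∧
      (A.Sol X → ∃ j < m', S' j ⊆ X) := by
  have ha := auction_den hE hX
  have hc : ((auction real allow).den ρ σ).arr .cand = σ.arr .cand := St.arr_of_keeps rfl σ
  have hs : Store ρ A S alt m ((auction real allow).den ρ σ) :=
    h.congr (St.var_of_keeps rfl σ) (St.heap_of_keeps rfl σ)
  rw [processCand, St.den_seq]
  generalize (auction real allow).den ρ σ = τ at ha hc hs ⊢
  by_cases hu : τ.var .unmet = 0
  · rw [St.den_cond_neg (by simp [Ex.eval, hu]), St.den_seq]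
    obtain ⟨Y, hYX, hY, hYc⟩ := minimize_den (σ := τ) hE (by rw [Cand, hc]; exact hX) hXn (ha.1 hu)
    have hs' : Store ρ A S alt m ((minimize real allow).den ρ τ) :=
      hs.congr (St.var_of_keeps rfl τ) (St.heap_of_keeps rfl τ)
    obtain ⟨S', alt', m', h1, h2, j, hj, hjY⟩ := insertRecord_den hs' hYc hY
    exact ⟨S', alt', m', h1, h2, fun _ => ⟨j, hj, hjY ▸ hYX⟩⟩
  · rw [St.den_cond_pos (by simp only [Ex.eval]; omega)]
    exact ⟨S, alt, m, hs, Extends.refl _ _, fun h => absurd (ha.2 h) hu⟩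

end RAM

namespace RAM

variable {ρ : Env} {real allow : Ex} {A : Assignment ρ.n} {X Y : Finset ℕ} {σ : HState}
  {S : ℕ → Finset ℕ} {alt : ℕ → ℕ → ℕ} {m : ℕ}

/-! ### Processing a solution -/

/-- The candidate obtained from the solution at `head` by adding the vertices in the first
`width` cells of `dig`, and removing the vertex `gone`. -/
def setCand : St :=
  .loop .n .pos (.aset1 .cand (.var .pos) (.heap (.add (.var .head) (.var .pos)))) ;;
  .loop .n .pos (.ite (.var .pos) (.var .width)
    (.aset1 .cand (.arr1 .dig (.var .pos)) (.const 1)) .skip) ;;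
  .aset1 .cand (.var .gone) (.const 0)

/-- Adds `1` to the number with the digits `dig` in base `n`. -/
def advance : St :=
  .set .carry (.const 1) ;;
  .loop .n .pos (.cond (.var .carry)
    (.ite (.succ (.arr1 .dig (.var .pos))) (.lim .n)
      (.aset1 .dig (.var .pos) (.succ (.arr1 .dig (.var .pos))) ;; .set .carry (.const 0))
      (.aset1 .dig (.var .pos) (.const 0))) .skip)

/-- Processes all candidates obtained from the solution at `head` by removing `gone`. -/
def processGone (real allow : Ex) : St :=
  .loop .n .pos (.aset1 .dig (.var .pos) (.const 0)) ;;
  .loop .R .turn (setCand ;; processCand real allow ;; advance)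

/-- Processes the solution at `head` and moves on to the next one. -/
def processHead (real allow : Ex) : St :=
  .loop .n .gone (.cond (.heap (.add (.var .head) (.var .gone))) (processGone real allow) .skip) ;;
  .set .head (.add (.add (.var .head) (.lim .N)) (.lim .N))

/-- Writes the solution at `head`. -/
def writeHead : St :=
  .loop .n .pos (.cond (.heap (.add (.var .head) (.var .pos))) (.out (.var .pos)) .skip)

/-- The vertex `gone` is deleted last, so it does no harm if the digits name it. -/
theorem setCand_den (hX : ∀ l < ρ.n, σ.heap (σ.var .head + l) = if l ∈ X then 1 else 0)
    {D : ℕ → ℕ} (hD : ∀ l < ρ.n, σ.arr .dig l 0 = D l) (hDn : ∀ l < ρ.n, D l < ρ.n)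
    (hw : σ.var .width ≤ ρ.n) (hg : σ.var .gone < ρ.n) :
    Cand ρ (setCand.den ρ σ)
      ((X ∪ (Finset.range (σ.var .width)).image D).erase (σ.var .gone)) := by
  have k1 := St.loop_inv (ρ := ρ) (l := .n) (v := .pos)
    (p := .aset1 .cand (.var .pos) (.heap (.add (.var .head) (.var .pos)))) (σ := σ)
    (fun k τ => τ.var .head = σ.var .head ∧ τ.heap = σ.heap ∧
      ∀ l < k, τ.arr .cand l 0 = if l ∈ X then 1 else 0) (by simp) (by
      rintro k hk τ ⟨h1, h2, h3⟩
      have hk' : k < ρ.n := hk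
      refine ⟨by simpa [St.den, St.aset1] using h1, by simpa [St.den, St.aset1] using h2,
        fun l hl => ?_⟩
      simp only [St.den, St.aset1, Ex.eval, setv_var, if_true, reduceCtorEq, if_false,
        min_var hk', seta_arr, setv_arr, setv_heap, h1, h2, hX k hk', Nat.zero_min, true_and,
        and_true]
      by_cases hlk : l = k
      · rw [if_pos hlk, hlk]
      · rw [if_neg hlk]
        exact h3 l (by omega))
  have f1 : ((St.loop .n .pos (.aset1 .cand (.var .pos)
      (.heap (.add (.var .head) (.var .pos))))).den ρ σ).arr .dig = σ.arr .dig :=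
    St.arr_of_keeps rfl σ
  have f2 : ((St.loop .n .pos (.aset1 .cand (.var .pos)
      (.heap (.add (.var .head) (.var .pos))))).den ρ σ).var .width = σ.var .width :=
    St.var_of_keeps rfl σ
  have f3 : ((St.loop .n .pos (.aset1 .cand (.var .pos)
      (.heap (.add (.var .head) (.var .pos))))).den ρ σ).var .gone = σ.var .gone :=
    St.var_of_keeps rfl σ
  rw [setCand, St.den_seq, St.den_seq]
  generalize (St.loop .n .pos (.aset1 .cand (.var .pos)
      (.heap (.add (.var .head) (.var .pos))))).den ρ σ = τ at k1 f1 f2 f3 ⊢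
  obtain ⟨-, -, k1⟩ := k1
  have k2 := St.loop_inv (ρ := ρ) (l := .n) (v := .pos)
    (p := .ite (.var .pos) (.var .width)
    (.aset1 .cand (.arr1 .dig (.var .pos)) (.const 1)) .skip) (σ := τ)
    (fun k υ => υ.var .width = τ.var .width ∧ υ.var .gone = τ.var .gone ∧
      υ.arr .dig = τ.arr .dig ∧
      ∀ l < ρ.n, υ.arr .cand l 0 =
        if l ∈ X ∪ (Finset.range (min k (σ.var .width))).image D then 1 else 0)
    ⟨rfl, rfl, rfl, by simpa [Lim.val] using k1⟩ (by
      rintro k hk υ ⟨h1, h2, h3, h4⟩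
      have hk' : k < ρ.n := hk
      by_cases hkw : k < σ.var .width
      · have e : (St.ite (.var .pos) (.var .width) (.aset1 .cand (.arr1 .dig (.var .pos)) (.const 1))
            .skip).den ρ (υ.setv .pos k) = (υ.setv .pos k).seta .cand (D k) 0 1 := by
          rw [St.den, if_pos (by simpa [Ex.eval, h1, f2] using hkw)]
          simp [St.den, St.aset1, Ex.eval, Ex.arr1, min_var hk', h3, f1, hD k hk',
            min_var (hDn k hk')]
        rw [e]
        refine ⟨by simpa using h1, by simpa using h2, by rw [← h3]; funext a b; simp,
          fun l hl => ?_⟩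
        have e1 : min (k + 1) (σ.var .width) = k + 1 := by omega
        have e2 : min k (σ.var .width) = k := by omega
        have := h4 l hl
        rw [e2] at this
        rw [e1, Finset.range_add_one, Finset.image_insert, Finset.union_insert]
        by_cases hlk : l = D k <;> simp [hlk] at this ⊢
        exact this
      · have e : (St.ite (.var .pos) (.var .width) (.aset1 .cand (.arr1 .dig (.var .pos)) (.const 1))
            .skip).den ρ (υ.setv .pos k) = υ.setv .pos k := by
          rw [St.den, if_neg (by simpa [Ex.eval, h1, f2] using hkw), St.den_skip]
        rw [e]
        refine ⟨by simpa using h1, by simpa using h2, h3, fun l hl => ?_⟩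
        have e1 : min (k + 1) (σ.var .width) = min k (σ.var .width) := by omega
        rw [e1]
        exact h4 l hl)
  generalize (St.loop .n .pos (.ite (.var .pos) (.var .width)
    (.aset1 .cand (.arr1 .dig (.var .pos)) (.const 1)) .skip)).den ρ τ = υ at k2 ⊢
  obtain ⟨h1, h2, h3, h4⟩ := k2
  intro l hl
  have := h4 l hl
  rw [show min (Lim.val ρ .n) (σ.var .width) = σ.var .width from min_eq_right hw] at this
  have hg' : υ.var .gone = σ.var .gone := h2.trans f3
  by_cases h : l = σ.var .gone
  · simp [St.den, St.aset1, Ex.eval, hg', min_var hg, h]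
  · simp [St.den, St.aset1, Ex.eval, hg', min_var hg, h] at this ⊢
    exact this

theorem advance_den {r : ℕ} (h : ∀ l < ρ.n, σ.arr .dig l 0 = r / ρ.n ^ l % ρ.n) :
    ∀ l < ρ.n, (advance.den ρ σ).arr .dig l 0 = (r + 1) / ρ.n ^ l % ρ.n := by
  have key := St.loop_inv (ρ := ρ) (l := .n) (v := .pos)
    (p := .cond (.var .carry)
    (.ite (.succ (.arr1 .dig (.var .pos))) (.lim .n)
      (.aset1 .dig (.var .pos) (.succ (.arr1 .dig (.var .pos))) ;; .set .carry (.const 0))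
      (.aset1 .dig (.var .pos) (.const 0))) .skip) (σ := σ.setv .carry 1)
    -- There is a carry into position `k` exactly when all lower digits of `r + 1` vanish.
    (fun k τ => (τ.var .carry = if ρ.n ^ k ∣ r + 1 then 1 else 0) ∧
      ∀ l < ρ.n, τ.arr .dig l 0 =
        if l < k then (r + 1) / ρ.n ^ l % ρ.n else r / ρ.n ^ l % ρ.n) ⟨by simp, by simpa using h⟩ ?_
  · intro l hl
    have := key.2 l hl
    rwa [if_pos (show l < Lim.val ρ .n from hl)] at this
  · rintro k hk τ ⟨h1, h2⟩
    have hk' : k < ρ.n := hk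
    have hn : 0 < ρ.n := by omega
    have hd := h2 k hk'
    rw [if_neg (lt_irrefl k)] at hd
    have hdiv := Nat.succ_div (a := r) (b := ρ.n ^ k)
    by_cases hc : ρ.n ^ k ∣ r + 1
    · rw [if_pos hc] at h1 hdiv
      rw [St.den_cond_pos (by simp [Ex.eval, h1])]
      have hdvd : ρ.n ^ (k + 1) ∣ r + 1 ↔ ρ.n ∣ r / ρ.n ^ k + 1 := by
        rw [← hdiv, pow_succ]
        exact (Nat.dvd_div_iff_mul_dvd hc).symm
      have hmod := Nat.add_mod (r / ρ.n ^ k) 1 ρ.n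
      have hlt := Nat.mod_lt (r / ρ.n ^ k) hn
      by_cases hs : r / ρ.n ^ k % ρ.n + 1 < ρ.n
      · have hmod' : (r / ρ.n ^ k + 1) % ρ.n = r / ρ.n ^ k % ρ.n + 1 := by
          rw [hmod, Nat.mod_eq_of_lt (a := 1) (by omega), Nat.mod_eq_of_lt hs]
        have e : (St.ite (.succ (.arr1 .dig (.var .pos))) (.lim .n)
            (.aset1 .dig (.var .pos) (.succ (.arr1 .dig (.var .pos))) ;; .set .carry (.const 0))
            (.aset1 .dig (.var .pos) (.const 0))).den ρ (τ.setv .pos k) =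
            ((τ.setv .pos k).seta .dig k 0 (r / ρ.n ^ k % ρ.n + 1)).setv .carry 0 := by
          rw [St.den, if_pos (by simpa [Ex.eval, Ex.arr1, min_var hk', hd, Lim.val] using hs)]
          simp [St.den, St.aset1, Ex.eval, Ex.arr1, min_var hk', hd]
        rw [e]
        refine ⟨?_, fun l hl => ?_⟩
        · rw [if_neg (by rw [hdvd, Nat.dvd_iff_mod_eq_zero, hmod']; omega)]
          simp
        · by_cases hlk : l = k
          · rw [if_pos (by omega), hlk, hdiv, hmod']
            simp
          · have := h2 l hl
            simp only [setv_arr, seta_arr, hlk, false_and, and_false, if_false]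
            rw [this]
            by_cases hlk' : l < k
            · rw [if_pos hlk', if_pos (by omega)]
            · rw [if_neg hlk', if_neg (by omega)]
      · have hmod' : (r / ρ.n ^ k + 1) % ρ.n = 0 := by
          rw [← Nat.mod_add_mod, show r / ρ.n ^ k % ρ.n + 1 = ρ.n by omega, Nat.mod_self]
        have e : (St.ite (.succ (.arr1 .dig (.var .pos))) (.lim .n)
            (.aset1 .dig (.var .pos) (.succ (.arr1 .dig (.var .pos))) ;; .set .carry (.const 0))
            (.aset1 .dig (.var .pos) (.const 0))).den ρ (τ.setv .pos k) =
            (τ.setv .pos k).seta .dig k 0 0 := by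
          rw [St.den, if_neg (by simpa [Ex.eval, Ex.arr1, min_var hk', hd, Lim.val] using hs)]
          simp [St.den, St.aset1, Ex.eval, min_var hk']
        rw [e]
        refine ⟨?_, fun l hl => ?_⟩
        · rw [if_pos (by rw [hdvd, Nat.dvd_iff_mod_eq_zero, hmod'])]
          simpa using h1
        · by_cases hlk : l = k
          · rw [if_pos (by omega), hlk, hdiv, hmod']
            simp
          · have := h2 l hl
            simp only [setv_arr, seta_arr, hlk, false_and, and_false, if_false]
            rw [this]
            by_cases hlk' : l < k
            · rw [if_pos hlk', if_pos (by omega)]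
            · rw [if_neg hlk', if_neg (by omega)]
    · rw [if_neg hc] at h1 hdiv
      rw [St.den_cond_neg (by simp [Ex.eval, h1]), St.den_skip]
      refine ⟨?_, fun l hl => ?_⟩
      · rw [if_neg (fun h => hc ((pow_dvd_pow _ (by omega)).trans h))]
        simpa using h1
      · have := h2 l hl
        rw [setv_arr, this]
        by_cases hlk : l = k
        · rw [hlk, if_neg (lt_irrefl k), if_pos (by omega), hdiv, add_zero]
        · by_cases hlk' : l < k
          · rw [if_pos hlk', if_pos (by omega)]
          · rw [if_neg hlk', if_neg (by omega)]

theorem exists_digits {n m : ℕ} (f : ℕ → ℕ) (hf : ∀ l < m, f l < n) :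
    ∃ r < n ^ m, ∀ l < m, r / n ^ l % n = f l := by
  induction m generalizing f with
  | zero => exact ⟨0, by simp, by simp⟩
  | succ m ih =>
    obtain ⟨r, hr, h⟩ := ih (fun l => f (l + 1)) (fun l hl => hf (l + 1) (by omega))
    have h0 := hf 0 (by omega)
    refine ⟨f 0 + n * r, ?_, fun l hl => ?_⟩
    · rw [pow_succ]
      nlinarith [Nat.mul_le_mul_left n (Nat.succ_le_of_lt hr)]
    · rcases l with - | l
      · simp [Nat.mod_eq_of_lt h0]
      · rw [pow_succ', ← Nat.div_div_eq_div_mul, Nat.add_mul_div_left _ _ (by omega),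
          Nat.div_eq_of_lt h0, zero_add]
        exact h l (by omega)

/-- A list of the elements of `T`, padded to length `m` by repeating one of them, is read as a
number in base `n`. Counting from 0 to `n ^ m - 1` thus runs through all nonempty sets of at most
`m` vertices, possibly with repetitions. -/
theorem exists_digits_image {n m : ℕ} {T : Finset ℕ} (hT : T ⊆ Finset.range n) (hne : T.Nonempty)
    (hm : T.card ≤ m) : ∃ r < n ^ m, (Finset.range m).image (fun l => r / n ^ l % n) = T := by
  obtain ⟨t, ht⟩ := hne
  let f : ℕ → ℕ := fun l => T.toList.getD l t
  have hfT : ∀ l, f l ∈ T := by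
    intro l
    by_cases h : l < T.toList.length
    · simp only [f, List.getD_eq_getElem _ _ h]
      exact Finset.mem_toList.1 (List.getElem_mem h)
    · simp only [f, List.getD_eq_default _ _ (not_lt.1 h)]
      exact ht
  obtain ⟨r, hr, h⟩ := exists_digits (n := n) (m := m) f
    (fun l _ => Finset.mem_range.1 (hT (hfT l)))
  refine ⟨r, hr, ?_⟩
  ext x
  simp only [Finset.mem_image, Finset.mem_range]
  constructor
  · rintro ⟨l, hl, rfl⟩
    rw [h l hl]; exact hfT l
  · intro hx
    obtain ⟨l, hl, rfl⟩ := List.getElem_of_mem (Finset.mem_toList.2 hx)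
    have hl' : l < T.card := by simpa using hl
    refine ⟨l, by omega, ?_⟩
    rw [h l (by omega)]
    simp only [f, List.getD_eq_getElem _ _ hl]

/-- The candidate of the round `r`. -/
def candidate (n w : ℕ) (X : Finset ℕ) (v r : ℕ) : Finset ℕ :=
  (X ∪ (Finset.range w).image fun l => r / n ^ l % n).erase v

/-- If `X` is a solution, the store contains a subset of it. -/
def Covers (A : Assignment ρ.n) (S : ℕ → Finset ℕ) (m : ℕ) (X : Finset ℕ) : Prop :=
  A.Sol X → ∃ j < m, S j ⊆ X

theorem Covers.extend {S' : ℕ → Finset ℕ} {m' : ℕ} (h : Covers A S m X) (he : Extends S m S' m') :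
    Covers A S' m' X := fun hX => by
  obtain ⟨j, hj, hjX⟩ := h hX
  exact ⟨j, hj.trans_le he.1, (he.2 j hj).symm ▸ hjX⟩

/-- The store grows during the loop, but existing records keep their sets. Hence the solution at
`head` can be reread in each round, and candidates that were covered remain covered. -/
theorem processGone_den (hE : Expresses ρ real allow A) {h v : ℕ} (hS : Store ρ A S alt m σ)
    (hh : σ.var .head = h * stride ρ.n) (hm : h < m) (hw : σ.var .width ≤ ρ.n)
    (hv : σ.var .gone = v) (hvn : v < ρ.n) :
    ∃ S' alt' m', Store ρ A S' alt' m' ((processGone real allow).den ρ σ) ∧ Extends S m S' m' ∧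
      ∀ r < ρ.R, Covers A S' m' (candidate ρ.n (σ.var .width) (S h) v r) := by
  have k1 := St.loop_inv (ρ := ρ) (l := .n) (v := .pos)
    (p := .aset1 .dig (.var .pos) (.const 0)) (σ := σ)
    (fun k τ => ∀ l < k, τ.arr .dig l 0 = 0) (by simp) (by
      rintro k hk τ h1 l hl
      have hk' : k < ρ.n := hk
      by_cases hlk : l = k
      · simp [St.den, St.aset1, Ex.eval, min_var hk', hlk]
      · have := h1 l (by omega)
        simp [St.den, St.aset1, Ex.eval, min_var hk', hlk, this])
  have s1 : Store ρ A S alt m ((St.loop .n .pos (.aset1 .dig (.var .pos) (.const 0))).den ρ σ) :=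
    hS.congr (St.var_of_keeps rfl σ) (St.heap_of_keeps rfl σ)
  have f1 : ((St.loop .n .pos (.aset1 .dig (.var .pos) (.const 0))).den ρ σ).var .head =
    σ.var .head := St.var_of_keeps rfl σ
  have f2 : ((St.loop .n .pos (.aset1 .dig (.var .pos) (.const 0))).den ρ σ).var .width =
    σ.var .width := St.var_of_keeps rfl σ
  have f3 : ((St.loop .n .pos (.aset1 .dig (.var .pos) (.const 0))).den ρ σ).var .gone =
    σ.var .gone := St.var_of_keeps rfl σ
  rw [processGone, St.den_seq]
  generalize (St.loop .n .pos (.aset1 .dig (.var .pos) (.const 0))).den ρ σ = τ at k1 s1 f1 f2 f3 ⊢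
  have key := St.loop_inv (ρ := ρ) (l := .R) (v := .turn)
    (p := setCand ;; processCand real allow ;; advance) (σ := τ)
    (fun k υ => υ.var .head = σ.var .head ∧ υ.var .width = σ.var .width ∧ υ.var .gone = v ∧
      (∀ l < ρ.n, υ.arr .dig l 0 = k / ρ.n ^ l % ρ.n) ∧
      ∃ S' alt' m', Store ρ A S' alt' m' υ ∧ Extends S m S' m' ∧
      ∀ r < k, Covers A S' m' (candidate ρ.n (σ.var .width) (S h) v r))
    ⟨f1, f2, f3.trans hv, fun l hl => by simpa using k1 l hl, S, alt, m, s1, Extends.refl _ _,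
      by simp⟩ ?_
  · obtain ⟨-, -, -, -, key⟩ := key
    exact key
  · rintro k hk υ ⟨h1, h2, h3, h4, S', alt', m', h5, h6, h7⟩
    have hS'h : S' h = S h := h6.2 h hm
    have hhm' : h < m' := hm.trans_le h6.1
    have hsub := (h5.min h hhm').1
    rw [hS'h] at hsub
    have hdig : ∀ l < ρ.n, k / ρ.n ^ l % ρ.n < ρ.n := fun l hl => Nat.mod_lt _ (by omega)
    have c1 := setCand_den (ρ := ρ) (X := S h) (σ := υ.setv .turn k)
      (fun l hl => by
        have := h5.bit h hhm' l hl
        rw [hS'h] at this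
        simpa [h1, hh] using this) (D := fun l => k / ρ.n ^ l % ρ.n) (by simpa using h4) hdig
      (by simpa [h2] using hw) (by simpa [h3] using hvn)
    have s2 : Store ρ A S' alt' m' (setCand.den ρ (υ.setv .turn k)) :=
      h5.congr ((St.var_of_keeps rfl _).trans (by simp)) (St.heap_of_keeps rfl _)
    have g1 : (setCand.den ρ (υ.setv .turn k)).var .head = υ.var .head :=
      (St.var_of_keeps rfl _).trans (by simp)
    have g2 : (setCand.den ρ (υ.setv .turn k)).var .width = υ.var .width :=
      (St.var_of_keeps rfl _).trans (by simp)
    have g3 : (setCand.den ρ (υ.setv .turn k)).var .gone = υ.var .gone :=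
      (St.var_of_keeps rfl _).trans (by simp)
    have g4 : (setCand.den ρ (υ.setv .turn k)).arr .dig = υ.arr .dig := St.arr_of_keeps rfl _
    rw [St.den_seq, St.den_seq]
    generalize setCand.den ρ (υ.setv .turn k) = ω at c1 s2 g1 g2 g3 g4 ⊢
    simp only [setv_var, reduceCtorEq, if_false, h2, h3] at c1
    obtain ⟨S'', alt'', m'', h8, h9, h10⟩ := processCand_den hE s2 c1 (by
      refine (Finset.erase_subset _ _).trans (Finset.union_subset hsub ?_)
      intro x hx
      obtain ⟨l, hl, rfl⟩ := Finset.mem_image.1 hx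
      have := Finset.mem_range.1 hl
      exact Finset.mem_range.2 (hdig l (by omega)))
    have g1' : ((processCand real allow).den ρ ω).var .head = ω.var .head := St.var_of_keeps rfl _
    have g2' : ((processCand real allow).den ρ ω).var .width = ω.var .width :=
      St.var_of_keeps rfl _
    have g3' : ((processCand real allow).den ρ ω).var .gone = ω.var .gone := St.var_of_keeps rfl _
    have g4' : ((processCand real allow).den ρ ω).arr .dig = ω.arr .dig := St.arr_of_keeps rfl _
    generalize (processCand real allow).den ρ ω = ω' at h8 g1' g2' g3' g4' ⊢
    refine ⟨?_, ?_, ?_, ?_, S'', alt'', m'', ?_, h6.trans h9, ?_⟩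
    · rw [St.var_of_keeps rfl, g1', g1, h1]
    · rw [St.var_of_keeps rfl, g2', g2, h2]
    · rw [St.var_of_keeps rfl, g3', g3, h3]
    · exact advance_den (by rw [g4', g4]; exact h4)
    · exact h8.congr (St.var_of_keeps rfl _) (St.heap_of_keeps rfl _)
    · intro r hr
      rcases Nat.lt_succ_iff_lt_or_eq.1 hr with hr | rfl
      · exact (h7 r hr).extend h9
      · exact h10

/-- The bound on `width` is conditional because the width is at least 1 and fails to be at most `n`
when `n = 0`; in that case the loop over `gone` is empty. -/
theorem processHead_den (hE : Expresses ρ real allow A) {h : ℕ} (hS : Store ρ A S alt m σ)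
    (hh : σ.var .head = h * stride ρ.n) (hm : h < m) (hw : 0 < ρ.n → σ.var .width ≤ ρ.n) :
    ∃ S' alt' m', Store ρ A S' alt' m' ((processHead real allow).den ρ σ) ∧ Extends S m S' m' ∧
      ((processHead real allow).den ρ σ).var .head = (h + 1) * stride ρ.n ∧
      ∀ v ∈ S h, ∀ r < ρ.R, Covers A S' m' (candidate ρ.n (σ.var .width) (S h) v r) := by
  have key := St.loop_inv (ρ := ρ) (l := .n) (v := .gone)
    (p := .cond (.heap (.add (.var .head) (.var .gone))) (processGone real allow) .skip) (σ := σ)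
    (fun k τ => τ.var .head = σ.var .head ∧ τ.var .width = σ.var .width ∧
      ∃ S' alt' m', Store ρ A S' alt' m' τ ∧ Extends S m S' m' ∧
      ∀ v ∈ S h, v < k → ∀ r < ρ.R, Covers A S' m' (candidate ρ.n (σ.var .width) (S h) v r))
    ⟨rfl, rfl, S, alt, m, hS, Extends.refl _ _, by simp⟩ ?_
  · obtain ⟨h1, -, S', alt', m', h2, h3, h4⟩ := key
    rw [processHead, St.den_seq]
    refine ⟨S', alt', m', h2.congr ?_ rfl, h3, ?_, fun v hv => h4 v hv ?_⟩
    · rw [St.var_of_keeps rfl]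
    · rw [St.den]
      simp only [setv_var, if_true, Ex.eval, h1, hh, Lim.val, min_self]
      rw [stride]
      ring
    · exact Finset.mem_range.1 ((hS.min h hm).1 hv)
  · rintro k hk τ ⟨h1, h2, S', alt', m', h3, h4, h5⟩
    have hk' : k < ρ.n := hk
    have hS'h : S' h = S h := h4.2 h hm
    have hb := h3.bit h (hm.trans_le h4.1) k hk'
    rw [hS'h] at hb
    by_cases hkS : k ∈ S h
    · rw [St.den_cond_pos (by simp [Ex.eval, h1, hh, min_var hk', hb, hkS])]
      refine ⟨by rw [St.var_of_keeps rfl]; simpa using h1, by rw [St.var_of_keeps rfl]; simpa using h2,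
        ?_⟩
      obtain ⟨S'', alt'', m'', h6, h7, h8⟩ := processGone_den (σ := τ.setv .gone k) (v := k) hE
        (h3.congr (by simp) rfl) (h := h) (by simpa [h1] using hh) (hm.trans_le h4.1)
        (by simpa [h2] using hw (by omega)) (by simp) hk'
      refine ⟨S'', alt'', m'', h6, h4.trans h7, fun v hv hvk r hr => ?_⟩
      rcases Nat.lt_succ_iff_lt_or_eq.1 hvk with hvk | rfl
      · exact (h5 v hv hvk r hr).extend h7
      · have := h8 r hr
        rw [hS'h] at this
        simpa [h2] using this
    · rw [St.den_cond_neg (by simp [Ex.eval, h1, hh, min_var hk', hb, hkS]), St.den_skip]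
      refine ⟨by simpa using h1, by simpa using h2, S', alt', m', h3.congr (by simp) rfl, h4,
        fun v hv hvk => h5 v hv ?_⟩
      have : v ≠ k := fun e => hkS (e ▸ hv)
      omega

theorem writeHead_den (hX : ∀ l < ρ.n, σ.heap (σ.var .head + l) = if l ∈ X then 1 else 0)
    (hXn : X ⊆ Finset.range ρ.n) (hb : σ.buf = ∅) : (writeHead.den ρ σ).buf = X := by
  have key := St.loop_inv (ρ := ρ) (l := .n) (v := .pos)
    (p := .cond (.heap (.add (.var .head) (.var .pos))) (.out (.var .pos)) .skip) (σ := σ)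
    (fun k τ => τ.var .head = σ.var .head ∧ τ.heap = σ.heap ∧ τ.buf = X ∩ Finset.range k)
    (by simp [hb]) ?_
  · rw [writeHead, key.2.2, Finset.inter_eq_left]
    exact hXn
  · rintro k hk τ ⟨h1, h2, h3⟩
    have hk' : k < ρ.n := hk
    by_cases hkX : k ∈ X
    · rw [St.den_cond_pos (by simp [Ex.eval, h1, h2, min_var hk', hX k hk', hkX])]
      refine ⟨by simpa [St.den] using h1, by simpa [St.den] using h2, ?_⟩
      rw [Finset.range_add_one, Finset.inter_insert_of_mem hkX, ← h3]
      simp [St.den, Ex.eval]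
    · rw [St.den_cond_neg (by simp [Ex.eval, h1, h2, min_var hk', hX k hk', hkX]), St.den_skip]
      refine ⟨by simpa using h1, by simpa using h2, ?_⟩
      rw [Finset.range_add_one, Finset.inter_insert_of_notMem hkX, ← h3]
      simp

end RAM

namespace RAM

/-! ### Polynomial time bounds -/

/-- The function is bounded by a power of `max n 2`. -/
def Poly (f : Env → ℕ) : Prop := ∃ k, ∀ ρ, f ρ ≤ max ρ.n 2 ^ k

/-- The function is bounded by `R + 1` times a power of `max n 2`. -/
def PolyR (f : Env → ℕ) : Prop := ∃ k, ∀ ρ, f ρ ≤ max ρ.n 2 ^ k * (ρ.R + 1)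

/-- As the base is at least 2, doubling costs one more factor. This is why bounds are stated with
`max n 2`. -/
theorem add_le_pow {x a b i j : ℕ} (hx : 2 ≤ x) (ha : a ≤ x ^ i) (hb : b ≤ x ^ j) :
    a + b ≤ x ^ (i + j + 1) := by
  have h1 : x ^ i ≤ x ^ (i + j) := Nat.pow_le_pow_right (by omega) (by omega)
  have h2 : x ^ j ≤ x ^ (i + j) := Nat.pow_le_pow_right (by omega) (by omega)
  rw [pow_succ]
  nlinarith

theorem Poly.const (c : ℕ) : Poly fun _ => c :=
  ⟨c, fun _ => (Nat.lt_two_pow_self).le.trans (Nat.pow_le_pow_left (le_max_right _ _) c)⟩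

theorem Poly.n : Poly fun ρ => ρ.n := ⟨1, fun _ => by simp⟩

theorem Poly.add {f g : Env → ℕ} (hf : Poly f) (hg : Poly g) : Poly fun ρ => f ρ + g ρ := by
  obtain ⟨i, hi⟩ := hf
  obtain ⟨j, hj⟩ := hg
  exact ⟨i + j + 1, fun ρ => add_le_pow (le_max_right _ _) (hi ρ) (hj ρ)⟩

theorem Poly.mul {f g : Env → ℕ} (hf : Poly f) (hg : Poly g) : Poly fun ρ => f ρ * g ρ := by
  obtain ⟨i, hi⟩ := hf
  obtain ⟨j, hj⟩ := hg
  exact ⟨i + j, fun ρ => (Nat.mul_le_mul (hi ρ) (hj ρ)).trans (pow_add _ _ _).ge⟩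

theorem Poly.mono {f g : Env → ℕ} (hg : Poly g) (h : ∀ ρ, f ρ ≤ g ρ) : Poly f := by
  obtain ⟨i, hi⟩ := hg
  exact ⟨i, fun ρ => (h ρ).trans (hi ρ)⟩

theorem Poly.max {f g : Env → ℕ} (hf : Poly f) (hg : Poly g) : Poly fun ρ => max (f ρ) (g ρ) :=
  (hf.add hg).mono fun _ => max_le (Nat.le_add_right _ _) (Nat.le_add_left _ _)

theorem Poly.pow {f : Env → ℕ} (hf : Poly f) (k : ℕ) : Poly fun ρ => f ρ ^ k := by
  obtain ⟨i, hi⟩ := hf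
  exact ⟨i * k, fun ρ => (Nat.pow_le_pow_left (hi ρ) k).trans (pow_mul _ _ _).ge⟩

theorem Poly.polyR {f : Env → ℕ} (hf : Poly f) : PolyR f := by
  obtain ⟨i, hi⟩ := hf
  exact ⟨i, fun ρ => (hi ρ).trans (Nat.le_mul_of_pos_right _ (by omega))⟩

theorem PolyR.add {f g : Env → ℕ} (hf : PolyR f) (hg : PolyR g) : PolyR fun ρ => f ρ + g ρ := by
  obtain ⟨i, hi⟩ := hf
  obtain ⟨j, hj⟩ := hg
  refine ⟨i + j + 1, fun ρ => (Nat.add_le_add (hi ρ) (hj ρ)).trans ?_⟩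
  rw [← Nat.add_mul]
  exact Nat.mul_le_mul_right _ (add_le_pow (le_max_right _ _) le_rfl le_rfl)

theorem PolyR.mul {f g : Env → ℕ} (hf : Poly f) (hg : PolyR g) : PolyR fun ρ => f ρ * g ρ := by
  obtain ⟨i, hi⟩ := hf
  obtain ⟨j, hj⟩ := hg
  refine ⟨i + j, fun ρ => (Nat.mul_le_mul (hi ρ) (hj ρ)).trans ?_⟩
  rw [pow_add, mul_assoc]

theorem PolyR.mono {f g : Env → ℕ} (hg : PolyR g) (h : ∀ ρ, f ρ ≤ g ρ) : PolyR f := by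
  obtain ⟨i, hi⟩ := hg
  exact ⟨i, fun ρ => (h ρ).trans (hi ρ)⟩

theorem PolyR.max {f g : Env → ℕ} (hf : PolyR f) (hg : PolyR g) :
    PolyR fun ρ => max (f ρ) (g ρ) :=
  (hf.add hg).mono fun _ => max_le (Nat.le_add_right _ _) (Nat.le_add_left _ _)

theorem poly_mulCost {f : Env → ℕ} (hf : Poly f) : Poly fun ρ => mulCost ρ.n (f ρ) :=
  ((Poly.n.add (.const 2)).mul (((Poly.const 3).mul hf).add (.const 5))).add (.const 2)

theorem poly_baseCost (b : ℕ) : Poly fun ρ => baseCost ρ.n b :=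
  ((Poly.const b).mul (((Poly.const 3).mul ((Poly.n.add (.const 3)).pow 2)).add (.const 2))).add
    (.const 1)

theorem poly_addrCost (b : ℕ) {f : Env → ℕ} (hf : Poly f) : Poly fun ρ => addrCost ρ.n b (f ρ) :=
  (Poly.const 1).add ((poly_baseCost b).add ((poly_mulCost hf).add (poly_mulCost (.const 1))))

theorem Ex.poly_cost (e : Ex) : Poly fun ρ => e.cost ρ.n := by
  induction e with
  | var | const | lim => exact .const 1
  | succ e ih => exact ih.add (.const 1)
  | add a b iha ihb => exact iha.add (ihb.add (poly_mulCost (.const 1)))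
  | arr k a b iha ihb =>
    exact iha.add (ihb.add ((poly_addrCost _ (Poly.n.add (.const 3))).add (.const 1)))
  | heap e ih => exact ih.add ((poly_baseCost 7).add (.const 1))
  | inp a b iha ihb => exact iha.add (ihb.add ((poly_addrCost _ Poly.n).add (.const 1)))
  | ite a b c d iha ihb ihc ihd => exact iha.add (ihb.add ((ihc.max ihd).add (.const 1)))

/-- The statement contains no long loops. -/
def St.flat : St → Bool
  | .seq p q => p.flat && q.flat
  | .ite _ _ p q => p.flat && q.flat
  | .loop .R _ _ => false
  | .loop .n _ p => p.flat
  | .loop .N _ p => p.flat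
  | _ => true

/-- The statement contains no nested long loops. -/
def St.shallow : St → Bool
  | .seq p q => p.shallow && q.shallow
  | .ite _ _ p q => p.shallow && q.shallow
  | .loop .R _ p => p.flat
  | .loop .n _ p => p.shallow
  | .loop .N _ p => p.shallow
  | _ => true

theorem St.poly_cost {p : St} (h : p.flat = true) : Poly fun ρ => p.cost ρ := by
  induction p with
  | skip => exact .const 1
  | set v e => exact e.poly_cost.add (.const 1)
  | aset k a b e =>
    exact a.poly_cost.add (b.poly_cost.add ((poly_addrCost _ (Poly.n.add (.const 3))).add
      (e.poly_cost.add (.const 1))))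
  | hset a e => exact a.poly_cost.add ((poly_baseCost 7).add (e.poly_cost.add (.const 1)))
  | out e => exact e.poly_cost.add (.const 1)
  | seq p q ihp ihq =>
    simp only [flat, Bool.and_eq_true] at h
    exact (ihp h.1).add (ihq h.2)
  | ite a b p q ihp ihq =>
    simp only [flat, Bool.and_eq_true] at h
    exact a.poly_cost.add (b.poly_cost.add (((ihp h.1).max (ihq h.2)).add (.const 1)))
  | loop l v p ih =>
    have body : ∀ h : p.flat = true, Poly fun ρ => 1 + (p.cost ρ + 1) + 1 := fun h =>
      ((Poly.const 1).add ((ih h).add (.const 1))).add (.const 1)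
    cases l with
    | n => exact (Poly.const 1).add ((Poly.n.mul (body h)).add (.const 1))
    | N => exact (Poly.const 1).add (((Poly.n.add (.const 2)).mul (body h)).add (.const 1))
    | R => cases h

/-- Long loops do not occur inside long loops, so `R` enters the cost only linearly. -/
theorem St.polyR_cost {p : St} (h : p.shallow = true) : PolyR fun ρ => p.cost ρ := by
  induction p with
  | skip | set | aset | hset | out => exact (St.poly_cost rfl).polyR
  | seq p q ihp ihq =>
    simp only [shallow, Bool.and_eq_true] at h
    exact (ihp h.1).add (ihq h.2)
  | ite a b p q ihp ihq =>
    simp only [shallow, Bool.and_eq_true] at h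
    exact a.poly_cost.polyR.add (b.poly_cost.polyR.add
      (((ihp h.1).max (ihq h.2)).add (Poly.const 1).polyR))
  | loop l v p ih =>
    have one := (Poly.const 1).polyR
    have body : ∀ h : p.shallow = true, PolyR fun ρ => 1 + (p.cost ρ + 1) + 1 := fun h =>
      (one.add ((ih h).add one)).add one
    cases l with
    | n => exact one.add ((PolyR.mul Poly.n (body h)).add one)
    | N => exact one.add ((PolyR.mul (Poly.n.add (.const 2)) (body h)).add one)
    | R =>
      have hb : Poly fun ρ => 1 + (p.cost ρ + 1) + 1 :=
        ((Poly.const 1).add ((St.poly_cost h).add (.const 1))).add (.const 1)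
      have hR : PolyR fun ρ => ρ.R := ⟨0, fun ρ => by simp⟩
      exact one.add (((PolyR.mul hb hR).mono fun ρ => (Nat.mul_comm _ _).le).add one)

/-! ### The number of new vertices -/

/-- Computes the number of vertices that are added to a solution. -/
def setWidth : St :=
  .loop .n .pos (.ite (.var .maxCap) (.inp (.const 0) (.var .pos))
    (.set .maxCap (.inp (.const 0) (.var .pos))) .skip) ;;
  .loop .n .demU (.set .deg (.const 0) ;;
    .loop .n .demW (.cond (.inp (.succ (.var .demU)) (.var .demW))
      (.set .deg (.succ (.var .deg))) .skip) ;;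
    .ite (.var .maxDeg) (.var .deg) (.set .maxDeg (.var .deg)) .skip) ;;
  .set .width (.ite (.var .maxCap) (.var .maxDeg) (.succ (.var .maxCap)) (.succ (.var .maxDeg)))

/-- The degree of the vertex `u` according to the input. -/
def inputDeg (ρ : Env) (u : ℕ) : ℕ :=
  ((Finset.range ρ.n).filter fun w => 0 < ρ.inp ((u + 1) * ρ.n + w)).card

/-- The number of vertices that are added to a solution. -/
def widthOf (ρ : Env) : ℕ :=
  min ((Finset.range ρ.n).sup ρ.inp) ((Finset.range ρ.n).sup (inputDeg ρ)) + 1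

variable {ρ : Env} {σ : HState}

theorem setWidth_den (h1 : σ.var .maxCap = 0) (h2 : σ.var .maxDeg = 0) :
    (setWidth.den ρ σ).var .width = widthOf ρ := by
  have k1 := St.loop_inv (ρ := ρ) (l := .n) (v := .pos)
    (p := .ite (.var .maxCap) (.inp (.const 0) (.var .pos))
    (.set .maxCap (.inp (.const 0) (.var .pos))) .skip) (σ := σ)
    (fun k τ => τ.var .maxCap = (Finset.range k).sup ρ.inp) (by simp [h1]) (by
      rintro k hk τ h
      have hk' : k < ρ.n := hk
      have e : (Ex.inp (.const 0) (.var .pos)).eval ρ (τ.setv .pos k) = ρ.inp k := by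
        simp [Ex.eval, min_var hk']
      have e' : (Ex.var .maxCap).eval ρ (τ.setv .pos k) = (Finset.range k).sup ρ.inp := by
        simp [Ex.eval, h]
      rw [Finset.range_add_one, Finset.sup_insert, St.den, e, e']
      split_ifs with hlt
      · rw [St.den, e]
        simp [hlt.le]
      · rw [sup_eq_right.2 (not_lt.1 hlt)]
        simpa using h)
  have f1 : ((St.loop .n .pos (.ite (.var .maxCap) (.inp (.const 0) (.var .pos))
    (.set .maxCap (.inp (.const 0) (.var .pos))) .skip)).den ρ σ).var .maxDeg = 0 :=
    (St.var_of_keeps rfl σ).trans h2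
  rw [setWidth, St.den_seq, St.den_seq]
  generalize (St.loop .n .pos (.ite (.var .maxCap) (.inp (.const 0) (.var .pos))
    (.set .maxCap (.inp (.const 0) (.var .pos))) .skip)).den ρ σ = τ at k1 f1 ⊢
  have k2 := St.loop_inv (ρ := ρ) (l := .n) (v := .demU)
    (p := .set .deg (.const 0) ;;
    .loop .n .demW (.cond (.inp (.succ (.var .demU)) (.var .demW))
      (.set .deg (.succ (.var .deg))) .skip) ;;
    .ite (.var .maxDeg) (.var .deg) (.set .maxDeg (.var .deg)) .skip) (σ := τ)
    (fun k υ => υ.var .maxCap = τ.var .maxCap ∧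
      υ.var .maxDeg = (Finset.range k).sup (inputDeg ρ)) (by simp [f1]) (by
      rintro k hk υ ⟨h3, h4⟩
      have hk' : k < ρ.n := hk
      rw [St.den_seq, St.den_seq]
      have k3 := St.loop_inv (ρ := ρ) (l := .n) (v := .demW)
        (p := .cond (.inp (.succ (.var .demU)) (.var .demW))
          (.set .deg (.succ (.var .deg))) .skip) (σ := (υ.setv .demU k).setv .deg 0)
        (fun j ω => ω.var .demU = k ∧ ω.var .maxCap = τ.var .maxCap ∧
          ω.var .maxDeg = (Finset.range k).sup (inputDeg ρ) ∧ ω.var .deg =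
            ((Finset.range j).filter fun w => 0 < ρ.inp ((k + 1) * ρ.n + w)).card)
        (by simp [h3, h4]) (by
          rintro j hj ω ⟨h5, h6, h7, h8⟩
          have hj' : j < ρ.n := hj
          have e : (Ex.inp (.succ (.var .demU)) (.var .demW)).eval ρ (ω.setv .demW j) =
              ρ.inp ((k + 1) * ρ.n + j) := by
            simp [Ex.eval, min_var hj', h5]
            rw [min_eq_left (by omega)]
          by_cases hp : 0 < ρ.inp ((k + 1) * ρ.n + j)
          · rw [St.den_cond_pos (by rw [e]; exact hp), Finset.range_add_one, Finset.filter_insert,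
              if_pos hp, Finset.card_insert_of_notMem (by simp), ← h8]
            simp [St.den, Ex.eval, h5, h6, h7]
          · rw [St.den_cond_neg (by rw [e]; omega), Finset.range_add_one, Finset.filter_insert,
              if_neg hp, ← h8]
            simp [h5, h6, h7])
      have e0 : (St.set .deg (.const 0)).den ρ (υ.setv .demU k) = (υ.setv .demU k).setv .deg 0 := rfl
      rw [e0]
      generalize (St.loop .n .demW (.cond (.inp (.succ (.var .demU)) (.var .demW))
          (.set .deg (.succ (.var .deg))) .skip)).den ρ ((υ.setv .demU k).setv .deg 0) = ω at k3 ⊢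
      obtain ⟨-, h6, h7, h8⟩ := k3
      have h8' : ω.var .deg = inputDeg ρ k := h8
      rw [Finset.range_add_one, Finset.sup_insert, St.den]
      simp only [Ex.eval, h7, h8']
      by_cases hlt : (Finset.range k).sup (inputDeg ρ) < inputDeg ρ k
      · rw [if_pos (by simpa [Ex.eval, h7, h8'] using hlt)]
        simp [St.den, Ex.eval, h6, h8', hlt.le]
      · rw [if_neg (by simpa [Ex.eval, h7, h8'] using hlt), sup_eq_right.2 (not_lt.1 hlt)]
        exact ⟨h6, h7⟩)
  generalize (St.loop .n .demU (.set .deg (.const 0) ;;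
    .loop .n .demW (.cond (.inp (.succ (.var .demU)) (.var .demW))
      (.set .deg (.succ (.var .deg))) .skip) ;;
    .ite (.var .maxDeg) (.var .deg) (.set .maxDeg (.var .deg)) .skip)).den ρ τ = υ at k2 ⊢
  obtain ⟨h3, h4⟩ := k2
  rw [k1] at h3
  simp only [St.den, Ex.eval, setv_var, if_true, h3, h4, widthOf, Lim.val]
  split_ifs <;> omega

end RAM

namespace RAM

/-! ### The enumeration algorithm -/

/-- Computes the auxiliary constants in the registers `1`, `3`, `4`, `5`. -/
def setConstants : Prog :=
  .seq (.instr (.copy 1 0)) (.seq (.instr (.incr 1)) (.seq (.instr (.incr 1))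
    (.seq (.instr (.copy 4 1)) (.seq (.instr (.incr 4)) (.seq (.instr (.const 5 1))
      (.seq (addMul 3 4 4 0) (addReg 3 4 0)))))))

/-- Computes the number of rounds of the long loops. -/
def setRounds : Prog :=
  .seq (.instr (.const 2 1)) (.seq (.instr (.const (sc 0) 0))
    (.whileLt (sc 0) (vr .width) (.seq (.instr (.const (sc 1) 0)) (.seq (addMul (sc 1) 0 2 2)
      (.seq (.instr (.copy 2 (sc 1))) (.instr (.incr (sc 0))))))))

/-- Computes a first minimal solution. -/
def findFirst (real allow : Ex) : St :=
  .loop .n .pos (.aset1 .cand (.var .pos) (.const 1)) ;; processCand real allow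

/-- Writes and processes all solutions in the store. -/
def mainLoop (real allow : Ex) : Prog :=
  .whileLt (vr .head) (vr .free) (.seq (writeHead.comp 0) (.seq (.instr .emit)
    ((processHead real allow).comp 0)))

/-- The enumeration algorithm. -/
def enumerate (real allow : Ex) : Prog :=
  .seq setConstants (.seq (setWidth.comp 0) (.seq setRounds
    (.seq ((findFirst real allow).comp 0) (mainLoop real allow))))

/-- The time bound for `setRounds`, where `b` bounds the numbers of rounds. -/
def roundsCost (n w b : ℕ) : ℕ := 1 + (1 + (w * (1 + (mulCost n b + (1 + 1)) + 1) + 1))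

/-- The initial state. -/
def HState.zero : HState := ⟨fun _ => 0, fun _ _ _ => 0, fun _ => 0, ∅⟩

/-- The number of long rounds depends on the width, which is computed later. Hence it is still 0 in
the environment here. -/
theorem setConstants_run {n : ℕ} (G : SimpleGraph (Fin n)) [DecidableRel G.Adj] (c : Fin n → ℕ) :
    Run setConstants (initial G c) (1 + (1 + (1 + (1 + (1 + (1 + (mulCost n (n + 3) +
      (3 * (n + 3) + 2)))))))) fun t => Rep ⟨n, 0, inputMem G c⟩ t HState.zero ∧ t.log = [] := by
  refine Run.seq (Run.instr (Run.seq (Run.instr (Run.seq (Run.instr (Run.seq (Run.instr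
    (Run.seq (Run.instr (Run.seq (Run.instr ?_)))))))))))
  generalize hs : (Instr.const 5 1).run _ = s
  have hr : ∀ x, s.reg x = if x = 0 then n else if x = 1 then n + 2 else if x = 4 then n + 3 else
      if x = 5 then 1 else 0 := by
    intro x
    rw [← hs]
    simp only [Instr.run, State.tick, initial, Function.update_apply]
    split_ifs <;> omega
  have hm : s.mem = inputMem G c := by rw [← hs]; rfl
  have hl : s.log = [] := by rw [← hs]; rfl
  have hb : s.buf = ∅ := by rw [← hs]; rfl
  refine Run.seq ((addMul_run s (a := 3) (x := 4) (y := 4) (r := 0)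
    ?_ ?_ ?_ ?_ ?_ ?_ ?_ ?_ ?_).mono ?_ ?_)
  any_goals (simp only [sc, ne_eq]; omega)
  · simp [hr, mulCost]
  rintro t ⟨h1, h2⟩
  have t4 : t.reg 4 = n + 3 := by rw [h2.2.2.2 4 (by simp [sc]), hr]; simp
  refine (addReg_run t (a := 3) (y := 4) (r := 0) ?_ ?_ ?_).mono ?_ ?_
  any_goals (simp only [sc, ne_eq]; omega)
  · rw [t4]
  rintro u ⟨h3, h4⟩
  have h5 := h2.trans h4 (C := fun x => x = 3 ∨ IsScratch 0 x)
    (by rintro x (h | h | h)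
        · exact Or.inl h
        · exact Or.inr ⟨_, le_rfl, h⟩
        · exact Or.inr ⟨_, by omega, h⟩)
    (by rintro x (h | h)
        · exact Or.inl h
        · exact Or.inr ⟨_, le_rfl, h⟩)
  have low : ∀ x ≤ 5, x ≠ 3 → u.reg x = s.reg x := fun x hx h3 => h5.2.2.2 x (by
    rintro (h | h)
    · exact h3 h
    · exact not_isScratch_of_le hx h)
  -- The input occupies only `n * (n + 1)` cells, so arrays and heap start out as zero.
  have zero : ∀ a, (n + 3) ^ 2 ≤ a → inputMem G c a = 0 := by
    intro a ha
    unfold inputMem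
    rcases Nat.eq_zero_or_pos n with rfl | hn
    · simp
    · have : n + 1 ≤ a / n := by
        rw [Nat.le_div_iff_mul_le hn]
        nlinarith
      rw [dif_pos (Nat.mod_lt _ hn), if_neg (by omega), dif_neg (by omega)]
  refine ⟨⟨?_, ?_, ?_, ?_, ?_, ?_, ?_, ?_, ?_, ?_, ?_⟩, h5.2.2.1.trans hl⟩
  · rw [low 0 (by omega) (by omega), hr]; simp
  · rw [low 1 (by omega) (by omega), hr]; simp
  · rw [low 2 (by omega) (by omega), hr]; simp
  -- The product is cut off at the factor `n + 2`; the final addition supplies the missing `n + 3`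
  -- to make `(n + 3) ^ 2`.
  · rw [h3, h1, t4, hr, hr, hr]
    simp
    ring
  · rw [low 4 (by omega) (by omega), hr]; simp
  · rw [low 5 (by omega) (by omega), hr]; simp
  · intro v
    have hv : 7 ≤ vr v := by simp only [vr]; omega
    rw [h5.2.2.2 (vr v) (by
      rintro (h | h)
      · omega
      · exact not_isScratch_vr h), hr, if_neg (by omega), if_neg (by omega), if_neg (by omega),
      if_neg (by omega)]
    rfl
  · intro a _
    rw [h5.1, hm]
  · intro k i j _ _
    rw [h5.1, hm, zero _ (by nlinarith [Nat.zero_le (k.idx * (n + 3) ^ 2)])]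
    rfl
  · intro x
    rw [h5.1, hm, zero _ (by dsimp only; omega)]
    rfl
  · rw [h5.2.1, hb]; rfl

/-- Repeated multiplication by `n`. The bound `b` covers all intermediate powers, which for `n = 0`
is not implied by a bound on the last one. -/
theorem setRounds_run {n w b : ℕ} {inp : ℕ → ℕ} {s : State} {σ : HState}
    (h : Rep ⟨n, 0, inp⟩ s σ) (hw : σ.var .width = w) (hb : ∀ k ≤ w, n ^ k ≤ b) :
    Run setRounds s (roundsCost n w b) fun t => Rep ⟨n, n ^ w, inp⟩ t σ ∧ t.log = s.log := by
  let C : ℕ → Prop := fun x => x = 2 ∨ IsScratch 0 x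
  have hC : ∀ x ≤ 5, x ≠ 2 → ¬ C x := by
    rintro x hx h2 (h | h)
    · exact h2 h
    · exact not_isScratch_of_le hx h
  have hCv : ∀ v, ¬ C (vr v) := by
    rintro v (h | h)
    · simp only [vr] at h; omega
    · exact not_isScratch_vr h
  refine Run.seq (Run.instr (Run.seq (Run.instr (Run.whileLt (fun k t => t.reg (sc 0) = k ∧
    t.reg 2 = n ^ k ∧ Same C s t) w ?_ ?_ ?_ ?_))))
  · refine ⟨by simp [Instr.run], by simp [Instr.run, sc], rfl, rfl, rfl, fun x hx => ?_⟩
    have h1 : x ≠ 2 := fun h => hx (Or.inl h)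
    have h2 : x ≠ sc 0 := fun h => hx (Or.inr ⟨0, le_rfl, h⟩)
    simp [Instr.run, h1, h2]
  · rintro k t ⟨h1, h2, h3⟩ hk
    rw [h1, h3.2.2.2 _ (hCv _), h.var, hw]
  · rintro k hk t ⟨h1, h2, h3⟩
    refine Run.seq (b := 1) (b' := mulCost n b + (1 + 1)) (Run.instr ?_)
    generalize hu : (Instr.const (sc 1) 0).run t.tick = u
    have u0 : u.reg 0 = n := by
      rw [← hu]
      simp only [Instr.run, tick_reg]
      rw [Function.update_of_ne (by simp [sc]), h3.2.2.2 0 (hC 0 (by omega) (by omega)), h.reg_n]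
    have u1 : u.reg 1 = n + 2 := by
      rw [← hu]
      simp only [Instr.run, tick_reg]
      rw [Function.update_of_ne (by simp [sc]), h3.2.2.2 1 (hC 1 (by omega) (by omega)), h.reg_N]
    have u2 : u.reg 2 = n ^ k := by
      rw [← hu]
      simp [Instr.run, sc, h2]
    have us : u.reg (sc 0) = k := by
      rw [← hu]
      simp only [Instr.run, tick_reg]
      rw [Function.update_of_ne (by simp [sc]), h1]
    have us1 : u.reg (sc 1) = 0 := by
      rw [← hu]
      simp [Instr.run]
    have hsu : Same C s u := by
      rw [← hu]
      refine ⟨h3.1, h3.2.1, h3.2.2.1, fun x hx => ?_⟩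
      have hx2 : x ≠ sc 1 := fun h => hx (Or.inr ⟨1, by omega, h⟩)
      rw [← h3.2.2.2 x hx]
      simp [Instr.run, hx2]
    refine Run.seq ((addMul_run u (a := sc 1) (x := 0) (y := 2) (r := 2)
      ?_ ?_ ?_ ?_ ?_ ?_ ?_ ?_ ?_).mono ?_ ?_)
    any_goals (simp only [sc, ne_eq]; omega)
    · rw [u1, u2, mulCost]
      have := hb k hk.le
      gcongr
    rintro v ⟨h4, h5⟩
    have hsv : Same C s v := hsu.trans h5 (fun _ h => h) (by
      rintro x (h | h | h)
      · exact Or.inr ⟨_, Nat.zero_le _, h⟩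
      · exact Or.inr ⟨_, Nat.zero_le _, h⟩
      · exact Or.inr ⟨_, Nat.zero_le _, h⟩)
    have vs : v.reg (sc 0) = k := by rw [h5.2.2.2 _ (by simp [sc]), us]
    refine Run.seq (Run.instr (Run.instr ⟨?_, ?_, hsv.1, hsv.2.1, hsv.2.2.1, fun x hx => ?_⟩))
    · simp only [Instr.run, Function.update_self, tick_reg]
      rw [Function.update_of_ne (by simp [sc]), vs]
    · simp only [Instr.run, tick_reg]
      rw [Function.update_of_ne (by simp [sc]), Function.update_self, h4, us1, u0, u1, u2,
        min_eq_left (by omega), pow_succ]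
      ring
    · have hx1 : x ≠ 2 := fun h => hx (Or.inl h)
      have hx2 : x ≠ sc 0 := fun h => hx (Or.inr ⟨0, le_rfl, h⟩)
      rw [← hsv.2.2.2 x hx]
      simp [Instr.run, hx1, hx2]
  · rintro t ⟨-, h2, h3⟩
    have low : ∀ x ≤ 5, x ≠ 2 → t.reg x = s.reg x := fun x hx h => h3.2.2.2 x (hC x hx h)
    exact ⟨⟨(low 0 (by omega) (by omega)).trans h.reg_n, (low 1 (by omega) (by omega)).trans h.reg_N,
      h2, (low 3 (by omega) (by omega)).trans h.reg_Q, (low 4 (by omega) (by omega)).trans h.reg_S,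
      (low 5 (by omega) (by omega)).trans h.reg_one, fun v => (h3.2.2.2 _ (hCv v)).trans (h.var v),
      h3.1 ▸ h.inp, h3.1 ▸ h.arr, h3.1 ▸ h.heap, h3.2.1.trans h.buf⟩, h3.2.2.1⟩

variable {ρ : Env} {real allow : Ex} {A : Assignment ρ.n} {σ : HState} {S : ℕ → Finset ℕ}
  {alt : ℕ → ℕ → ℕ} {m : ℕ}

/-- By monotonicity there is a solution if and only if the set of all vertices is one. If there is
none, the store may stay empty and the main loop does nothing. -/
theorem findFirst_den (hE : Expresses ρ real allow A) (hf : σ.var .free = 0)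
    (hh : ∀ x, σ.heap x = 0) :
    ∃ S alt m, Store ρ A S alt m ((findFirst real allow).den ρ σ) ∧
      Covers A S m (Finset.range ρ.n) := by
  have k1 := St.loop_inv (ρ := ρ) (l := .n) (v := .pos)
    (p := .aset1 .cand (.var .pos) (.const 1)) (σ := σ)
    (fun k τ => ∀ l < k, τ.arr .cand l 0 = 1) (by simp) (by
      rintro k hk τ h1 l hl
      have hk' : k < ρ.n := hk
      by_cases hlk : l = k
      · simp [St.den, St.aset1, Ex.eval, min_var hk', hlk]
      · have := h1 l (by omega)
        simp [St.den, St.aset1, Ex.eval, min_var hk', hlk, this])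
  have h0 : Store ρ A (fun _ => ∅) (fun _ _ => 0) 0
      ((St.loop .n .pos (.aset1 .cand (.var .pos) (.const 1))).den ρ σ) := by
    constructor
    · rw [St.var_of_keeps rfl, hf, zero_mul]
    · simp
    · simp
    · intro x _
      rw [St.heap_of_keeps rfl, hh]
    all_goals simp
  obtain ⟨S, alt, m, h1, -, h2⟩ := processCand_den hE h0 (X := Finset.range ρ.n)
    (by intro l hl; rw [k1 l hl, if_pos (Finset.mem_range.2 hl)]) subset_rfl
  exact ⟨S, alt, m, h1, h2⟩

/-- This bound serves only for the termination of the main loop; it does not enter the delay. -/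
theorem Store.le_two_pow (h : Store ρ A S alt m σ) : m ≤ 2 ^ ρ.n := by
  have := Finset.card_le_card_of_injOn S (s := Finset.range m)
    (t := (Finset.range ρ.n).powerset)
    (fun j hj => Finset.mem_powerset.2 (h.min j (Finset.mem_range.1 hj)).1)
    (fun i hi j hj e => h.inj i (Finset.mem_range.1 hi) j (Finset.mem_range.1 hj) e)
  simpa using this

/-! ### The main loop and the delay -/

/-- The state of the main loop, with `h` solutions written so far. -/
structure MainInv (ρ : Env) (A : Assignment ρ.n) (d e : ℕ) (S : ℕ → Finset ℕ) (alt : ℕ → ℕ → ℕ)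
    (m h : ℕ) (σ : HState) (s : State) : Prop where
  rep : Rep ρ s σ
  store : Store ρ A S alt m σ
  head : σ.var .head = h * stride ρ.n
  le : h ≤ m
  buf : σ.buf = ∅
  width : σ.var .width = widthOf ρ
  covers : ∀ i < h, ∀ v ∈ S i, ∀ r < ρ.R, Covers A S m (candidate ρ.n (widthOf ρ) (S i) v r)
  univ : Covers A S m (Finset.range ρ.n)
  log : s.log.map Prod.fst = (List.range h).map S
  chain : ∀ x ≤ s.clock + e, List.IsChain (fun a b : ℕ => b ≤ a + d)
    (0 :: (s.log.map Prod.snd ++ [x]))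

/-- The budget `e` pays for a loop test, writing a solution and `emit`. The delay condition is kept
for every possible next event within `e` of the clock, so it applies both to the next output and to
the end of the run. After an output, at most the cost of processing plus `e` passes until the next
event, which is within `d`. -/
theorem MainInv.step (hE : Expresses ρ real allow A) {d e h : ℕ} {s : State}
    (hI : MainInv ρ A d e S alt m h σ s) (hm : h < m) (hw : 0 < ρ.n → widthOf ρ ≤ ρ.n)
    (he : writeHead.cost ρ + 2 ≤ e) (hd : (processHead real allow).cost ρ + e ≤ d) :
    Run (.seq (writeHead.comp 0) (.seq (.instr .emit) ((processHead real allow).comp 0))) s.tick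
      (writeHead.cost ρ + (1 + (processHead real allow).cost ρ)) fun t =>
        ∃ S' alt' m' σ', MainInv ρ A d e S' alt' m' (h + 1) σ' t := by
  have hrep : Rep ρ s.tick σ := hI.rep.congr_scratch (r := 0) ⟨rfl, rfl, rfl, fun _ _ => rfl⟩
  obtain ⟨t, h1, h2, h3, h4, -⟩ := writeHead.comp_run 0 s.tick σ hrep
  simp only [tick_clock, tick_log] at h2 h4
  refine Run.seq ⟨t, h1, h2, ?_⟩
  refine Run.seq (Run.instr ?_)
  have hbuf : t.buf = S h := by
    rw [h3.buf]
    exact writeHead_den (fun l hl => by rw [hI.head]; exact hI.store.bit h hm l hl)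
      (hI.store.min h hm).1 hI.buf
  let σ₁ : HState := { writeHead.den ρ σ with buf := ∅ }
  have hrep₁ : Rep ρ (Instr.emit.run t) σ₁ :=
    ⟨h3.reg_n, h3.reg_N, h3.reg_R, h3.reg_Q, h3.reg_S, h3.reg_one, h3.var, h3.inp, h3.arr, h3.heap,
      rfl⟩
  have e1 : σ₁.var .free = σ.var .free := St.var_of_keeps (p := writeHead) rfl σ
  have e2 : σ₁.var .head = σ.var .head := St.var_of_keeps (p := writeHead) rfl σ
  have e3 : σ₁.var .width = σ.var .width := St.var_of_keeps (p := writeHead) rfl σ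
  have e4 : σ₁.heap = σ.heap := St.heap_of_keeps (p := writeHead) rfl σ
  obtain ⟨S', alt', m', h5, h6, h7, h8⟩ := processHead_den (σ := σ₁) hE (hI.store.congr e1 e4)
    (e2.trans hI.head) hm (by rw [e3, hI.width]; exact hw)
  obtain ⟨u, h9, h10, h11, h12, -⟩ := (processHead real allow).comp_run 0 _ σ₁ hrep₁
  refine ⟨u, h9, h10, S', alt', m', _, h11, h5, h7, by have := h6.1; omega, ?_, ?_, ?_, ?_, ?_, ?_⟩
  · rw [St.buf_of_keeps rfl]
  · rw [St.var_of_keeps rfl, e3, hI.width]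
  · intro i hi v hv r hr
    rcases Nat.lt_succ_iff_lt_or_eq.1 hi with hi | rfl
    · have hi' := h6.2 i (hi.trans hm)
      rw [hi'] at hv ⊢
      exact (hI.covers i hi v hv r hr).extend h6
    · rw [h6.2 i hm] at hv ⊢
      have := h8 v hv r hr
      rwa [e3, hI.width] at this
  · exact hI.univ.extend h6
  · rw [h12]
    simp only [Instr.run, State.tick]
    rw [List.map_append, h4, hI.log, List.range_succ, List.map_append]
    simp only [List.map_cons, List.map_nil, hbuf]
    rw [h6.2 h hm]
    congr 1
    exact List.map_congr_left fun i hi => (h6.2 i ((List.mem_range.1 hi).trans hm)).symm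
  · intro x hx
    rw [h12]
    simp only [Instr.run, State.tick] at h10 ⊢
    rw [List.map_append, h4]
    simp only [List.map_cons, List.map_nil, List.append_assoc, List.cons_append, List.nil_append]
    rw [← List.cons_append, List.isChain_append_cons_cons]
    refine ⟨?_, by omega, by simp⟩
    have := hI.chain (t.clock + 1) (by omega)
    simpa using this

/-- The store may grow in every round, so `m - h` need not decrease. The induction is on `2 ^ n - h`
instead. -/
theorem mainLoop_run (hE : Expresses ρ real allow A) {d e h : ℕ} {s : State}
    (hI : MainInv ρ A d e S alt m h σ s) (hw : 0 < ρ.n → widthOf ρ ≤ ρ.n)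
    (he : writeHead.cost ρ + 2 ≤ e) (hd : (processHead real allow).cost ρ + e ≤ d) :
    ∃ t, Exec (mainLoop real allow) s t ∧ ∃ S alt m σ s', MainInv ρ A d e S alt m m σ s' ∧
      t = s'.tick := by
  have key : ∀ N h S alt m σ s, N + h = 2 ^ ρ.n → MainInv ρ A d e S alt m h σ s →
      ∃ t, Exec (mainLoop real allow) s t ∧ ∃ S alt m σ s', MainInv ρ A d e S alt m m σ s' ∧
      t = s'.tick := by
    intro N
    induction N with
    | zero =>
      intro h S alt m σ s hN hI
      have h1 := hI.store.le_two_pow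
      have h2 := hI.le
      have hm : h = m := by omega
      refine ⟨_, .whileFalse ?_, S, alt, m, σ, s, hm ▸ hI, rfl⟩
      rw [hI.rep.var, hI.rep.var, hI.head, hI.store.free, hm]
      exact lt_irrefl _
    | succ N ih =>
      intro h S alt m σ s hN hI
      rcases Nat.lt_or_ge h m with hm | hm
      · obtain ⟨t, h1, -, S', alt', m', σ', h2⟩ := hI.step hE hm hw he hd
        obtain ⟨u, h3, h4⟩ := ih (h + 1) S' alt' m' σ' t (by omega) h2
        refine ⟨u, .whileTrue ?_ h1 h3, h4⟩
        rw [hI.rep.var, hI.rep.var, hI.head, hI.store.free]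
        exact Nat.mul_lt_mul_of_pos_right hm (by simp [stride])
      · have h2 := hI.le
        have hm : h = m := by omega
        refine ⟨_, .whileFalse ?_, S, alt, m, σ, s, hm ▸ hI, rfl⟩
        rw [hI.rep.var, hI.rep.var, hI.head, hI.store.free, hm]
        exact lt_irrefl _
  exact key (2 ^ ρ.n - h) h S alt m σ s
    (Nat.sub_add_cancel (hI.le.trans hI.store.le_two_pow)) hI

/-- When the loop ends, every stored solution has been processed, so the stored family is closed
under exchange. It is nonempty as soon as some solution exists, and hence contains all minimal
solutions. -/
theorem MainInv.mem_iff {d e : ℕ} {s : State} (hI : MainInv ρ A d e S alt m m σ s)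
    (hA : A.Bounded (widthOf ρ)) (hR : ρ.R = ρ.n ^ widthOf ρ) (B : Finset ℕ) :
    B ∈ s.log.map Prod.fst ↔ A.MinSol B := by
  rw [hI.log, List.mem_map]
  simp only [List.mem_range]
  constructor
  · rintro ⟨j, hj, rfl⟩
    exact hI.store.min j hj
  · intro hB
    have := hB.mem_of_closed hA {X | ∃ j < m, S j = X} (by
      rintro X ⟨j, hj, rfl⟩; exact hI.store.min j hj) (by
      obtain ⟨j, hj, -⟩ := hI.univ (hB.2.1.mono hB.1)
      exact ⟨S j, j, hj, rfl⟩) (by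
      rintro X ⟨i, hi, rfl⟩ v hv T hTn hT hTc hs
      obtain ⟨r, hr, e⟩ := exists_digits_image hTn hT hTc
      have hc : candidate ρ.n (widthOf ρ) (S i) v r = (S i ∪ T).erase v := by
        rw [candidate, e]
      obtain ⟨j, hj, hjc⟩ := hI.covers i hi v hv r (by rw [hR]; exact hr) (by rw [hc]; exact hs)
      exact ⟨S j, ⟨j, hj, rfl⟩, hc ▸ hjc⟩)
    exact this

end RAM

namespace RAM

/-- The algorithm enumerates the minimal solutions of an assignment problem. -/
theorem enumerate_spec (real allow : Ex) : ∃ k, ∀ (n : ℕ) (G : SimpleGraph (Fin n))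
    [DecidableRel G.Adj] (c : Fin n → ℕ) (A : Assignment n) (w : ℕ) (𝓢 : Set (Finset (Fin n))),
    (∀ R, Expresses ⟨n, R, inputMem G c⟩ real allow A) →
    widthOf ⟨n, 0, inputMem G c⟩ = w + 1 → A.Bounded (w + 1) → w ≤ n → (0 < n → w < n) →
    (∀ B, A.MinSol B ↔ ∃ X ∈ 𝓢, X.map Fin.valEmbedding = B) →
    EnumeratesWithDelay (enumerate real allow) G c 𝓢 (max n 2 ^ (w + k)) := by
  have one := (Poly.const 1).polyR
  have hR : PolyR fun ρ => ρ.R := ⟨0, fun ρ => by simp⟩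
  have p1 : PolyR fun ρ => 1 + (1 + (1 + (1 + (1 + (1 + (mulCost ρ.n (ρ.n + 3) +
      (3 * (ρ.n + 3) + 2))))))) := by
    have n3 := Poly.n.add (Poly.const 3)
    exact one.add (one.add (one.add (one.add (one.add (one.add
      ((poly_mulCost n3).add (((Poly.const 3).mul n3).add (.const 2))).polyR)))))
  -- The width is computed while `R` is still 0.
  have p2 : PolyR fun ρ => setWidth.cost ⟨ρ.n, 0, ρ.inp⟩ := by
    obtain ⟨k, hk⟩ := St.poly_cost (p := setWidth) rfl
    exact Poly.polyR ⟨k, fun ρ => hk ⟨ρ.n, 0, ρ.inp⟩⟩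
  have p3 : PolyR fun ρ => roundsCost ρ.n (ρ.n + 1) (ρ.R + 1) := by
    have m1 : PolyR fun ρ => mulCost ρ.n (ρ.R + 1) :=
      (PolyR.mul (Poly.n.add (.const 2)) ((PolyR.mul (Poly.const 3) (hR.add one)).add
        (Poly.const 5).polyR)).add (Poly.const 2).polyR
    exact one.add (one.add ((PolyR.mul (Poly.n.add (.const 1))
      ((one.add (m1.add (one.add one))).add one)).add one))
  have p4 : PolyR fun ρ => (findFirst real allow).cost ρ := (St.poly_cost rfl).polyR
  have p5 : PolyR fun ρ => writeHead.cost ρ + 2 := ((St.poly_cost rfl).add (.const 2)).polyR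
  have p6 : PolyR fun ρ => (processHead real allow).cost ρ := St.polyR_cost rfl
  -- A single bound for the whole start-up plus one round of the main loop; it also covers the time
  -- before the first output.
  obtain ⟨k, hk⟩ := p1.add (p2.add (p3.add (p4.add (p5.add p6))))
  -- One extra factor comes from the exponent `w + 1` of `R`, the other from `R + 1 ≤ 2 * max n 2 ^
  -- (w + 1)`.
  refine ⟨k + 2, ?_⟩
  intro n G _ c A w 𝓢 hE hwidth hA hwn' hwn h𝓢
  have hd := hk ⟨n, n ^ (w + 1), inputMem G c⟩
  have hd' : max n 2 ^ k * (n ^ (w + 1) + 1) ≤ max n 2 ^ (w + (k + 2)) := by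
    have h1 : n ^ (w + 1) ≤ max n 2 ^ (w + 1) := Nat.pow_le_pow_left (le_max_left _ _) _
    have h2 : 1 ≤ max n 2 ^ (w + 1) := Nat.one_le_pow _ _ (by omega)
    calc max n 2 ^ k * (n ^ (w + 1) + 1) ≤ max n 2 ^ k * (max n 2 ^ (w + 1) * 2) :=
          Nat.mul_le_mul_left _ (by omega)
      _ ≤ max n 2 ^ k * (max n 2 ^ (w + 1) * max n 2) :=
          Nat.mul_le_mul_left _ (Nat.mul_le_mul_left _ (le_max_right _ _))
      _ = max n 2 ^ (w + (k + 2)) := by ring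
  have hd := hd.trans hd'
  generalize max n 2 ^ (w + (k + 2)) = d at hd
  dsimp only at hd
  obtain ⟨s₁, x₁, c₁, r₁, l₁⟩ := setConstants_run G c
  obtain ⟨s₂, x₂, c₂, r₂, l₂, -⟩ := setWidth.comp_run 0 s₁ _ r₁
  have hw₂ : (setWidth.den ⟨n, 0, inputMem G c⟩ HState.zero).var .width = w + 1 :=
    (setWidth_den rfl rfl).trans hwidth
  -- The summand 1 in the bound is needed for `n = 0`, where the power with exponent 0 exceeds the
  -- others.
  obtain ⟨s₃, x₃, c₃, r₃, l₃⟩ := setRounds_run r₂ hw₂ (b := n ^ (w + 1) + 1) (by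
    intro i hi
    rcases Nat.eq_zero_or_pos n with rfl | hn
    · have : (0 : ℕ) ^ i ≤ 1 := by cases i <;> simp
      omega
    · exact (Nat.pow_le_pow_right hn hi).trans (by omega))
  have hrc : roundsCost n (w + 1) (n ^ (w + 1) + 1) ≤ roundsCost n (n + 1) (n ^ (w + 1) + 1) := by
    unfold roundsCost
    gcongr
  obtain ⟨s₄, x₄, c₄, r₄, l₄, -⟩ := (findFirst real allow).comp_run 0 s₃ _ r₃
  obtain ⟨S, alt, m, hS, hcov⟩ := findFirst_den (σ := setWidth.den ⟨n, 0, inputMem G c⟩ HState.zero)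
    (hE (n ^ (w + 1))) (St.var_of_keeps (p := setWidth) rfl _)
    (fun x => by rw [St.heap_of_keeps rfl]; rfl)
  have hinit : MainInv ⟨n, n ^ (w + 1), inputMem G c⟩ A d
      (writeHead.cost ⟨n, n ^ (w + 1), inputMem G c⟩ + 2) S alt m 0
      ((findFirst real allow).den ⟨n, n ^ (w + 1), inputMem G c⟩
        (setWidth.den ⟨n, 0, inputMem G c⟩ HState.zero)) s₄ := by
    refine ⟨r₄, hS, ?_, Nat.zero_le _, ?_, ?_, by simp, hcov, ?_, ?_⟩
    · rw [St.var_of_keeps rfl, St.var_of_keeps rfl, zero_mul]; rfl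
    · rw [St.buf_of_keeps rfl, St.buf_of_keeps rfl]; rfl
    · rw [St.var_of_keeps rfl, hw₂]; exact hwidth.symm
    · rw [l₄, l₃, l₂, l₁]; rfl
    · intro x hx
      rw [l₄, l₃, l₂, l₁]
      have h0 : (initial G c).clock = 0 := rfl
      simp only [List.map_nil, List.nil_append]
      rw [List.isChain_cons_cons]
      refine ⟨by omega, by simp⟩
  obtain ⟨t, x₅, S', alt', m', σ', s', hI, rfl⟩ := mainLoop_run (hE (n ^ (w + 1))) hinit
    (fun h => by rw [show widthOf ⟨n, n ^ (w + 1), inputMem G c⟩ = w + 1 from hwidth]; exact hwn h)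
    le_rfl (by omega)
  have hwidth' : widthOf ⟨n, n ^ (w + 1), inputMem G c⟩ = w + 1 := hwidth
  refine ⟨s'.tick, .seq x₁ (.seq x₂ (.seq x₃ (.seq x₄ x₅))), ?_, fun B => ?_, ?_⟩
  · rw [tick_log, hI.log]
    refine List.Nodup.map_on ?_ List.nodup_range
    intro i hi j hj e
    exact hI.store.inj i (List.mem_range.1 hi) j (List.mem_range.1 hj) e
  · rw [tick_log, hI.mem_iff (by rw [hwidth']; exact hA) (by rw [hwidth'])]
    exact h𝓢 B
  · exact hI.chain _ (by simp)

end RAM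

/-! ### From sets of numbers to sets of vertices; numbering of fibres -/

theorem Assignment.sol_iff {n : ℕ} {A : Assignment n} {X : Finset ℕ} :
    A.Sol X ↔ ∃ F : {d : ℕ × ℕ // A.Real d} → ℕ × ℕ, Function.Injective F ∧
      ∀ d : {d : ℕ × ℕ // A.Real d}, A.Allow d (F d) ∧ (F d).1 ∈ X := by
  classical
  constructor
  · rintro ⟨f, ⟨hf, hfi⟩, hX⟩
    exact ⟨fun d => f d, fun a b e => Subtype.ext (hfi a.2 b.2 e), fun d => ⟨hf d d.2, hX d d.2⟩⟩
  · rintro ⟨F, hF, hFX⟩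
    have e : ∀ d (h : A.Real d), (if h : A.Real d then F ⟨d, h⟩ else (0, 0)) = F ⟨d, h⟩ :=
      fun d h => dif_pos h
    refine ⟨fun d => if h : A.Real d then F ⟨d, h⟩ else (0, 0), ⟨fun d hd => ?_, ?_⟩, fun d hd => ?_⟩
    · dsimp only; rw [e d hd]; exact (hFX ⟨d, hd⟩).1
    · intro a ha b hb hab
      dsimp only at hab
      rw [e a ha, e b hb] at hab
      exact congrArg Subtype.val (hF hab)
    · dsimp only; rw [e d hd]; exact (hFX ⟨d, hd⟩).2

/-- Sets of vertices as sets of numbers. -/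
theorem Assignment.minSol_iff {n : ℕ} {A : Assignment n} {P : Finset (Fin n) → Prop}
    (h : ∀ X, A.Sol (X.map Fin.valEmbedding) ↔ P X) (B : Finset ℕ) :
    A.MinSol B ↔ ∃ X ∈ {X | Minimal P X}, X.map Fin.valEmbedding = B := by
  have hmap : ∀ B ⊆ Finset.range n, ∃ X : Finset (Fin n), X.map Fin.valEmbedding = B := by
    intro B hB
    refine ⟨Finset.univ.filter fun v => (v : ℕ) ∈ B, ?_⟩
    ext x
    simp only [Finset.mem_map, Finset.mem_filter, Finset.mem_univ, true_and, Fin.valEmbedding_apply]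
    constructor
    · rintro ⟨v, hv, rfl⟩; exact hv
    · intro hx; exact ⟨⟨x, Finset.mem_range.1 (hB hx)⟩, hx, rfl⟩
  constructor
  · rintro ⟨hB, hs, hmin⟩
    obtain ⟨X, rfl⟩ := hmap B hB
    refine ⟨X, ⟨(h X).1 hs, fun Y hY hYX => ?_⟩, rfl⟩
    exact (Finset.map_injective _ (hmin _ (Finset.map_subset_map.2 hYX) ((h Y).2 hY))).ge
  · rintro ⟨X, hX, rfl⟩
    have hXn : X.map Fin.valEmbedding ⊆ Finset.range n := by
      intro x hx
      obtain ⟨v, -, rfl⟩ := Finset.mem_map.1 hx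
      exact Finset.mem_range.2 v.2
    refine ⟨hXn, (h X).2 hX.1, fun Y hY hs => ?_⟩
    obtain ⟨Y, rfl⟩ := hmap Y (hY.trans hXn)
    have hYX := Finset.map_subset_map.1 hY
    rw [le_antisymm hYX (hX.2 ((h Y).1 hs) hYX)]

/-- Numbering each fibre from 0 turns "at most `c v` objects are sent to `v`" into distinct slots
`(v, i)` with `i < c v`. -/
theorem exists_rank {α β : Type*} [Finite α] (g : α → β) : ∃ rank : α → ℕ,
    (∀ a, rank a < Nat.card {b // g b = g a}) ∧ ∀ a b, g a = g b → rank a = rank b → a = b := by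
  refine ⟨fun a => Finite.equivFin {b // g b = g a} ⟨a, rfl⟩, fun a => Fin.is_lt _, ?_⟩
  intro a b hab h
  -- The numbering depends on the fibre as a type, so equality of values of `g` has to be
  -- transported before ranks can be compared.
  have key : ∀ y (hy : g a = y), ((Finite.equivFin {b // g b = g a} ⟨a, rfl⟩ : Fin _) : ℕ) =
      (Finite.equivFin {b // g b = y} ⟨a, hy⟩ : Fin _) := by
    rintro _ rfl; rfl
  dsimp only at h
  rw [key _ hab] at h
  exact congrArg Subtype.val ((Finite.equivFin _).injective (Fin.ext h))

theorem card_fiber_le {α : Type*} {p : α → Prop} (rank : α → ℕ) {k : ℕ}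
    (h1 : ∀ a, p a → rank a < k) (h2 : ∀ a b, p a → p b → rank a = rank b → a = b) :
    Nat.card {a // p a} ≤ k := by
  have := Nat.card_le_card_of_injective (fun a : {a // p a} => (⟨rank a, h1 a a.2⟩ : Fin k))
    (fun a b e => Subtype.ext (h2 a b a.2 b.2 (congrArg Fin.val e)))
  simpa using this

/-! ### Capacities and degrees as read from the input -/

section Graph

variable {n : ℕ} (G : SimpleGraph (Fin n)) (c : Fin n → ℕ)

/-- Adjacency of numbers. -/
def adjNat (u w : ℕ) : Prop := ∃ (hu : u < n) (hw : w < n), G.Adj ⟨u, hu⟩ ⟨w, hw⟩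

variable {G} in
theorem adjNat.symm {u w : ℕ} (h : adjNat G u w) : adjNat G w u := by
  obtain ⟨hu, hw, h⟩ := h
  exact ⟨hw, hu, h.symm⟩

/-- The capacity of a number. -/
def capNat (v : ℕ) : ℕ := if h : v < n then c ⟨v, h⟩ else 0

theorem capNat_coe (v : Fin n) : capNat c v = c v := by simp [capNat]

theorem capNat_le (v : ℕ) : capNat c v ≤ Finset.univ.sup c := by
  unfold capNat
  split_ifs
  · exact Finset.le_sup (f := c) (Finset.mem_univ _)
  · exact Nat.zero_le _

variable [DecidableRel G.Adj]

theorem inputMem_cap {v : ℕ} (hv : v < n) : RAM.inputMem G c v = capNat c v := by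
  simp [RAM.inputMem, capNat, Nat.mod_eq_of_lt hv, Nat.div_eq_of_lt hv, hv]

theorem inputMem_adj {u w : ℕ} (hu : u < n) (hw : w < n) :
    0 < RAM.inputMem G c ((u + 1) * n + w) ↔ adjNat G u w := by
  have h1 : ((u + 1) * n + w) % n = w := by
    rw [Nat.mul_comm, Nat.mul_add_mod, Nat.mod_eq_of_lt hw]
  have h2 : ((u + 1) * n + w) / n = u + 1 := by
    rw [Nat.mul_comm, Nat.mul_add_div (by omega), Nat.div_eq_of_lt hw, add_zero]
  simp only [RAM.inputMem, h1, h2, adjNat]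
  by_cases h : G.Adj ⟨u, hu⟩ ⟨w, hw⟩ <;> simp [hu, hw, h]

open Classical in
theorem card_adjNat (v : Fin n) : ((Finset.range n).filter (adjNat G v)).card = G.degree v := by
  rw [← SimpleGraph.card_neighborFinset_eq_degree, ← Finset.card_map Fin.valEmbedding]
  congr 1
  ext w
  simp only [Finset.mem_filter, Finset.mem_range, Finset.mem_map, SimpleGraph.mem_neighborFinset,
    Fin.valEmbedding_apply]
  constructor
  · rintro ⟨-, _, hw, hvw⟩; exact ⟨⟨w, hw⟩, hvw, rfl⟩
  · rintro ⟨w, hvw, rfl⟩; exact ⟨w.2, v.2, w.2, hvw⟩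

open Classical in
theorem card_adjNat_le (v : ℕ) : ((Finset.range n).filter (adjNat G v)).card ≤ G.maxDegree := by
  by_cases hv : v < n
  · exact (card_adjNat G ⟨v, hv⟩).trans_le (G.degree_le_maxDegree _)
  · rw [Finset.filter_false_of_mem]
    · simp
    · rintro w - ⟨h, -⟩; exact hv h

theorem widthOf_input (R : ℕ) : RAM.widthOf ⟨n, R, RAM.inputMem G c⟩ =
    min (Finset.univ.sup c) G.maxDegree + 1 := by
  classical
  have h1 : (Finset.range n).sup (RAM.inputMem G c) = Finset.univ.sup c := by
    apply le_antisymm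
    · refine Finset.sup_le fun v hv => ?_
      rw [inputMem_cap G c (Finset.mem_range.1 hv)]
      exact capNat_le c v
    · refine Finset.sup_le fun v _ => ?_
      rw [← capNat_coe c v, ← inputMem_cap G c v.2]
      exact Finset.le_sup (f := RAM.inputMem G c) (Finset.mem_range.2 v.2)
  have h2 : ∀ u < n, RAM.inputDeg ⟨n, R, RAM.inputMem G c⟩ u =
      ((Finset.range n).filter (adjNat G u)).card := by
    intro u hu
    refine congrArg Finset.card (Finset.filter_congr fun w hw => ?_)
    exact inputMem_adj G c hu (Finset.mem_range.1 hw)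
  have h3 : (Finset.range n).sup (RAM.inputDeg ⟨n, R, RAM.inputMem G c⟩) = G.maxDegree := by
    apply le_antisymm
    · refine Finset.sup_le fun u hu => ?_
      rw [h2 u (Finset.mem_range.1 hu)]
      exact card_adjNat_le G u
    · refine G.maxDegree_le_of_forall_degree_le _ fun v => ?_
      rw [← card_adjNat, ← h2 v v.2]
      exact Finset.le_sup (f := RAM.inputDeg ⟨n, R, RAM.inputMem G c⟩) (Finset.mem_range.2 v.2)
  simp only [RAM.widthOf, h1, h3]

/-- It ensures that the width, which is one larger, is at most `n`, so that the digits fit into `n`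
cells. -/
theorem min_maxDegree_lt (hn : 0 < n) : min (Finset.univ.sup c) G.maxDegree < n := by
  refine (min_le_right _ _).trans_lt ?_
  have : Nonempty (Fin n) := ⟨⟨0, hn⟩⟩
  simpa using G.maxDegree_lt_card_verts

end Graph

/-! ### Vertex covers and dominating sets as assignments -/

namespace RAM

/-- If `a = b` then `x` else `y`. -/
def Ex.ifEq (a b x y : Ex) : Ex := .ite a b y (.ite b a y x)

theorem Ex.eval_ifEq (ρ : Env) (σ : HState) (a b x y : Ex) : (Ex.ifEq a b x y).eval ρ σ =
    if a.eval ρ σ = b.eval ρ σ then x.eval ρ σ else y.eval ρ σ := by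
  simp only [ifEq, eval]
  split_ifs <;> first | rfl | omega

/-- The demands of a vertex cover. -/
def coverReal : Ex :=
  .ite (.var .demU) (.var .demW) (.inp (.succ (.var .demU)) (.var .demW)) (.const 0)

/-- The slots of a vertex cover. -/
def coverAllow : Ex :=
  .ite (.var .slotI) (.inp (.const 0) (.var .slotV))
    (.ifEq (.var .slotV) (.var .curU) (.const 1)
      (.ifEq (.var .slotV) (.var .curW) (.const 1) (.const 0))) (.const 0)

/-- The demands of a dominating set. -/
def domReal : Ex := .ifEq (.var .demU) (.var .demW) (.const 1) (.const 0)

/-- The slots of a dominating set. -/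
def domAllow : Ex :=
  .ite (.const 0) (.var .slotI)
    (.ite (.var .slotI) (.succ (.inp (.const 0) (.var .slotV)))
      (.inp (.succ (.var .slotV)) (.var .curW)) (.const 0))
    (.ifEq (.var .slotV) (.var .curW) (.const 1) (.const 0))

end RAM

section Problems

variable {n : ℕ} (G : SimpleGraph (Fin n)) (c : Fin n → ℕ)

/-- Edges are to be assigned to their end vertices. -/
def coverAssignment : Assignment n where
  Real d := d.1 < d.2 ∧ adjNat G d.1 d.2
  Allow d j := j ∈ grid n ∧ j.2 < capNat c j.1 ∧ (j.1 = d.1 ∨ j.1 = d.2)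
  real_mem := fun _ ⟨_, h1, h2, _⟩ => mem_grid.2 ⟨h1, h2⟩
  allow_mem := fun _ _ h => h.1

/-- Vertices are to be assigned to themselves or to neighbours. -/
def domAssignment : Assignment n where
  Real d := d ∈ grid n ∧ d.1 = d.2
  Allow d j := j ∈ grid n ∧
    (j.2 = 0 ∧ j.1 = d.2 ∨ 0 < j.2 ∧ j.2 ≤ capNat c j.1 ∧ adjNat G j.1 d.2)
  real_mem := fun _ h => h.1
  allow_mem := fun _ _ h => h.1

theorem coverAssignment_expresses [DecidableRel G.Adj] (R : ℕ) :
    RAM.Expresses ⟨n, R, RAM.inputMem G c⟩ RAM.coverReal RAM.coverAllow (coverAssignment G c) where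
  real σ hu hw := by
    have hu' : σ.var .demU < n := hu
    have hw' : σ.var .demW < n := hw
    simp only [RAM.coverReal, RAM.Ex.eval, coverAssignment, RAM.min_var hw',
      show min (σ.var .demU + 1) (n + 2) = σ.var .demU + 1 by omega]
    split_ifs with h
    · simp [h, inputMem_adj G c hu' hw']
    · simp [h]
  allow σ hu hw hv hi := by
    have hv' : σ.var .slotV < n := hv
    have hi' : σ.var .slotI < n := hi
    simp only [RAM.coverAllow, RAM.Ex.eval, RAM.Ex.eval_ifEq, coverAssignment, RAM.min_var hv',
      Nat.zero_min, Nat.zero_mul, Nat.zero_add, inputMem_cap G c hv', mem_grid]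
    by_cases h1 : σ.var .slotI < capNat c (σ.var .slotV)
    · rw [if_pos h1]
      simp only [hv', hi', h1, true_and]
      by_cases h2 : σ.var .slotV = σ.var .curU
      · simp [h2]
      · by_cases h3 : σ.var .slotV = σ.var .curW <;> simp [h2, h3]
    · simp [h1]

theorem domAssignment_expresses [DecidableRel G.Adj] (R : ℕ) :
    RAM.Expresses ⟨n, R, RAM.inputMem G c⟩ RAM.domReal RAM.domAllow (domAssignment G c) where
  real σ hu hw := by
    have hu' : σ.var .demU < n := hu
    have hw' : σ.var .demW < n := hw
    simp only [RAM.domReal, RAM.Ex.eval, RAM.Ex.eval_ifEq, domAssignment, mem_grid]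
    split_ifs with h <;> simp [h, hw']
  allow σ hu hw hv hi := by
    have hw' : σ.var .curW < n := hw
    have hv' : σ.var .slotV < n := hv
    have hi' : σ.var .slotI < n := hi
    simp only [RAM.domAllow, RAM.Ex.eval, RAM.Ex.eval_ifEq, domAssignment, RAM.min_var hv',
      RAM.min_var hw', show min (σ.var .slotV + 1) (n + 2) = σ.var .slotV + 1 by omega,
      Nat.zero_min, Nat.zero_mul, Nat.zero_add, inputMem_cap G c hv', mem_grid]
    by_cases h0 : 0 < σ.var .slotI
    · rw [if_pos h0]
      by_cases h1 : σ.var .slotI < capNat c (σ.var .slotV) + 1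
      · rw [if_pos h1, inputMem_adj G c hv' hw']
        simp [hv', hi', h0, h0.ne', Nat.lt_succ_iff.1 h1]
      · rw [if_neg h1]
        simp only [lt_irrefl, false_iff]
        rintro ⟨-, h | h⟩ <;> omega
    · rw [if_neg h0]
      obtain h0 : σ.var .slotI = 0 := by omega
      split_ifs with h <;> simp [h, h0, hw', (Nat.zero_le _).trans_lt hv']

theorem Finset.card_le_of_snd {D : Finset (ℕ × ℕ)} {f : ℕ × ℕ → ℕ × ℕ} {v k : ℕ}
    (hf : Set.InjOn f D) (h : ∀ d ∈ D, (f d).1 = v ∧ (f d).2 < k) : D.card ≤ k := by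
  have := Finset.card_le_card_of_injOn (s := D) (t := Finset.range k) (fun d => (f d).2)
    (fun d hd => Finset.mem_coe.2 (Finset.mem_range.2 (h d hd).2)) (fun a ha b hb e =>
      hf ha hb (Prod.ext ((h a ha).1.trans (h b hb).1.symm) e))
  simpa using this

/-- The edges served by a vertex occupy distinct slots below its capacity and have distinct other
ends. The summand 1 is slack here; it allows both problems to use the same width. -/
theorem coverAssignment_bounded [DecidableRel G.Adj] :
    (coverAssignment G c).Bounded (min (Finset.univ.sup c) G.maxDegree + 1) := by
  classical
  rintro f ⟨hf, hfi⟩ v D hD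
  refine le_trans (le_min ?_ ?_) (Nat.le_succ _)
  · refine Finset.card_le_of_snd (hfi.mono fun d hd => (hD d hd).1) fun d hd =>
      ⟨(hD d hd).2, (hf d (hD d hd).1).2.1.trans_le (capNat_le c _)⟩
  · refine le_trans ?_ (card_adjNat_le G v)
    have key : ∀ d ∈ D, d.1 < d.2 ∧ adjNat G d.1 d.2 ∧ (v = d.1 ∨ v = d.2) := fun d hd =>
      ⟨(hD d hd).1.1, (hD d hd).1.2, (hD d hd).2 ▸ (hf d (hD d hd).1).2.2⟩
    refine Finset.card_le_card_of_injOn (fun d => if v = d.1 then d.2 else d.1) ?_ ?_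
    · intro d hd
      obtain ⟨-, h2, h3⟩ := key d hd
      simp only [Finset.coe_filter, Set.mem_ofPred_eq, Finset.mem_range]
      split_ifs with h
      · rw [h]; exact ⟨h2.2.1, h2⟩
      · rw [h3.resolve_left h]; exact ⟨h2.1, h2.symm⟩
    · intro a ha b hb e
      obtain ⟨h1, -, h3⟩ := key a ha
      obtain ⟨h1', -, h3'⟩ := key b hb
      dsimp only at e
      split_ifs at e <;> exact Prod.ext (by omega) (by omega)

/-- Here the summand 1 accounts for the vertex itself: it has slot 0 besides its capacity, and
serves within its closed neighbourhood. -/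
theorem domAssignment_bounded [DecidableRel G.Adj] :
    (domAssignment G c).Bounded (min (Finset.univ.sup c) G.maxDegree + 1) := by
  classical
  rintro f ⟨hf, hfi⟩ v D hD
  rw [← min_add_add_right]
  refine le_min ?_ ?_
  · refine Finset.card_le_of_snd (hfi.mono fun d hd => (hD d hd).1) fun d hd =>
      ⟨(hD d hd).2, ?_⟩
    have := capNat_le c (f d).1
    rcases (hf d (hD d hd).1).2 with h | h <;> omega
  · refine le_trans ?_ (Nat.succ_le_succ (card_adjNat_le G v))
    refine le_trans ?_ (Finset.card_insert_le v _)
    refine Finset.card_le_card_of_injOn Prod.snd ?_ ?_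
    · intro d hd
      obtain ⟨hr, hv⟩ := hD d hd
      rcases (hf d hr).2 with h | h
      · rw [← h.2, hv]; exact Finset.mem_insert_self _ _
      · refine Finset.mem_insert_of_mem (Finset.mem_filter.2 ⟨?_, hv ▸ h.2.2⟩)
        exact Finset.mem_range.2 h.2.2.2.1
    · intro a ha b hb e
      exact Prod.ext ((hD a ha).1.2.trans (e.trans (hD b hb).1.2.symm)) e

/-- The edges correspond to the demands. -/
theorem exists_edgeEquiv : ∃ E : {d : ℕ × ℕ // (coverAssignment G c).Real d} ≃ G.edgeSet,
    ∀ d, ∃ (hu : d.1.1 < n) (hw : d.1.2 < n), (E d : Sym2 (Fin n)) = s(⟨_, hu⟩, ⟨_, hw⟩) := by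
  let E : {d : ℕ × ℕ // (coverAssignment G c).Real d} → G.edgeSet := fun d =>
    ⟨s(⟨d.1.1, d.2.2.1⟩, ⟨d.1.2, d.2.2.2.1⟩), d.2.2.2.2⟩
  refine ⟨Equiv.ofBijective E ⟨?_, ?_⟩, fun d => ⟨d.2.2.1, d.2.2.2.1, rfl⟩⟩
  · rintro ⟨⟨u, w⟩, h, h1, h2, _⟩ ⟨⟨u', w'⟩, h', h1', h2', _⟩ e
    have e := congrArg Subtype.val e
    simp only [E, Sym2.eq_iff, Fin.mk.injEq] at e
    dsimp only at h h'
    exact Subtype.ext (Prod.ext (by dsimp only; omega) (by dsimp only; omega))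
  · rintro ⟨e, he⟩
    induction e with
    | h u w =>
      have hne : (u : ℕ) ≠ w := fun h => G.ne_of_adj he (Fin.ext h)
      rcases lt_or_gt_of_ne hne with h | h
      · exact ⟨⟨(u, w), h, u.2, w.2, he⟩, rfl⟩
      · exact ⟨⟨(w, u), h, w.2, u.2, he.symm⟩, Subtype.ext Sym2.eq_swap⟩

/-- An edge sent to `v` takes the slot of `v` given by its rank among the edges sent there;
conversely, slot numbers below `c v` bound the size of each fibre. -/
theorem coverAssignment_sol (X : Finset (Fin n)) :
    (coverAssignment G c).Sol (X.map Fin.valEmbedding) ↔ IsCapacitatedVertexCover G c X := by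
  rw [Assignment.sol_iff]
  obtain ⟨E, hE⟩ := exists_edgeEquiv G c
  constructor
  · rintro ⟨F, hF, hFX⟩
    have h : ∀ e, ∃ v : X, ((v : Fin n) : ℕ) = (F (E.symm e)).1 := fun e => by
      obtain ⟨v, hv, e⟩ := Finset.mem_map.1 (hFX (E.symm e)).2
      exact ⟨⟨v, hv⟩, e⟩
    choose α hα using h
    refine ⟨α, fun e => ?_, fun v => card_fiber_le (fun e => (F (E.symm e)).2) ?_ ?_⟩
    · obtain ⟨hu, hw, he⟩ := hE (E.symm e)
      rw [E.apply_symm_apply] at he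
      rw [he, Sym2.mem_iff, Fin.ext_iff, Fin.ext_iff, hα]
      exact (hFX (E.symm e)).1.2.2
    · rintro e rfl
      rw [← capNat_coe c, hα]
      exact (hFX (E.symm e)).1.2.1
    · intro a b ha hb e
      refine E.symm.injective (hF (Prod.ext ?_ e))
      rw [← hα, ← hα, ha, hb]
  · rintro ⟨α, hα, hc⟩
    obtain ⟨rank, h1, h2⟩ := exists_rank α
    -- Slot numbers must lie in the grid whatever the capacity. Edges with a common end are told
    -- apart by their other ends, so fewer than `n + 1` of them share a vertex.
    have h3 : ∀ e, rank e < n := fun e => (h1 e).trans_le <|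
      card_fiber_le (fun b => ((Sym2.Mem.other (hα b) : Fin n) : ℕ)) (fun b _ => Fin.is_lt _) <| by
        intro a b ha hb hab
        refine Subtype.ext ?_
        calc (a : Sym2 (Fin n)) = s((α a : Fin n), Sym2.Mem.other (hα a)) :=
              (Sym2.other_spec (hα a)).symm
          _ = s((α b : Fin n), Sym2.Mem.other (hα b)) :=
              congrArg₂ (fun x y => s(x, y)) (congrArg Subtype.val (ha.trans hb.symm)) (Fin.ext hab)
          _ = b := Sym2.other_spec (hα b)
    refine ⟨fun d => (((α (E d) : Fin n) : ℕ), rank (E d)), fun a b e => ?_, fun d =>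
      ⟨⟨mem_grid.2 ⟨Fin.is_lt _, h3 _⟩, ?_, ?_⟩, Finset.mem_map.2 ⟨_, (α (E d)).2, rfl⟩⟩⟩
    · simp only [Prod.mk.injEq] at e
      exact E.injective (h2 _ _ (Subtype.ext (Fin.ext e.1)) e.2)
    · rw [capNat_coe]
      exact (h1 _).trans_le (hc _)
    · obtain ⟨hu, hw, he⟩ := hE d
      have := hα (E d)
      rw [he, Sym2.mem_iff, Fin.ext_iff, Fin.ext_iff] at this
      exact this

/-- Members of `X` can always use their own slot 0, which costs no capacity. A vertex outside `X`
cannot use a slot 0 of `X`, since that slot serves only its owner; it gets a slot of positive number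
at a neighbour. -/
theorem domAssignment_sol (X : Finset (Fin n)) :
    (domAssignment G c).Sol (X.map Fin.valEmbedding) ↔ IsCapacitatedDominatingSet G c X := by
  classical
  rw [Assignment.sol_iff]
  constructor
  · rintro ⟨F, hF, hFX⟩
    let E : Fin n → {d : ℕ × ℕ // (domAssignment G c).Real d} := fun w =>
      ⟨(w, w), mem_grid.2 ⟨w.2, w.2⟩, rfl⟩
    have hE : Function.Injective E := fun a b e =>
      Fin.ext (congrArg (fun d : {d : ℕ × ℕ // (domAssignment G c).Real d} => d.1.1) e)
    have h : ∀ w : {w // w ∉ X}, ∃ v : X, ((v : Fin n) : ℕ) = (F (E w)).1 := fun w => by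
      obtain ⟨v, hv, e⟩ := Finset.mem_map.1 (hFX (E w)).2
      exact ⟨⟨v, hv⟩, e⟩
    choose β hβ using h
    have key : ∀ w : {w // w ∉ X}, 0 < (F (E w)).2 ∧ (F (E w)).2 ≤ c (β w) ∧
        G.Adj (w : Fin n) (β w) := by
      intro w
      rcases (hFX (E w)).1.2 with ⟨-, h⟩ | ⟨h1, h2, h3⟩
      · refine absurd (β w).2 ?_
        rw [show (β w : Fin n) = w from Fin.ext ((hβ w).trans h)]
        exact w.2
      · rw [← hβ] at h2 h3
        rw [capNat_coe] at h2
        exact ⟨h1, h2, h3.symm.2.2⟩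
    refine ⟨β, fun w => (key w).2.2, fun v =>
      card_fiber_le (fun w : {w // w ∉ X} => (F (E w)).2 - 1) ?_ ?_⟩
    · rintro w rfl
      have := key w
      omega
    · intro a b ha hb e
      have h1 := key a
      have h2 := key b
      refine Subtype.ext (hE (hF (Prod.ext ?_ (by omega))))
      rw [← hβ, ← hβ, ha, hb]
  · rintro ⟨β, hβ, hc⟩
    obtain ⟨rank, h1, h2⟩ := exists_rank β
    -- Positive slots are shifted by one and must still fit into the grid. They do, since no vertex
    -- is its own neighbour and each fibre has at most `n - 1` elements.
    have h3 : ∀ w, rank w + 1 < n := fun w => by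
      have h4 : Nat.card {b // β b = β w} ≤ Nat.card {x : Fin n // x ≠ β w} :=
        Nat.card_le_card_of_injective
          (fun b => ⟨b.1.1, fun e => G.ne_of_adj (hβ b.1) (e.trans (by rw [b.2]))⟩)
          fun a b e => Subtype.ext (Subtype.ext (congrArg (fun x : {x : Fin n // x ≠ β w} => x.1) e))
      have h5 := Finite.card_subtype_lt (p := fun x : Fin n => x ≠ β w) (x := β w) (by simp)
      have h6 := h1 w
      rw [Nat.card_fin] at h5
      omega
    let f : Fin n → ℕ × ℕ := fun w =>
      if h : w ∈ X then (w, 0) else ((β ⟨w, h⟩ : Fin n), rank ⟨w, h⟩ + 1)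
    have f1 : ∀ w, w ∈ X → f w = (↑w, 0) := fun w h => dif_pos h
    have f2 : ∀ w (h : w ∉ X), f w = (((β ⟨w, h⟩ : Fin n) : ℕ), rank ⟨w, h⟩ + 1) :=
      fun w h => dif_neg h
    have fi : Function.Injective f := by
      intro a b e
      by_cases ha : a ∈ X <;> by_cases hb : b ∈ X
      · rw [f1 a ha, f1 b hb, Prod.mk.injEq] at e
        exact Fin.ext e.1
      · rw [f1 a ha, f2 b hb, Prod.mk.injEq] at e
        omega
      · rw [f2 a ha, f1 b hb, Prod.mk.injEq] at e
        omega
      · rw [f2 a ha, f2 b hb, Prod.mk.injEq] at e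
        exact congrArg Subtype.val (h2 ⟨a, ha⟩ ⟨b, hb⟩ (Subtype.ext (Fin.ext e.1)) (by omega))
    have hn : ∀ d : {d : ℕ × ℕ // (domAssignment G c).Real d}, d.1.2 < n :=
      fun d => (mem_grid.1 d.2.1).2
    refine ⟨fun d => f ⟨d.1.2, hn d⟩, fun a b e => ?_, fun d => ?_⟩
    · have e' : a.1.2 = b.1.2 := congrArg Fin.val (fi e)
      exact Subtype.ext (Prod.ext (a.2.2.trans (e'.trans b.2.2.symm)) e')
    · by_cases h : (⟨d.1.2, hn d⟩ : Fin n) ∈ X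
      · dsimp only
        rw [f1 _ h]
        exact ⟨⟨mem_grid.2 ⟨hn d, (Nat.zero_le _).trans_lt (hn d)⟩, Or.inl ⟨rfl, rfl⟩⟩,
          Finset.mem_map.2 ⟨_, h, rfl⟩⟩
      · dsimp only
        rw [f2 _ h]
        refine ⟨⟨mem_grid.2 ⟨Fin.is_lt _, h3 _⟩, Or.inr ⟨Nat.succ_pos _, ?_, ?_⟩⟩,
          Finset.mem_map.2 ⟨_, (β ⟨_, h⟩).2, rfl⟩⟩
        · rw [capNat_coe]
          exact (h1 _).trans_le (hc _)
        · exact ⟨Fin.is_lt _, hn d, (hβ ⟨_, h⟩).symm⟩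

end Problems

/-! ### The two enumeration results -/

theorem min_maxDegree_le {n : ℕ} (G : SimpleGraph (Fin n)) (c : Fin n → ℕ) [DecidableRel G.Adj] :
    min (Finset.univ.sup c) G.maxDegree ≤ n := by
  rcases Nat.eq_zero_or_pos n with rfl | h
  · simp
  · exact (min_maxDegree_lt G c h).le

theorem theorem6p3 :
    (∃ (p : RAM.Prog) (k : ℕ), ∀ (n : ℕ) (G : SimpleGraph (Fin n)) [DecidableRel G.Adj]
      (c : Fin n → ℕ),
      RAM.EnumeratesWithDelay p G c {X | Minimal (IsCapacitatedVertexCover G c) X}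
        (max n 2 ^ (min (Finset.univ.sup c) G.maxDegree + k))) ∧
    (∃ (p : RAM.Prog) (k : ℕ), ∀ (n : ℕ) (G : SimpleGraph (Fin n)) [DecidableRel G.Adj]
      (c : Fin n → ℕ),
      RAM.EnumeratesWithDelay p G c {X | Minimal (IsCapacitatedDominatingSet G c) X}
        (max n 2 ^ (min (Finset.univ.sup c) G.maxDegree + k))) := by
  obtain ⟨k, hk⟩ := RAM.enumerate_spec RAM.coverReal RAM.coverAllow
  obtain ⟨l, hl⟩ := RAM.enumerate_spec RAM.domReal RAM.domAllow
  exact ⟨⟨_, k, fun n G _ c => hk n G c (coverAssignment G c) _ _ (coverAssignment_expresses G c)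
      (widthOf_input G c 0) (coverAssignment_bounded G c) (min_maxDegree_le G c)
      (min_maxDegree_lt G c) (Assignment.minSol_iff (coverAssignment_sol G c))⟩,
    ⟨_, l, fun n G _ c => hl n G c (domAssignment G c) _ _ (domAssignment_expresses G c)
      (widthOf_input G c 0) (domAssignment_bounded G c) (min_maxDegree_le G c)
      (min_maxDegree_lt G c) (Assignment.minSol_iff (domAssignment_sol G c))⟩⟩
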